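/- Consider the holomorphic system $\dot x=F_1(x,y,z),\ \dot y=F_2(x,y,z),\ \dot z=F_3(x,y,z)$, where $F=(F_1,F_2,F_3)$ is holomorphic near the origin of $\mathbb C^3$ and $F(0)=0$. Assume that its linear part $\Lambda$ at the origin satisfies $$\Lambda e_x=i\omega_1e_x,\qquad \Lambda e_y=i\omega_1e_y+\varepsilon e_x,\qquad \Lambda e_z=i\omega_2e_z,$$ where $\omega_1,\omega_2\in\mathbb R\setminus\{0\}$ and $\varepsilon\in\mathbb C\setminus\{0\}$. (So $\Lambda$ has the double eigenvalue $i\omega_1$ with a $2\times2$ Jordan block on the $(x,y)$-plane, with the $x$-axis as its eigenline, and the further eigenvalue $i\omega_2$ on the $z$-axis; $\omega_1=\omega_2$ is allowed.) For a coordinate subspace $E$ (the $x$-, $y$- or $z$-axis, or the $(x,z)$-plane), an $E$-invariant holomorphic center manifold is a germ at the origin of a complex submanifold $M\ni 0$ that is locally invariant under the system and has tangent space $T_0M=E$. It contains an isochronous center family of period $T$ if the points of $M\setminus\{0\}$ near the origin lie on periodic orbits of least period $T$ that are contained in $M$ and shrink to the origin. Definition of $\bar r$. Let $k$ be the coordinate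 $x$ or $z$. Parametrize curves tangent to the $k$-axis by the $k$-coordinate $\xi$, and write the other two coordinates, in order, as $\xi w_1,\xi w_2$. With $F$ evaluated along the curve, the system becomes the Briot–Bouquet system $\xi w'=\Phi(\xi,w)$, where $\Phi_j=\dfrac{F_j/\xi}{F_k/\xi}-w_j$ ($F_j$ being the component of $F$ that belongs to $w_j$). For $\Phi(\xi,w)=b\,\xi+Aw+O(2)$, a reduction step is the substitution $w=\xi(\tilde w+(1-A)^{-1}b)$, which again gives a Briot–Bouquet system. For an integer $n\ge2$ let $\bar r_k(n)$ be the coefficient of $\xi$ in the second equation after $n-2$ reduction steps applied to $\Phi$. (When $\omega_2/\omega_1=n$, the resulting matrix $A$ for $k=x$ is $\mathrm{diag}(2-n,1)$; when $\omega_1/\omega_2=n$, for $k=z$ it is $\begin{pmatrix}1&\varepsilon/(i\omega_2)\\0&1\end{pmatrix}$.) Then, with $\mathbb N=\{1,2,\dots\}$: 1) There is no $y$-invariant holomorphic center manifold. 2) If $\omega_2/\omega_1\notin\mathbb N$, there is a unique $x$-invariant holomorphic center manifold, and it contains an isochronous center family of period $2\pi/|\omega_1|$. 3) If $\omega_1/\omega_2\notin\mathbb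 N$, there is a unique $z$-invariant holomorphic center manifold, and it contains an isochronous center family of period $2\pi/|\omega_2|$. 4) If $\omega_1=\omega_2$, there is a unique $(x,z)$-invariant holomorphic center manifold (tangent to the $(x,z)$-plane, of complex dimension two), and it contains an isochronous center family of period $2\pi/|\omega_1|$. 5) If $n=\omega_2/\omega_1\in\mathbb N\setminus\{1\}$: when $\bar r_x(n)=0$ there are infinitely many $x$-invariant holomorphic center manifolds, each of which contains an isochronous center family of period $2\pi/|\omega_1|$; when $\bar r_x(n)\neq0$ there is none. 6) If $n=\omega_1/\omega_2\in\mathbb N\setminus\{1\}$: when $\bar r_z(n)=0$ there are infinitely many $z$-invariant holomorphic center manifolds, each of which contains an isochronous center family of period $2\pi/|\omega_2|$; when $\bar r_z(n)\neq0$ there is none. -/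

import Mathlib

open Complex Filter Topology

/-- The phase space `ℂ³`; the coordinates `x, y, z` have the indices `0, 1, 2`. -/
abbrev C3 : Type := Fin 3 → ℂ

/-- The projection of `ℂ³` onto the subspace spanned by the coordinate axes with index in `S`. -/
def coordProj (S : Finset (Fin 3)) (p : C3) : C3 := fun i => if i ∈ S then p i else 0

/-- Near the origin, `M` is a complex submanifold of `ℂ³` through the origin whose tangent space
there is the span of the coordinate axes with index in `S`: it is the graph, over that span, of a
holomorphic map that vanishes to second order. -/
def IsHolSubmanifoldTangentTo (S : Finset (Fin 3)) (M : Set C3) : Prop :=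
  ∃ ψ : C3 → C3, AnalyticAt ℂ ψ 0 ∧ ψ 0 = 0 ∧ fderiv ℂ ψ 0 = 0 ∧
    ∀ᶠ p in 𝓝 (0 : C3), p ∈ M ↔ ∀ j, j ∉ S → p j = ψ (coordProj S p) j

/-- Local invariance at the origin: there is a neighbourhood `U` of the origin such that a solution
that stays in `U` during a time interval and meets `M` stays in `M` during that interval. -/
def IsLocallyInvariant (F : C3 → C3) (M : Set C3) : Prop :=
  ∃ U ∈ 𝓝 (0 : C3), ∀ (γ : ℝ → C3) (J : Set ℝ), J.OrdConnected →
    IsIntegralCurveOn γ (fun _ => F) J → (∀ t ∈ J, γ t ∈ U) → ∀ s ∈ J, γ s ∈ M → ∀ t ∈ J, γ t ∈ M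

/-- `M` is an `S`-invariant holomorphic center manifold of `ẇ = F(w)` at the origin, that is, a
locally invariant complex submanifold tangent to the coordinate subspace given by `S`. Only the
germ of `M` at the origin matters. -/
def IsCenterManifold (F : C3 → C3) (S : Finset (Fin 3)) (M : Set C3) : Prop :=
  IsHolSubmanifoldTangentTo S M ∧ IsLocallyInvariant F M

/-- The germs at the origin of the `S`-invariant holomorphic center manifolds. -/
def centerManifoldGerms (F : C3 → C3) (S : Finset (Fin 3)) : Set ((𝓝 (0 : C3)).Germ Prop) :=
  {m | ∃ M : Set C3, IsCenterManifold F S M ∧ m = ((fun p => p ∈ M : C3 → Prop) : Germ _ Prop)}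

/-- `M` contains an isochronous center family of period `T`: every point of `M` other than the
origin, near the origin, lies on a periodic orbit of least period `T` that is contained in `M`, and
these orbits shrink to the origin. -/
def HasIsochronousCenterFamily (F : C3 → C3) (M : Set C3) (T : ℝ) : Prop :=
  0 < T ∧ ∀ V ∈ 𝓝 (0 : C3), ∃ U ∈ 𝓝 (0 : C3), ∀ p ∈ M ∩ U, p ≠ 0 →
    ∃ γ : ℝ → C3, γ 0 = p ∧ IsIntegralCurve γ (fun _ => F) ∧ (∀ t, γ t ∈ M ∩ V) ∧
      Function.Periodic γ T ∧ ∀ s, 0 < s → s < T → ¬ Function.Periodic γ s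

/-- There is exactly one germ of an `S`-invariant holomorphic center manifold, and it contains an
isochronous center family of period `T`. -/
def HasUniqueIsochronousCenterManifold (F : C3 → C3) (S : Finset (Fin 3)) (T : ℝ) : Prop :=
  ∃ M : Set C3, IsCenterManifold F S M ∧ HasIsochronousCenterFamily F M T ∧
    ∀ M' : Set C3, IsCenterManifold F S M' → M' =ᶠ[𝓝 (0 : C3)] M

/-- There are infinitely many germs of `S`-invariant holomorphic center manifolds, and each of them
contains an isochronous center family of period `T`. -/
def HasInfinitelyManyIsochronousCenterManifolds (F : C3 → C3) (S : Finset (Fin 3)) (T : ℝ) :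
    Prop :=
  (centerManifoldGerms F S).Infinite ∧
    ∀ M : Set C3, IsCenterManifold F S M → HasIsochronousCenterFamily F M T

noncomputable section

/-- `F(x • d) / x`, where `d` is the vector with `k`-th coordinate `1` and the remaining coordinates
`w`, in order; the value at `x = 0` is the derivative (here `F 0 = 0`). -/
def blowUp (F : C3 → C3) (k : Fin 3) (x : ℂ) (w : Fin 2 → ℂ) : C3 :=
  dslope (fun s : ℂ => F (s • (Fin.insertNth k (1 : ℂ) w : C3))) 0 x

/-- The right-hand side `Φ` of the Briot-Bouquet system `x w' = Φ(x, w)` that `ẇ = F(w)` induces on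
curves that are graphs over the `k`-th coordinate axis (with coordinate `x`), where the remaining
two coordinates are written, in order, as `x * w 0` and `x * w 1`. -/
def briotBouquet (F : C3 → C3) (k : Fin 3) (x : ℂ) (w : Fin 2 → ℂ) : Fin 2 → ℂ :=
  fun i => blowUp F k x w (k.succAbove i) / blowUp F k x w k - w i

/-- The coefficient of `x` in the linear part of `Φ` at the origin. -/
def xCoeff (Φ : ℂ → (Fin 2 → ℂ) → Fin 2 → ℂ) : Fin 2 → ℂ :=
  fun i => deriv (fun x => Φ x 0 i) 0

/-- The matrix of `w` in the linear part of `Φ` at the origin. -/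
def wMatrix (Φ : ℂ → (Fin 2 → ℂ) → Fin 2 → ℂ) : Matrix (Fin 2) (Fin 2) ℂ :=
  Matrix.of fun i j => deriv (fun s : ℂ => Φ 0 (Pi.single j s) i) 0

/-- One reduction step for `x w' = Φ(x, w)`, `Φ(x, w) = b x + A w + O(2)`: the substitution
`w = x (w̃ + c)` with `c = (1 - A)⁻¹ b` gives `x w̃' = Φ(x, x (w̃ + c)) / x - (w̃ + c)`, whose
linear part in `w̃` is `A - 1`. -/
def reduce (Φ : ℂ → (Fin 2 → ℂ) → Fin 2 → ℂ) : ℂ → (Fin 2 → ℂ) → Fin 2 → ℂ :=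
  fun x w i =>
    let c : Fin 2 → ℂ := (1 - wMatrix Φ)⁻¹.mulVec (xCoeff Φ)
    dslope (fun s : ℂ => Φ s (s • (w + c)) i) 0 x - (w i + c i)

/-- After `n - 2` reduction steps, the coefficient of `x` in the second equation of the
Briot-Bouquet system over the `k`-th coordinate axis. For `k = 0` the second equation belongs to
the coordinate `z`, for `k = 2` it belongs to `y`. -/
def rBar (F : C3 → C3) (k : Fin 3) (n : ℕ) : ℂ :=
  xCoeff (reduce^[n - 2] (briotBouquet F k)) 1

end

/-! A locally invariant graph is the same as a graph to which the vector field is tangent: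
differentiating a solution inside the graph gives tangency, and a Gronwall estimate for the distance
to the graph gives the converse (`isCenterManifold_iff`). The linearization of tangency at the
origin says that the tangent space is invariant under Λ. The y-axis is not, because of ε, which is
claim 1.

A graph over an axis is a curve, and after division by the coordinate ξ tangency becomes the
Briot–Bouquet system ξw' = Φ(ξ, w) with w(0) = 0. Its matrix A has the eigenvalues 0 and ω₂/ω₁ - 1
over the x-axis, and the double eigenvalue ω₁/ω₂ - 1 over the z-axis. The leading coefficient of the
difference of two solutions is an eigenvector of A for a positive integer, so without such
eigenvalues the solution is unique. A reduction step replaces A by A - 1; after N ≥ ‖A‖ steps the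
term Nw dominates the linear part and a contraction yields a solution. If the positive integer n - 1
is an eigenvalue, n - 2 reductions move it to 1. The first coefficient c of a solution must then
satisfy b + Ac = c. The second row of this system reads r̄ = 0; if it holds, one component of c is
free, and every choice extends to a solution because the next reduction is free of resonances.

Both existence results, for Briot–Bouquet systems and for Poincaré linearization, are instances of
the equation Dh(u)u + (p+1)h = R(u, h) (`exists_euler_solution`). The left side is inverted by g ↦
∫₀¹ s^p g(su) ds, which has norm at most 1/(p+m+1) on maps of order m.

If Λ is the scalar iω on the tangent space, the restricted field is linearizable, since iω never
equals a sum of at least two copies of itself. The flow is then conjugate to u ↦ exp(iωt)u, which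
gives the isochronous family. When ω₁ = ω₂, the scalar iω₁ occurs both on the (x,z)-plane and on its
quotient. Rescaling the quotient makes the nilpotent part of Λ small, so linearization yields a map
K whose image is the manifold. Every competing graph contains this image, by the leading-coefficient
argument along rays. -/

/-! ### Osgood's lemma: continuity and holomorphy along lines imply analyticity -/

/-- `f` is continuous on the ball of radius `r` and complex differentiable along complex lines. -/
def LineHol {E W : Type*} [NormedAddCommGroup E] [NormedSpace ℂ E] [NormedAddCommGroup W]
    [NormedSpace ℂ W] (f : E → W) (r : ℝ) : Prop :=
  ContinuousOn f (Metric.ball 0 r) ∧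
    ∀ u ∈ Metric.ball (0 : E) r, ∀ v, DifferentiableAt ℂ (fun σ : ℂ => f (u + σ • v)) 0

theorem LineHol.analyticAt_one {W : Type*} [NormedAddCommGroup W]
    [NormedSpace ℂ W] [CompleteSpace W] {f : ℂ → W} {r : ℝ} (hr : 0 < r) (h : LineHol f r) :
    AnalyticAt ℂ f 0 := by
  refine DifferentiableOn.analyticAt (s := Metric.ball 0 r) ?_ (Metric.ball_mem_nhds _ hr)
  intro u hu
  have h1 := h.2 u hu 1
  have h2 : DifferentiableAt ℂ ((fun σ : ℂ => f (u + σ • 1)) ∘ fun z => z - u) u := by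
    apply DifferentiableAt.comp
    · simpa using h1
    · fun_prop
  have h3 : ((fun σ : ℂ => f (u + σ • 1)) ∘ fun z => z - u) = f := by
    ext z; simp
  rw [h3] at h2
  exact h2.differentiableWithinAt

section TripleIntegral

variable {W : Type*} [NormedAddCommGroup W] [NormedSpace ℂ W]

/-- The iterated integral over `[0, 2π]³`. -/
noncomputable def tripleIntegral (H : ℝ × ℝ × ℝ → W) : W :=
  ∫ a in (0 : ℝ)..2 * Real.pi, ∫ b in (0 : ℝ)..2 * Real.pi, ∫ c in (0 : ℝ)..2 * Real.pi, H (a, b, c)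

theorem continuous_inner₁ {H : ℝ × ℝ × ℝ → W} (hH : Continuous H) :
    Continuous fun q : ℝ × ℝ => ∫ c in (0 : ℝ)..2 * Real.pi, H (q.1, q.2, c) :=
  intervalIntegral.continuous_parametric_intervalIntegral_of_continuous'
    (f := fun (q : ℝ × ℝ) c => H (q.1, q.2, c)) (by unfold Function.uncurry; fun_prop) _ _

theorem continuous_inner₂ {H : ℝ × ℝ × ℝ → W} (hH : Continuous H) :
    Continuous fun a : ℝ => ∫ b in (0 : ℝ)..2 * Real.pi, ∫ c in (0 : ℝ)..2 * Real.pi, H (a, b, c) :=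
  intervalIntegral.continuous_parametric_intervalIntegral_of_continuous'
    (f := fun a b => ∫ c in (0 : ℝ)..2 * Real.pi, H (a, b, c)) (continuous_inner₁ hH) _ _

theorem tripleIntegral_add {H K : ℝ × ℝ × ℝ → W} (hH : Continuous H) (hK : Continuous K) :
    tripleIntegral (fun q => H q + K q) = tripleIntegral H + tripleIntegral K := by
  unfold tripleIntegral
  rw [← intervalIntegral.integral_add ((continuous_inner₂ hH).intervalIntegrable _ _)
    ((continuous_inner₂ hK).intervalIntegrable _ _)]
  congr 1; ext a
  have h1 : ∀ {H : ℝ × ℝ × ℝ → W}, Continuous H →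
      Continuous fun b : ℝ => ∫ c in (0 : ℝ)..2 * Real.pi, H (a, b, c) := fun hH =>
    (continuous_inner₁ hH).comp (Continuous.prodMk_right a)
  rw [← intervalIntegral.integral_add ((h1 hH).intervalIntegrable _ _)
    ((h1 hK).intervalIntegrable _ _)]
  congr 1; ext b
  rw [← intervalIntegral.integral_add]
  · exact Continuous.intervalIntegrable (by fun_prop) _ _
  · exact Continuous.intervalIntegrable (by fun_prop) _ _

theorem tripleIntegral_smul (z : ℂ) (H : ℝ × ℝ × ℝ → W) :
    tripleIntegral (fun q => z • H q) = z • tripleIntegral H := by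
  simp only [tripleIntegral, intervalIntegral.integral_smul]

theorem norm_tripleIntegral_le {H : ℝ × ℝ × ℝ → W} {C : ℝ} (hC : ∀ q, ‖H q‖ ≤ C) :
    ‖tripleIntegral H‖ ≤ C * (2 * Real.pi) ^ 3 := by
  have key : ∀ (f : ℝ → W) (C : ℝ), (∀ x, ‖f x‖ ≤ C) →
      ‖∫ x in (0 : ℝ)..2 * Real.pi, f x‖ ≤ C * (2 * Real.pi) := fun f C h => by
    have := intervalIntegral.norm_integral_le_of_norm_le_const (a := 0) (b := 2 * Real.pi)
      (f := f) (C := C) (fun x _ => h x)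
    rwa [sub_zero, abs_of_pos Real.two_pi_pos] at this
  refine (key _ _ fun a => key _ _ fun b => key _ _ fun c => hC _).trans (le_of_eq (by ring))

/-- Integration over `[0, 2π]³` against a bounded continuous function with values in `W`. -/
noncomputable def pairing (G : BoundedContinuousFunction (ℝ × ℝ × ℝ) W) :
    BoundedContinuousFunction (ℝ × ℝ × ℝ) ℂ →L[ℂ] W :=
  LinearMap.mkContinuous
    { toFun := fun g => tripleIntegral fun q => g q • G q
      map_add' := fun g k => by
        simp only [BoundedContinuousFunction.coe_add, Pi.add_apply, add_smul]
        exact tripleIntegral_add (by fun_prop) (by fun_prop)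
      map_smul' := fun z g => by
        simp only [BoundedContinuousFunction.coe_smul, smul_assoc, RingHom.id_apply]
        exact tripleIntegral_smul _ _ }
    (‖G‖ * (2 * Real.pi) ^ 3) fun g => by
      suffices h : ∀ q, ‖g q • G q‖ ≤ ‖g‖ * ‖G‖ from
        (norm_tripleIntegral_le h).trans (le_of_eq (by ring))
      intro q
      rw [norm_smul]
      gcongr
      · exact g.norm_coe_le_norm q
      · exact G.norm_coe_le_norm q

theorem pairing_apply (G : BoundedContinuousFunction (ℝ × ℝ × ℝ) W)
    (g : BoundedContinuousFunction (ℝ × ℝ × ℝ) ℂ) :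
    pairing G g = tripleIntegral fun q => g q • G q := rfl

end TripleIntegral

/-- A point on the circle of radius `ρ`, as a bounded continuous function of a parameter. -/
noncomputable def circleBCF {X : Type*} [TopologicalSpace X] (ρ : ℝ) (a : C(X, ℝ)) :
    BoundedContinuousFunction X ℂ :=
  BoundedContinuousFunction.ofNormedAddCommGroup (fun x => circleMap 0 ρ (a x))
    (by fun_prop) |ρ| (fun x => by simp)

theorem isUnit_circleBCF {X : Type*} [TopologicalSpace X] {ρ : ℝ} (hρ : 0 < ρ) (a : C(X, ℝ)) :
    IsUnit (circleBCF ρ a) := by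
  have hne : ∀ x, circleMap 0 ρ (a x) ≠ 0 := fun x => circleMap_ne_center hρ.ne'
  have hc : Continuous fun x => (circleMap 0 ρ (a x))⁻¹ :=
    Continuous.inv₀ (by fun_prop) hne
  refine IsUnit.of_mul_eq_one (BoundedContinuousFunction.ofNormedAddCommGroup
    (fun x => (circleMap 0 ρ (a x))⁻¹) hc ρ⁻¹ (fun x => by simp [abs_of_pos hρ])) ?_
  ext x
  simp [circleBCF, hne x]

/-- The Cauchy kernel `1 / (ζ - z)`, `|ζ| = ρ`, with values in bounded continuous functions. -/
noncomputable def cauchyKernel {X : Type*} [TopologicalSpace X] (ρ : ℝ) (a : C(X, ℝ)) (z : ℂ) :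
    BoundedContinuousFunction X ℂ :=
  Ring.inverse (circleBCF ρ a - algebraMap ℂ _ z)

/-- Inversion in a Banach algebra is analytic at every unit, and the circle function is a unit
because it stays at distance ρ from 0. -/
theorem cauchyKernel_analyticAt {X : Type*} [TopologicalSpace X] {ρ : ℝ} (hρ : 0 < ρ)
    (a : C(X, ℝ)) : AnalyticAt ℂ (cauchyKernel ρ a) 0 := by
  obtain ⟨u, hu⟩ := isUnit_circleBCF hρ a
  have h1 : AnalyticAt ℂ (fun z : ℂ => circleBCF ρ a - algebraMap ℂ _ z) 0 :=
    analyticAt_const.sub ((Algebra.linearMap ℂ (BoundedContinuousFunction X ℂ)).toContinuousLinearMap.analyticAt 0)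
  refine AnalyticAt.comp (g := Ring.inverse) ?_ h1
  have := analyticAt_inverse (𝕜 := ℂ) u
  simpa [hu] using this

theorem cauchyKernel_apply {X : Type*} [TopologicalSpace X] {ρ : ℝ} (hρ : 0 < ρ) (a : C(X, ℝ)) :
    ∀ᶠ z in 𝓝 (0 : ℂ), ∀ x, cauchyKernel ρ a z x = (circleMap 0 ρ (a x) - z)⁻¹ := by
  have h1 : ContinuousAt (fun z : ℂ => circleBCF ρ a - algebraMap ℂ (BoundedContinuousFunction X ℂ) z) 0 :=
    (continuous_const.sub (Algebra.linearMap ℂ (BoundedContinuousFunction X ℂ)).toContinuousLinearMap.continuous).continuousAt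
  have h2 := h1.eventually (p := IsUnit) (Units.isOpen.mem_nhds (by
    simpa using isUnit_circleBCF hρ a))
  filter_upwards [h2] with z hz x
  have h3 := Ring.mul_inverse_cancel _ hz
  have h4 := DFunLike.congr_fun h3 x
  simp only [BoundedContinuousFunction.coe_mul, Pi.mul_apply, BoundedContinuousFunction.coe_one,
    Pi.one_apply, BoundedContinuousFunction.coe_sub, Pi.sub_apply] at h4
  have h5 : (algebraMap ℂ (BoundedContinuousFunction X ℂ) z) x = z := by
    simp [BoundedContinuousFunction.algebraMap_apply]
  rw [h5] at h4
  exact eq_inv_of_mul_eq_one_right h4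

theorem cauchy_formula {W : Type*} [NormedAddCommGroup W] [NormedSpace ℂ W] [CompleteSpace W]
    {φ : ℂ → W} {ρ : ℝ} (h : ∀ z ∈ Metric.closedBall (0 : ℂ) ρ, DifferentiableAt ℂ φ z) {z : ℂ}
    (hz : z ∈ Metric.ball (0 : ℂ) ρ) :
    φ z = ∫ t in (0 : ℝ)..2 * Real.pi, ((2 * Real.pi * I)⁻¹ * deriv (circleMap 0 ρ) t *
      (circleMap 0 ρ t - z)⁻¹) • φ (circleMap 0 ρ t) := by
  rw [← two_pi_I_inv_smul_circleIntegral_sub_inv_smul_of_differentiable_on_off_countable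
    Set.countable_empty hz (fun x hx => (h x hx).continuousAt.continuousWithinAt)
    (fun x hx => h x (Metric.ball_subset_closedBall hx.1))]
  rw [circleIntegral, ← intervalIntegral.integral_smul]
  simp only [smul_smul, mul_assoc]

/-- Iterating Cauchy's formula over the polycircle writes f(z) as one bounded linear map applied to
the product of three Cauchy kernels. The kernels are analytic in z with values in a Banach algebra,
so analyticity of f follows without expanding the integral into a series. -/
theorem LineHol.analyticAt_three {W : Type*} [NormedAddCommGroup W]
    [NormedSpace ℂ W] [CompleteSpace W] {f : C3 → W} {r : ℝ} (hr : 0 < r) (h : LineHol f r) :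
    AnalyticAt ℂ f 0 := by
  set ρ := r / 2 with hρd
  have hρ : 0 < ρ := by positivity
  let κ : ℝ → ℂ := fun t => (2 * Real.pi * I)⁻¹ * deriv (circleMap 0 ρ) t
  have hκ : Continuous κ := by
    simp only [κ, deriv_circleMap]; fun_prop
  let ζ : ℝ → ℂ := circleMap 0 ρ
  have hmem : ∀ z : C3, (∀ i, ‖z i‖ ≤ ρ) → z ∈ Metric.ball (0 : C3) r := fun z hz => by
    rw [mem_ball_zero_iff]
    exact ((pi_norm_le_iff_of_nonneg hρ.le).2 hz).trans_lt (by linarith)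
  have hζ : ∀ t, ‖ζ t‖ ≤ ρ := fun t => by simp [ζ, abs_of_pos hρ]
  let G₀ : ℝ × ℝ × ℝ → W := fun q => (κ q.1 * κ q.2.1 * κ q.2.2) • f ![ζ q.1, ζ q.2.1, ζ q.2.2]
  have hG₀ : Continuous G₀ := by
    refine Continuous.smul (by fun_prop) ?_
    refine h.1.comp_continuous ?_ ?_
    · refine continuous_pi fun i => ?_
      fin_cases i <;> simp [ζ] <;> fun_prop
    · intro q
      refine hmem _ fun i => ?_
      fin_cases i <;> simp [hζ]
  have hGb : ∃ C, ∀ q, ‖G₀ q‖ ≤ C := by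
    let p : ℝ → ℝ := fun t => t
    have hcomp : IsCompact (Metric.closedBall (0 : C3) ρ) := isCompact_closedBall _ _
    obtain ⟨C, hC⟩ := hcomp.exists_bound_of_continuousOn (h.1.mono (fun z hz => hmem z fun i =>
      (norm_le_pi_norm z i).trans (by simpa using hz)))
    have hκb : ∀ t, ‖κ t‖ ≤ ρ := fun t => by
      have h1 : ‖κ t‖ = (2 * Real.pi)⁻¹ * ρ := by
        simp [κ, deriv_circleMap, abs_of_pos hρ, abs_of_pos Real.pi_pos]
      rw [h1]
      have : (2 * Real.pi)⁻¹ ≤ 1 := inv_le_one_of_one_le₀ (by nlinarith [Real.pi_gt_three])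
      nlinarith
    refine ⟨ρ * ρ * ρ * C, fun q => ?_⟩
    rw [norm_smul, norm_mul, norm_mul]
    gcongr
    · exact hκb _
    · exact hκb _
    · exact hκb _
    · apply hC
      rw [mem_closedBall_zero_iff, pi_norm_le_iff_of_nonneg hρ.le]
      intro i; fin_cases i <;> simp [hζ]
  obtain ⟨C, hC⟩ := hGb
  let G : BoundedContinuousFunction (ℝ × ℝ × ℝ) W :=
    BoundedContinuousFunction.ofNormedAddCommGroup G₀ hG₀ C hC
  let a : Fin 3 → C(ℝ × ℝ × ℝ, ℝ) := ![⟨fun q => q.1, by fun_prop⟩, ⟨fun q => q.2.1, by fun_prop⟩,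
    ⟨fun q => q.2.2, by fun_prop⟩]
  have hKi : ∀ i : Fin 3, AnalyticAt ℂ (fun z : C3 => cauchyKernel ρ (a i) (z i)) 0 := fun i => by
    refine AnalyticAt.comp (g := cauchyKernel ρ (a i)) ?_
      ((ContinuousLinearMap.proj (R := ℂ) (φ := fun _ : Fin 3 => ℂ) i).analyticAt 0)
    simpa using cauchyKernel_analyticAt hρ (a i)
  have hK : AnalyticAt ℂ (fun z : C3 => pairing G (cauchyKernel ρ (a 0) (z 0) *
      cauchyKernel ρ (a 1) (z 1) * cauchyKernel ρ (a 2) (z 2))) 0 :=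
    ((pairing G).analyticAt _).comp (((hKi 0).mul (hKi 1)).mul (hKi 2))
  refine hK.congr ?_
  have hev : ∀ i : Fin 3, ∀ᶠ z in 𝓝 (0 : C3), ∀ x, cauchyKernel ρ (a i) (z i) x =
      (ζ (a i x) - z i)⁻¹ := fun i => by
    have : Tendsto (fun z : C3 => z i) (𝓝 0) (𝓝 0) := (continuous_apply i).tendsto' _ _ rfl
    exact this.eventually (cauchyKernel_apply hρ (a i))
  filter_upwards [hev 0, hev 1, hev 2, Metric.ball_mem_nhds (0 : C3) hρ] with z h0 h1 h2 hz
  have hzi : ∀ i, ‖z i‖ < ρ := fun i => (norm_le_pi_norm z i).trans_lt (by simpa using hz)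
  have hdiff : ∀ (u v : C3) (x : ℂ), (∀ i, ‖(u + x • v) i‖ ≤ ρ) →
      DifferentiableAt ℂ (fun x : ℂ => f (u + x • v)) x := fun u v x hx => by
    have e1 := h.2 (u + x • v) (hmem _ hx) v
    have e2 : DifferentiableAt ℂ ((fun σ : ℂ => f (u + x • v + σ • v)) ∘ fun y => y - x) x := by
      apply DifferentiableAt.comp
      · simpa using e1
      · fun_prop
    refine e2.congr_of_eventuallyEq (Eventually.of_forall fun y => ?_)
    simp only [Function.comp]
    congr 1
    module
  have s0 : ∀ y w : ℂ, ‖y‖ ≤ ρ → ‖w‖ ≤ ρ → ∀ x ∈ Metric.closedBall (0 : ℂ) ρ,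
      DifferentiableAt ℂ (fun x : ℂ => f ![x, y, w]) x := fun y w hy hw x hx => by
    have := hdiff ![0, y, w] ![1, 0, 0] x (fun i => by fin_cases i <;> simp_all)
    simpa using this
  have s1 : ∀ y w : ℂ, ‖y‖ ≤ ρ → ‖w‖ ≤ ρ → ∀ x ∈ Metric.closedBall (0 : ℂ) ρ,
      DifferentiableAt ℂ (fun x : ℂ => f ![y, x, w]) x := fun y w hy hw x hx => by
    have := hdiff ![y, 0, w] ![0, 1, 0] x (fun i => by fin_cases i <;> simp_all)
    simpa using this
  have s2 : ∀ y w : ℂ, ‖y‖ ≤ ρ → ‖w‖ ≤ ρ → ∀ x ∈ Metric.closedBall (0 : ℂ) ρ,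
      DifferentiableAt ℂ (fun x : ℂ => f ![y, w, x]) x := fun y w hy hw x hx => by
    have := hdiff ![y, w, 0] ![0, 0, 1] x (fun i => by fin_cases i <;> simp_all)
    simpa using this
  have hz' : z = ![z 0, z 1, z 2] := by ext i; fin_cases i <;> rfl
  have hm : ∀ i, z i ∈ Metric.ball (0 : ℂ) ρ := fun i => by simpa using hzi i
  conv_rhs => rw [hz']
  rw [cauchy_formula (φ := fun x => f ![x, z 1, z 2]) (s0 _ _ (hzi 1).le (hzi 2).le) (hm 0)]
  have t1 : ∀ t, f ![ζ t, z 1, z 2] = ∫ b in (0 : ℝ)..2 * Real.pi,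
      (κ b * (ζ b - z 1)⁻¹) • f ![ζ t, ζ b, z 2] := fun t =>
    cauchy_formula (φ := fun x => f ![ζ t, x, z 2]) (s1 _ _ (hζ t) (hzi 2).le) (hm 1)
  have t2 : ∀ t b, f ![ζ t, ζ b, z 2] = ∫ c in (0 : ℝ)..2 * Real.pi,
      (κ c * (ζ c - z 2)⁻¹) • f ![ζ t, ζ b, ζ c] := fun t b =>
    cauchy_formula (φ := fun x => f ![ζ t, ζ b, x]) (s2 _ _ (hζ t) (hζ b)) (hm 2)
  simp only [ζ] at t1 t2
  simp only [t1, t2, ← intervalIntegral.integral_smul]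
  rw [pairing_apply]
  unfold tripleIntegral
  congr 1; ext t; congr 1; ext b; congr 1; ext c
  simp only [BoundedContinuousFunction.coe_mul, Pi.mul_apply, h0, h1, h2]
  change _ • G₀ _ = _
  simp only [G₀, smul_smul, ζ, a, Matrix.cons_val, ContinuousMap.coe_mk]
  congr 1
  simp only [κ]
  ring

/-! ### Inverting the Euler operator, and the fixed-point theorem -/

section EulerIntegral

variable {E W : Type*} [NormedAddCommGroup E] [NormedSpace ℂ E] [NormedAddCommGroup W]
    [NormedSpace ℂ W]

/-- The integral operator that inverts `h ↦ Dh(u) u + (p + 1) h(u)` on maps of high order. -/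
noncomputable def eulerInt (p : ℤ) (g : E → W) (u : E) : W :=
  ∫ s in (0 : ℝ)..1, ((s : ℂ) ^ p) • g ((s : ℂ) • u)

theorem smul_mem_ball_of_le_one {r : ℝ} {u : E} (hu : u ∈ Metric.ball (0 : E) r) {s : ℝ}
    (hs : s ∈ Set.Ioc (0 : ℝ) 1) : (s : ℂ) • u ∈ Metric.ball (0 : E) r := by
  rw [mem_ball_zero_iff] at *
  rw [norm_smul, Complex.norm_real, Real.norm_of_nonneg hs.1.le]
  exact (mul_le_of_le_one_left (norm_nonneg _) hs.2).trans_lt hu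

/-- The power p may be negative; the vanishing of g to order m compensates for it, leaving the
nonnegative exponent e = p + m. -/
theorem norm_zpow_smul_le {p : ℤ} {m e : ℕ} (hpm : p + m = e) {g : E → W} {r C : ℝ}
    (hg : ∀ u ∈ Metric.ball (0 : E) r, ‖g u‖ ≤ C * ‖u‖ ^ m) {u : E}
    (hu : u ∈ Metric.ball (0 : E) r) {s : ℝ} (hs : s ∈ Set.Ioc (0 : ℝ) 1) :
    ‖((s : ℂ) ^ p) • g ((s : ℂ) • u)‖ ≤ C * ‖u‖ ^ m * s ^ e := by
  have h1 := hg _ (smul_mem_ball_of_le_one hu hs)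
  rw [norm_smul, Complex.norm_real, Real.norm_of_nonneg hs.1.le] at h1
  rw [norm_smul, norm_zpow, Complex.norm_real, Real.norm_of_nonneg hs.1.le]
  have h2 : s ^ e = s ^ p * s ^ m := by
    rw [← zpow_natCast s e, ← hpm, zpow_add₀ hs.1.ne', zpow_natCast]
  calc s ^ p * ‖g ((s : ℂ) • u)‖ ≤ s ^ p * (C * (s * ‖u‖) ^ m) :=
        mul_le_mul_of_nonneg_left h1 (zpow_nonneg hs.1.le _)
    _ = C * ‖u‖ ^ m * s ^ e := by rw [h2, mul_pow]; ring

theorem continuousOn_zpow_smul {p : ℤ} {g : E → W} {r : ℝ}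
    (hg : ContinuousOn g (Metric.ball 0 r)) {u : E} {S : Set ℝ} (hS : ∀ s ∈ S, s ≠ 0)
    (hu : ∀ s ∈ S, (s : ℂ) • u ∈ Metric.ball (0 : E) r) :
    ContinuousOn (fun s : ℝ => ((s : ℂ) ^ p) • g ((s : ℂ) • u)) S := by
  refine ContinuousOn.smul ?_ (hg.comp (by fun_prop) hu)
  refine ContinuousOn.zpow₀ (by fun_prop) _ fun s hs => Or.inl ?_
  exact_mod_cast hS s hs

variable {p : ℤ} {m e : ℕ} {g : E → W} {r C : ℝ}

theorem aestronglyMeasurable_zpow_smul (hg : ContinuousOn g (Metric.ball 0 r)) {u : E}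
    (hu : u ∈ Metric.ball (0 : E) r) :
    MeasureTheory.AEStronglyMeasurable (fun s : ℝ => ((s : ℂ) ^ p) • g ((s : ℂ) • u))
      (MeasureTheory.volume.restrict (Set.Ioc 0 1)) :=
  (continuousOn_zpow_smul hg (fun _ hs => hs.1.ne')
    (fun _ hs => smul_mem_ball_of_le_one hu hs)).aestronglyMeasurable measurableSet_Ioc

theorem intervalIntegrable_zpow_smul (hpm : p + m = e) (hgc : ContinuousOn g (Metric.ball 0 r))
    (hg : ∀ u ∈ Metric.ball (0 : E) r, ‖g u‖ ≤ C * ‖u‖ ^ m) {u : E}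
    (hu : u ∈ Metric.ball (0 : E) r) :
    IntervalIntegrable (fun s : ℝ => ((s : ℂ) ^ p) • g ((s : ℂ) • u)) MeasureTheory.volume 0 1 := by
  rw [intervalIntegrable_iff_integrableOn_Ioc_of_le zero_le_one]
  have hb : IntervalIntegrable (fun s : ℝ => C * ‖u‖ ^ m * s ^ e) MeasureTheory.volume 0 1 :=
    Continuous.intervalIntegrable (by fun_prop) _ _
  rw [intervalIntegrable_iff_integrableOn_Ioc_of_le zero_le_one] at hb
  refine hb.mono' (aestronglyMeasurable_zpow_smul hgc hu) ?_
  filter_upwards [MeasureTheory.ae_restrict_mem measurableSet_Ioc] with s hs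
  exact norm_zpow_smul_le hpm hg hu hs

/-- The factor 1/(e+1) is ∫₀¹ s^e ds. It is the gain against which the Lipschitz constant of the
nonlinearity is weighed. -/
theorem norm_eulerInt_le (hpm : p + m = e)
    (hg : ∀ u ∈ Metric.ball (0 : E) r, ‖g u‖ ≤ C * ‖u‖ ^ m) {u : E}
    (hu : u ∈ Metric.ball (0 : E) r) : ‖eulerInt p g u‖ ≤ C / (e + 1) * ‖u‖ ^ m := by
  have hb : IntervalIntegrable (fun s : ℝ => C * ‖u‖ ^ m * s ^ e) MeasureTheory.volume 0 1 :=
    Continuous.intervalIntegrable (by fun_prop) _ _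
  refine (intervalIntegral.norm_integral_le_of_norm_le zero_le_one
    (Eventually.of_forall fun s hs => norm_zpow_smul_le hpm hg hu hs) hb).trans (le_of_eq ?_)
  simp
  ring

theorem eulerInt_sub {g' : E → W} {C' : ℝ} (hpm : p + m = e)
    (hgc : ContinuousOn g (Metric.ball 0 r))
    (hg : ∀ u ∈ Metric.ball (0 : E) r, ‖g u‖ ≤ C * ‖u‖ ^ m)
    (hgc' : ContinuousOn g' (Metric.ball 0 r))
    (hg' : ∀ u ∈ Metric.ball (0 : E) r, ‖g' u‖ ≤ C' * ‖u‖ ^ m) {u : E}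
    (hu : u ∈ Metric.ball (0 : E) r) :
    eulerInt p (fun u => g u - g' u) u = eulerInt p g u - eulerInt p g' u := by
  unfold eulerInt
  rw [← intervalIntegral.integral_sub (intervalIntegrable_zpow_smul hpm hgc hg hu)
    (intervalIntegrable_zpow_smul hpm hgc' hg' hu)]
  simp only [smul_sub]

/-- Dominated convergence gives continuity. Along a complex line the integral is differentiated
under the integral sign, where Cauchy's estimate on small circles supplies the dominating constant.
-/
theorem LineHol.eulerInt [CompleteSpace W] (hpm : p + m = e) (hC : 0 ≤ C) (hgh : LineHol g r)
    (hg : ∀ u ∈ Metric.ball (0 : E) r, ‖g u‖ ≤ C * ‖u‖ ^ m) :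
    LineHol (eulerInt p g) r := by
  have hK : ∀ u ∈ Metric.ball (0 : E) r, ∀ s ∈ Set.Ioc (0 : ℝ) 1,
      ‖((s : ℂ) ^ p) • g ((s : ℂ) • u)‖ ≤ C * r ^ m := fun u hu s hs => by
    refine (norm_zpow_smul_le hpm hg hu hs).trans ?_
    have h1 : ‖u‖ ≤ r := (mem_ball_zero_iff.1 hu).le
    have h2 : s ^ e ≤ 1 := pow_le_one₀ hs.1.le hs.2
    calc C * ‖u‖ ^ m * s ^ e ≤ C * ‖u‖ ^ m * 1 := by gcongr
      _ ≤ C * r ^ m := by rw [mul_one]; gcongr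
  have hae := MeasureTheory.ae_restrict_mem (μ := MeasureTheory.volume)
    (measurableSet_Ioc (a := (0 : ℝ)) (b := 1))
  unfold _root_.eulerInt
  simp only [intervalIntegral.integral_of_le zero_le_one]
  constructor
  · refine MeasureTheory.continuousOn_of_dominated (bound := fun _ => C * r ^ m)
      (fun u hu => aestronglyMeasurable_zpow_smul hgh.1 hu) (fun u hu => ?_)
      (MeasureTheory.integrable_const _) ?_
    · filter_upwards [hae] with s hs using hK u hu s hs
    · filter_upwards [hae] with s hs
      exact (hgh.1.comp (by fun_prop) fun u hu => smul_mem_ball_of_le_one hu hs).const_smul _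
  · intro u hu v
    have hnh : ∀ᶠ σ in 𝓝 (0 : ℂ), u + σ • v ∈ Metric.ball (0 : E) r := by
      have : ContinuousAt (fun σ : ℂ => u + σ • v) 0 := by fun_prop
      exact this.eventually (Metric.isOpen_ball.mem_nhds (by simpa using hu))
    obtain ⟨δ', hδ', hball⟩ := Metric.eventually_nhds_iff_ball.1 hnh
    -- With 2δ < δ', circles of radius δ about points of the δ-ball stay where the integrand is
    -- holomorphic.
    obtain ⟨δ, hδ, hδδ⟩ : ∃ δ > 0, 2 * δ < δ' := ⟨δ' / 3, by positivity, by linarith⟩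
    have hmem : ∀ σ ∈ Metric.ball (0 : ℂ) δ, ∀ τ ∈ Metric.closedBall σ δ,
        u + τ • v ∈ Metric.ball (0 : E) r := fun σ hσ τ hτ => by
      apply hball
      rw [Metric.mem_ball] at *
      have := dist_triangle τ σ 0
      have h3 := Metric.mem_closedBall.1 hτ
      linarith
    have hd : ∀ s ∈ Set.Ioc (0 : ℝ) 1, ∀ σ : ℂ, u + σ • v ∈ Metric.ball (0 : E) r →
        DifferentiableAt ℂ (fun σ : ℂ => ((s : ℂ) ^ p) • g ((s : ℂ) • (u + σ • v))) σ :=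
      fun s hs σ hσ => by
        have e1 := hgh.2 _ (smul_mem_ball_of_le_one hσ hs) ((s : ℂ) • v)
        have e2 : DifferentiableAt ℂ ((fun τ : ℂ => g ((s : ℂ) • (u + σ • v) + τ • (s : ℂ) • v)) ∘
            fun y => y - σ) σ := by
          apply DifferentiableAt.comp
          · simpa using e1
          · fun_prop
        refine (e2.const_smul ((s : ℂ) ^ p)).congr_of_eventuallyEq (Eventually.of_forall fun y => ?_)
        simp only [Function.comp, Pi.smul_apply]
        congr 2
        module
    have hself : ∀ σ ∈ Metric.ball (0 : ℂ) δ, u + σ • v ∈ Metric.ball (0 : E) r := fun σ hσ =>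
      hmem σ hσ σ (Metric.mem_closedBall_self hδ.le)
    have h0 : (0 : ℂ) ∈ Metric.ball (0 : ℂ) δ := Metric.mem_ball_self hδ
    refine (hasDerivAt_integral_of_dominated_loc_of_deriv_le
      (F := fun (σ : ℂ) (s : ℝ) => ((s : ℂ) ^ p) • g ((s : ℂ) • (u + σ • v)))
      (F' := fun σ s => deriv (fun σ : ℂ => ((s : ℂ) ^ p) • g ((s : ℂ) • (u + σ • v))) σ)
      (bound := fun _ => C * r ^ m / δ)
      (Metric.ball_mem_nhds (0 : ℂ) hδ) ?_ ?_ ?_ ?_ (MeasureTheory.integrable_const _)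
      ?_).2.differentiableAt
    · filter_upwards [hnh] with σ hσ using aestronglyMeasurable_zpow_smul hgh.1 hσ
    · have := intervalIntegrable_zpow_smul hpm hgh.1 hg (u := u + (0 : ℂ) • v) (by simpa using hu)
      rwa [intervalIntegrable_iff_integrableOn_Ioc_of_le zero_le_one] at this
    -- The derivative is measurable in s as the pointwise limit of difference quotients with
    -- increments t n → 0; the denominator n + 2 keeps them inside the δ-ball.
    · let t : ℕ → ℂ := fun n => ((δ / (n + 2) : ℝ) : ℂ)
      have ht0 : ∀ n, t n ≠ 0 := fun n => by
        exact Complex.ofReal_ne_zero.2 (by positivity)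
      have htb : ∀ n, t n ∈ Metric.ball (0 : ℂ) δ := fun n => by
        have h2 : (0 : ℝ) < n + 2 := by positivity
        rw [mem_ball_zero_iff, Complex.norm_real, Real.norm_of_nonneg (by positivity),
          div_lt_iff₀ h2]
        nlinarith [(Nat.cast_nonneg n : (0 : ℝ) ≤ n)]
      have htl : Tendsto t atTop (𝓝[≠] 0) := by
        refine tendsto_nhdsWithin_iff.2 ⟨?_, Eventually.of_forall ht0⟩
        have h1 : Tendsto (fun n : ℕ => δ / ((n : ℝ) + 2)) atTop (𝓝 0) :=
          tendsto_const_nhds.div_atTop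
            (tendsto_atTop_add_const_right _ _ tendsto_natCast_atTop_atTop)
        have := (Complex.continuous_ofReal.tendsto 0).comp h1
        simpa [t, Function.comp_def] using this
      refine aestronglyMeasurable_of_tendsto_ae (β := W) atTop (f := fun (n : ℕ) (s : ℝ) => (t n)⁻¹ •
        (((s : ℂ) ^ p) • g ((s : ℂ) • (u + (0 + t n) • v)) -
          ((s : ℂ) ^ p) • g ((s : ℂ) • (u + (0 : ℂ) • v)))) (fun n => ?_) ?_
      · refine ((aestronglyMeasurable_zpow_smul hgh.1 ?_).sub
          (aestronglyMeasurable_zpow_smul hgh.1 ?_)).const_smul ((t n)⁻¹)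
        · simpa using hself _ (htb n)
        · simpa using hu
      · filter_upwards [hae] with s hs
        have := (hd s hs 0 (hself 0 h0)).hasDerivAt.tendsto_slope_zero
        exact this.comp htl
    · filter_upwards [hae] with s hs σ hσ
      refine norm_deriv_le_of_forall_mem_sphere_norm_le hδ ?_ ?_
      · refine DifferentiableOn.diffContOnCl fun τ hτ => ?_
        rw [closure_ball _ hδ.ne'] at hτ
        exact (hd s hs τ (hmem σ hσ τ hτ)).differentiableWithinAt
      · exact fun τ hτ => hK _ (hmem σ hσ τ (Metric.sphere_subset_closedBall hτ)) s hs
    · filter_upwards [hae] with s hs σ hσ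
      exact (hd s hs σ (hself σ hσ)).hasDerivAt

/-- Rescaling s turns the value at tu into t^(-p-1) ∫₀ᵗ s^p g(su) ds. The derivative at t = 1 is the
Euler derivative on one side, and the product rule with the fundamental theorem of calculus on the
other. -/
theorem fderiv_eulerInt [CompleteSpace W] (hpm : p + m = e) (hgc : ContinuousOn g (Metric.ball 0 r))
    (hg : ∀ u ∈ Metric.ball (0 : E) r, ‖g u‖ ≤ C * ‖u‖ ^ m) {u : E}
    (hu : u ∈ Metric.ball (0 : E) r) (hd : DifferentiableAt ℂ (eulerInt p g) u) :
    fderiv ℂ (eulerInt p g) u u = -((p : ℂ) + 1) • eulerInt p g u + g u := by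
  set φ : ℝ → W := fun s => ((s : ℂ) ^ p) • g ((s : ℂ) • u) with hφ
  let S : Set ℝ := {s | 0 < s ∧ (s : ℂ) • u ∈ Metric.ball (0 : E) r}
  have hS : IsOpen S := by
    refine (isOpen_lt continuous_const continuous_id).inter ?_
    exact Metric.isOpen_ball.preimage (by fun_prop)
  have h1S : (1 : ℝ) ∈ S := ⟨one_pos, by simpa using hu⟩
  have hφc : ContinuousOn φ S := continuousOn_zpow_smul hgc (fun s hs => hs.1.ne') fun s hs => hs.2
  have hint : HasDerivAt (fun t => ∫ s in (0 : ℝ)..t, φ s) (φ 1) 1 :=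
    intervalIntegral.integral_hasDerivAt_right (intervalIntegrable_zpow_smul hpm hgc hg hu)
      (hφc.stronglyMeasurableAtFilter hS 1 h1S) (hφc.continuousAt (hS.mem_nhds h1S))
  have hz : HasDerivAt (fun t : ℝ => (t : ℂ) ^ (-p - 1)) (-((p : ℂ) + 1)) 1 := by
    have := (hasDerivAt_zpow (-p - 1) (((1 : ℝ) : ℂ)) (Or.inl (by simp))).comp_ofReal
    convert this using 1
    push_cast
    simp
    ring
  have hprod := hz.smul hint
  have heq : (fun t : ℝ => eulerInt p g ((t : ℂ) • u)) =ᶠ[𝓝 1]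
      (fun t : ℝ => (t : ℂ) ^ (-p - 1)) • fun t => ∫ s in (0 : ℝ)..t, φ s := by
    filter_upwards [hS.mem_nhds h1S] with t ht
    have ht0 : (t : ℂ) ≠ 0 := by exact_mod_cast ht.1.ne'
    have h1 : ∫ s in (0 : ℝ)..t, φ s = t • ∫ s in (0 : ℝ)..1, φ (t * s) := by
      rw [intervalIntegral.smul_integral_comp_mul_left]; simp
    have h2 : ∀ s : ℝ, φ (t * s) = ((t : ℂ) ^ p) • ((s : ℂ) ^ p) • g ((s : ℂ) • (t : ℂ) • u) := by
      intro s
      simp only [hφ, Complex.ofReal_mul, mul_zpow, smul_smul]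
      rw [mul_comm (t : ℂ) s]
    rw [Pi.smul_apply', h1]
    simp only [h2, intervalIntegral.integral_smul]
    change _ = _ • t • _ • eulerInt p g _
    rw [← Complex.coe_smul t, smul_smul, smul_smul, mul_assoc]
    have h3 : (t : ℂ) ^ (-p - 1) * (t * (t : ℂ) ^ p) = 1 := by
      rw [← zpow_one_add₀ ht0, ← zpow_add₀ ht0, show -p - 1 + (1 + p) = 0 by ring, zpow_zero]
    rw [h3, one_smul]
  have hA := hprod.congr_of_eventuallyEq heq
  have hB : HasDerivAt (fun t : ℝ => eulerInt p g ((t : ℂ) • u)) (fderiv ℂ (eulerInt p g) u u) 1 := by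
    have e1 : HasDerivAt (fun z : ℂ => z • u) u (((1 : ℝ) : ℂ)) := by
      simpa using (hasDerivAt_id (((1 : ℝ) : ℂ))).smul_const u
    have e2 : HasFDerivAt (eulerInt p g) (fderiv ℂ (eulerInt p g) u) ((((1 : ℝ) : ℂ)) • u) := by
      simpa using hd.hasFDerivAt
    have e3 := HasFDerivAt.comp_hasDerivAt (𝕜 := ℂ) (((1 : ℝ) : ℂ)) e2 e1
    have e4 : HasDerivAt (fun t : ℝ => (t : ℂ)) 1 1 := by
      simpa using (hasDerivAt_id (((1 : ℝ) : ℂ))).comp_ofReal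
    simpa [Function.comp_def] using HasDerivAt.scomp (1 : ℝ) e3 e4
  have := hB.unique hA
  rw [this]
  simp only [Complex.ofReal_one, one_zpow, one_smul, hφ]
  change g u + _ • eulerInt p g u = _
  rw [add_comm]

/-- Weierstrass' theorem on each line. Together with stability under the integral operator, this
makes the class suitable for Picard iteration. -/
theorem LineHol.of_tendstoUniformlyOn [CompleteSpace W] {H : ℕ → E → W} {h : E → W}
    (hH : ∀ k, LineHol (H k) r) (hlim : TendstoUniformlyOn H h atTop (Metric.ball 0 r)) :
    LineHol h r := by
  refine ⟨hlim.continuousOn (Eventually.of_forall fun k => (hH k).1).frequently,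
    fun u hu v => ?_⟩
  let U : Set ℂ := {σ | u + σ • v ∈ Metric.ball (0 : E) r}
  have hU : IsOpen U := Metric.isOpen_ball.preimage (by fun_prop)
  have h1 : TendstoLocallyUniformlyOn (fun k σ => H k (u + σ • v)) (fun σ => h (u + σ • v))
      atTop U := (hlim.comp fun σ : ℂ => u + σ • v).tendstoLocallyUniformlyOn
  refine (h1.differentiableOn (Eventually.of_forall fun k σ hσ => ?_) hU).differentiableAt
    (hU.mem_nhds (by simpa [U] using hu))
  have e2 : DifferentiableAt ℂ ((fun τ : ℂ => H k (u + σ • v + τ • v)) ∘ fun y => y - σ) σ := by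
    apply DifferentiableAt.comp
    · simpa using (hH k).2 _ hσ v
    · fun_prop
  refine (e2.congr_of_eventuallyEq (Eventually.of_forall fun y => ?_)).differentiableWithinAt
  simp only [Function.comp]
  congr 1
  module

theorem LineHol.comp_prod {R : E × W → W} {h : E → W} {ρ : ℝ}
    (hR : ∀ x ∈ Metric.ball (0 : E) r, ∀ y ∈ Metric.ball (0 : W) ρ, DifferentiableAt ℂ R (x, y))
    (hh : LineHol h r) (hρ : ∀ u ∈ Metric.ball (0 : E) r, h u ∈ Metric.ball (0 : W) ρ) :
    LineHol (fun u => R (u, h u)) r := by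
  refine ⟨fun u hu => ?_, fun u hu v => ?_⟩
  · exact ContinuousAt.comp_continuousWithinAt (f := fun u => (u, h u))
      (hR u hu _ (hρ u hu)).continuousAt (continuousWithinAt_id.prodMk (hh.1 u hu))
  · have h1 : DifferentiableAt ℂ R (u + (0 : ℂ) • v, h (u + (0 : ℂ) • v)) := by
      simpa using hR u hu _ (hρ u hu)
    have h2 : DifferentiableAt ℂ (fun σ : ℂ => u + σ • v) 0 := by fun_prop
    exact DifferentiableAt.comp (0 : ℂ) (g := R) h1 (h2.prodMk (hh.2 u hu v))

/-- Local solvability of `Dh(u) u + (p + 1) h(u) = R(u, h(u))` for `R` with a small Lipschitz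
constant in the second variable, in the class of maps that vanish to order `m`. -/
theorem exists_euler_fixedPoint [CompleteSpace W] {R : E × W → W} {ρ κ B : ℝ}
    (hr : 0 < r) (hC : 0 ≤ C) (hκ : 0 ≤ κ)
    (hE : ∀ f : E → W, LineHol f r → AnalyticAt ℂ f 0)
    (hpm : p + m = e) (hκe : κ < e + 1)
    (hR : ∀ x ∈ Metric.ball (0 : E) r, ∀ y ∈ Metric.ball (0 : W) ρ, DifferentiableAt ℂ R (x, y))
    (hR0 : ∀ x ∈ Metric.ball (0 : E) r, ‖R (x, 0)‖ ≤ C * ‖x‖ ^ m)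
    (hRl : ∀ x ∈ Metric.ball (0 : E) r, ∀ y ∈ Metric.ball (0 : W) ρ,
      ∀ y' ∈ Metric.ball (0 : W) ρ, ‖R (x, y) - R (x, y')‖ ≤ κ * ‖y - y'‖)
    (hB : B = C / (e + 1 - κ)) (hBρ : B * r ^ m < ρ) :
    ∃ h : E → W, AnalyticAt ℂ h 0 ∧ (∀ u ∈ Metric.ball (0 : E) r, ‖h u‖ ≤ B * ‖u‖ ^ m) ∧
      ∀ᶠ u in 𝓝 (0 : E), fderiv ℂ h u u = -((p : ℂ) + 1) • h u + R (u, h u) := by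
  have he : (0 : ℝ) < e + 1 := by positivity
  have hek : 0 < e + 1 - κ := by linarith
  have hB0 : 0 ≤ B := by rw [hB]; positivity
  have hρ : 0 < ρ := lt_of_le_of_lt (by positivity) hBρ
  -- This identity determines B: the bound B‖u‖^m on h gives (C + κB)‖u‖^m for R(u, h(u)), and the
  -- integral operator divides by e + 1.
  have hCB : C + κ * B = (e + 1) * B := by rw [hB]; field_simp; ring
  let K : Set (E → W) := {h | LineHol h r ∧ ∀ u ∈ Metric.ball (0 : E) r, ‖h u‖ ≤ B * ‖u‖ ^ m}
  have hKρ : ∀ h ∈ K, ∀ u ∈ Metric.ball (0 : E) r, h u ∈ Metric.ball (0 : W) ρ :=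
    fun h hh u hu => by
      rw [mem_ball_zero_iff]
      refine ((hh.2 u hu).trans ?_).trans_lt hBρ
      have := (mem_ball_zero_iff.1 hu).le
      gcongr
  have hKR : ∀ h ∈ K, LineHol (fun u => R (u, h u)) r := fun h hh => hh.1.comp_prod hR (hKρ h hh)
  have hKb : ∀ h ∈ K, ∀ u ∈ Metric.ball (0 : E) r, ‖R (u, h u)‖ ≤ ((e + 1) * B) * ‖u‖ ^ m :=
    fun h hh u hu => by
      have h1 := hRl u hu _ (hKρ h hh u hu) 0 (Metric.mem_ball_self hρ)
      rw [sub_zero] at h1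
      have h2 := hR0 u hu
      have h3 := hh.2 u hu
      have h4 : ‖R (u, h u)‖ ≤ ‖R (u, h u) - R (u, 0)‖ + ‖R (u, 0)‖ := by
        simpa using norm_add_le (R (u, h u) - R (u, 0)) (R (u, 0))
      have h5 : κ * ‖h u‖ ≤ κ * (B * ‖u‖ ^ m) := by gcongr
      rw [← hCB, add_mul]
      linarith
  let T : (E → W) → E → W := fun h => eulerInt p fun u => R (u, h u)
  have hTK : ∀ h ∈ K, T h ∈ K := fun h hh => by
    refine ⟨LineHol.eulerInt hpm (by positivity) (hKR h hh) (hKb h hh), fun u hu => ?_⟩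
    refine (norm_eulerInt_le hpm (hKb h hh) hu).trans (le_of_eq ?_)
    field_simp
  -- The contraction factor for the weighted norm sup ‖h(u)‖ / ‖u‖^m.
  set q : ℝ := κ / (e + 1) with hq
  have hq0 : 0 ≤ q := by positivity
  have hq1 : q < 1 := (div_lt_one he).2 hκe
  have hTd : ∀ h ∈ K, ∀ h' ∈ K, ∀ D, (∀ u ∈ Metric.ball (0 : E) r, ‖h u - h' u‖ ≤ D * ‖u‖ ^ m) →
      ∀ u ∈ Metric.ball (0 : E) r, ‖T h u - T h' u‖ ≤ q * D * ‖u‖ ^ m := by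
    intro h hh h' hh' D hD u hu
    have h1 := eulerInt_sub hpm (hKR h hh).1 (hKb h hh) (hKR h' hh').1 (hKb h' hh') hu
    change ‖eulerInt p (fun u => R (u, h u)) u - eulerInt p (fun u => R (u, h' u)) u‖ ≤ _
    rw [← h1]
    refine (norm_eulerInt_le (C := κ * D) hpm (fun u hu => ?_) hu).trans (le_of_eq ?_)
    · refine (hRl u hu _ (hKρ h hh u hu) _ (hKρ h' hh' u hu)).trans ?_
      rw [mul_assoc]
      exact mul_le_mul_of_nonneg_left (hD u hu) hκ
    · rw [hq]; ring
  let H : ℕ → E → W := fun k => T^[k] 0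
  have hHs : ∀ k, H (k + 1) = T (H k) := fun k => Function.iterate_succ_apply' _ _ _
  have h0K : (0 : E → W) ∈ K := by
    refine ⟨⟨continuousOn_const, fun u _ v => differentiableAt_const (0 : W)⟩, fun u _ => ?_⟩
    simp only [Pi.zero_apply, norm_zero]
    positivity
  have hHK : ∀ k, H k ∈ K := fun k => by
    induction k with
    | zero => exact h0K
    | succ k ih => rw [hHs]; exact hTK _ ih
  have hHd : ∀ k, ∀ u ∈ Metric.ball (0 : E) r, ‖H (k + 1) u - H k u‖ ≤ q ^ k * B * ‖u‖ ^ m := by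
    intro k
    induction k with
    | zero =>
      intro u hu
      have : H 0 u = 0 := rfl
      rw [this, sub_zero, pow_zero, one_mul]
      exact (hHK 1).2 u hu
    | succ k ih =>
      intro u hu
      have := hTd _ (hHK (k + 1)) _ (hHK k) _ ih u hu
      rw [← hHs, ← hHs] at this
      refine this.trans (le_of_eq (by ring))
  have hdist : ∀ u ∈ Metric.ball (0 : E) r, ∀ k, dist (H k u) (H (k + 1) u) ≤ B * ‖u‖ ^ m * q ^ k :=
    fun u hu k => by
      rw [dist_comm, dist_eq_norm]
      exact (hHd k u hu).trans (le_of_eq (by ring))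
  have hex : ∀ u, ∃ y, u ∈ Metric.ball (0 : E) r → Tendsto (fun k => H k u) atTop (𝓝 y) := fun u => by
    by_cases hu : u ∈ Metric.ball (0 : E) r
    · obtain ⟨y, hy⟩ := cauchySeq_tendsto_of_complete
        (cauchySeq_of_le_geometric q _ hq1 (hdist u hu))
      exact ⟨y, fun _ => hy⟩
    · exact ⟨0, fun h => absurd h hu⟩
  choose h hlim using hex
  have hdl : ∀ u ∈ Metric.ball (0 : E) r, ∀ k,
      ‖h u - H k u‖ ≤ (B / (1 - q) * q ^ k) * ‖u‖ ^ m := fun u hu k => by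
    have := dist_le_of_le_geometric_of_tendsto q _ hq1 (hdist u hu) (hlim u hu) k
    rw [dist_comm, dist_eq_norm] at this
    exact this.trans (le_of_eq (by ring))
  have hunif : TendstoUniformlyOn H h atTop (Metric.ball 0 r) := by
    rw [Metric.tendstoUniformlyOn_iff]
    intro ε hε
    have h1 : Tendsto (fun k => (B / (1 - q) * r ^ m) * q ^ k) atTop (𝓝 0) := by
      simpa using (tendsto_pow_atTop_nhds_zero_of_lt_one hq0 hq1).const_mul (B / (1 - q) * r ^ m)
    filter_upwards [h1.eventually (gt_mem_nhds hε)] with k hk u hu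
    rw [dist_eq_norm]
    refine (hdl u hu k).trans_lt (lt_of_le_of_lt ?_ hk)
    have := (mem_ball_zero_iff.1 hu).le
    have h3 : 0 < 1 - q := by linarith
    calc B / (1 - q) * q ^ k * ‖u‖ ^ m ≤ B / (1 - q) * q ^ k * r ^ m := by gcongr
      _ = _ := by ring
  have hhK : h ∈ K := by
    refine ⟨LineHol.of_tendstoUniformlyOn (fun k => (hHK k).1) hunif, fun u hu => ?_⟩
    exact le_of_tendsto (hlim u hu).norm (Eventually.of_forall fun k => (hHK k).2 u hu)
  have hfix : ∀ u ∈ Metric.ball (0 : E) r, T h u = h u := fun u hu => by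
    have h1 : Tendsto (fun k => H (k + 1) u) atTop (𝓝 (h u)) :=
      (hlim u hu).comp (tendsto_add_atTop_nat 1)
    have h2 : Tendsto (fun k => H (k + 1) u) atTop (𝓝 (T h u)) := by
      rw [tendsto_iff_norm_sub_tendsto_zero]
      have h3 : Tendsto (fun k => (q * (B / (1 - q)) * ‖u‖ ^ m) * q ^ k) atTop (𝓝 0) := by
        simpa using (tendsto_pow_atTop_nhds_zero_of_lt_one hq0 hq1).const_mul
          (q * (B / (1 - q)) * ‖u‖ ^ m)
      refine squeeze_zero (fun _ => norm_nonneg _) (fun k => ?_) h3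
      rw [norm_sub_rev, hHs]
      exact (hTd h hhK _ (hHK k) _ (fun u hu => hdl u hu k) u hu).trans (le_of_eq (by ring))
    exact tendsto_nhds_unique h2 h1
  have hev : T h =ᶠ[𝓝 0] h := by
    filter_upwards [Metric.ball_mem_nhds (0 : E) hr] with u hu using hfix u hu
  refine ⟨h, hE h hhK.1, hhK.2, ?_⟩
  filter_upwards [hev.eventuallyEq_nhds, (hE h hhK.1).eventually_analyticAt,
    Metric.ball_mem_nhds (0 : E) hr] with u hu hua hub
  rw [← hu.fderiv_eq]
  have hd : DifferentiableAt ℂ (T h) u := hua.differentiableAt.congr_of_eventuallyEq hu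
  have := fderiv_eulerInt hpm (hKR h hhK).1 (hKb h hhK) hub hd
  rw [this]
  change -((p : ℂ) + 1) • T h u + _ = _
  rw [hfix u hub]

end EulerIntegral

/-! ### Local solvability and Poincaré linearization -/

section Poincare

variable {E W : Type*} [NormedAddCommGroup E] [NormedSpace ℂ E] [NormedAddCommGroup W]
    [NormedSpace ℂ W]

theorem AnalyticAt.isBigO_sq {f : E → W} (hf : AnalyticAt ℂ f 0) (h0 : f 0 = 0)
    (h1 : fderiv ℂ f 0 = 0) : f =O[𝓝 0] fun u => ‖u‖ ^ 2 := by
  obtain ⟨p, hp⟩ := hf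
  have h := hp.isBigO_sub_partialSum_pow 2
  have h2 : ∀ y, p.partialSum 2 y = 0 := fun y => by
    have e0 : p 0 (fun _ => y) = 0 := by
      rw [hp.coeff_zero, h0]
    have e1 : p 1 (fun _ => y) = 0 := by
      have := hp.fderiv_eq
      rw [h1] at this
      have h3 : continuousMultilinearCurryFin1 ℂ E W (p 1) y = 0 := by rw [← this]; simp
      rw [continuousMultilinearCurryFin1_apply] at h3
      convert h3 using 2
      ext i; simp [Fin.snoc]
    simp [FormalMultilinearSeries.partialSum, Finset.sum_range_succ, e0, e1]
  simpa [h2] using h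

/-- Strict differentiability makes the Lipschitz constant in the second variable as close as desired
to the norm of the partial derivative at the origin, so a bound at the origin suffices on a small
ball. The hypothesis `hE` stands for Osgood's lemma and allows E to be ℂ or ℂ³. -/
theorem exists_euler_solution [CompleteSpace W] {R : E × W → W} {p : ℤ} {m e : ℕ}
    (hE : ∀ (f : E → W) (r : ℝ), 0 < r → LineHol f r → AnalyticAt ℂ f 0)
    (hm : m ≠ 0) (hpm : p + m = e) (hR : AnalyticAt ℂ R 0)
    (hR0 : (fun u => R (u, 0)) =O[𝓝 0] fun u : E => ‖u‖ ^ m)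
    (hL : ‖(fderiv ℂ R 0).comp (ContinuousLinearMap.inr ℂ E W)‖ < e + 1) :
    ∃ h : E → W, AnalyticAt ℂ h 0 ∧ h =O[𝓝 0] (fun u => ‖u‖ ^ m) ∧
      ∀ᶠ u in 𝓝 (0 : E), fderiv ℂ h u u = -((p : ℂ) + 1) • h u + R (u, h u) := by
  set L := (fderiv ℂ R 0).comp (ContinuousLinearMap.inr ℂ E W) with hLd
  obtain ⟨κ, hκ1, hκ2⟩ := exists_between hL
  have hκ0 : 0 ≤ κ := (norm_nonneg L).trans hκ1.le
  obtain ⟨C, hC, hCb⟩ := hR0.exists_nonneg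
  rw [Asymptotics.isBigOWith_iff] at hCb
  have hst := (hasStrictFDerivAt_iff_isLittleO.1 hR.hasStrictFDerivAt).def (sub_pos.2 hκ1)
  have hst' : ∀ᶠ q in 𝓝 (0 : E × W) ×ˢ 𝓝 (0 : E × W),
      ‖R q.1 - R q.2 - fderiv ℂ R 0 (q.1 - q.2)‖ ≤ (κ - ‖L‖) * ‖q.1 - q.2‖ := by
    rwa [← nhds_prod_eq]
  obtain ⟨s, hs, hsp⟩ := (eventually_prod_self_iff
    (r := fun a b => ‖R a - R b - fderiv ℂ R 0 (a - b)‖ ≤ (κ - ‖L‖) * ‖a - b‖)).1 hst'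
  have hall : ∀ᶠ q in 𝓝 (0 : E × W), q ∈ s ∧ DifferentiableAt ℂ R q :=
    (Filter.eventually_mem_set.2 hs).and
      (hR.eventually_analyticAt.mono fun q hq => hq.differentiableAt)
  obtain ⟨ρ, hρ, hball⟩ := Metric.eventually_nhds_iff_ball.1 hall
  set B : ℝ := C / (e + 1 - κ) with hB
  have hsmall : ∀ᶠ r in 𝓝 (0 : ℝ), B * r ^ m < ρ := by
    have : ContinuousAt (fun r : ℝ => B * r ^ m) 0 := by fun_prop
    exact this.eventually (gt_mem_nhds (by simpa [hm] using hρ))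
  obtain ⟨r₁, hr₁, hr₁b⟩ := Metric.eventually_nhds_iff_ball.1 hsmall
  obtain ⟨r₂, hr₂, hr₂b⟩ := Metric.eventually_nhds_iff_ball.1 hCb
  obtain ⟨r, hr, hrr⟩ : ∃ r > 0, r < min ρ (min r₁ r₂) :=
    exists_between (lt_min hρ (lt_min hr₁ hr₂))
  have hrρ : r < ρ := hrr.trans_le (min_le_left _ _)
  have hrr₁ : r < r₁ := hrr.trans_le ((min_le_right _ _).trans (min_le_left _ _))
  have hrr₂ : r < r₂ := hrr.trans_le ((min_le_right _ _).trans (min_le_right _ _))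
  have hxy : ∀ x ∈ Metric.ball (0 : E) r, ∀ y ∈ Metric.ball (0 : W) ρ,
      (x, y) ∈ Metric.ball (0 : E × W) ρ := fun x hx y hy => by
    rw [mem_ball_zero_iff] at *
    rw [Prod.norm_def]
    exact max_lt (hx.trans hrρ) hy
  obtain ⟨h, hh, hb, hode⟩ := exists_euler_fixedPoint (R := R) (ρ := ρ) (κ := κ) (B := B) hr hC hκ0
    (fun f hf => hE f r hr hf) hpm hκ2 (fun x hx y hy => (hball _ (hxy x hx y hy)).2)
    (fun x hx => by simpa using hr₂b x (Metric.ball_subset_ball hrr₂.le hx))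
    (fun x hx y hy y' hy' => by
      have h1 := hsp _ (hball _ (hxy x hx y hy)).1 _ (hball _ (hxy x hx y' hy')).1
      have h2 : ((x, y) : E × W) - (x, y') = ContinuousLinearMap.inr ℂ E W (y - y') := by
        simp
      rw [h2] at h1
      have h3 : ‖(ContinuousLinearMap.inr ℂ E W) (y - y')‖ = ‖y - y'‖ := by simp
      rw [h3] at h1
      have h4 := L.le_opNorm (y - y')
      have h5 : fderiv ℂ R 0 (ContinuousLinearMap.inr ℂ E W (y - y')) = L (y - y') := rfl
      rw [h5] at h1
      have h6 := norm_add_le (R (x, y) - R (x, y') - L (y - y')) (L (y - y'))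
      rw [sub_add_cancel] at h6
      linarith) hB
    (hr₁b r (by rw [mem_ball_zero_iff, Real.norm_of_nonneg hr.le]; exact hrr₁))
  refine ⟨h, hh, ?_, hode⟩
  refine Asymptotics.IsBigO.of_bound B ?_
  filter_upwards [Metric.ball_mem_nhds (0 : E) hr] with u hu
  simpa using hb u hu

/-- Poincaré linearization on an eigenspace: `range P` lies in the eigenspace of `Df(0)` for `lam`,
and `Df(0) / lam` is close to the identity. -/
theorem exists_linearization {f : C3 → C3} (hf : AnalyticAt ℂ f 0) (hf0 : f 0 = 0) {lam : ℂ}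
    (hlam : lam ≠ 0) (P : C3 →L[ℂ] C3) (hP : ∀ u, fderiv ℂ f 0 (P u) = lam • P u)
    (hN : ‖lam⁻¹ • fderiv ℂ f 0 - ContinuousLinearMap.id ℂ C3‖ < 1) :
    ∃ K : C3 → C3, AnalyticAt ℂ K 0 ∧ K 0 = 0 ∧ fderiv ℂ K 0 = P ∧
      ∀ᶠ u in 𝓝 (0 : C3), lam • fderiv ℂ K u u = f (K u) := by
  -- The unknown is w = K - P. With p = -2 the equation reads Dw(u)u - w = R(u, w), so the summand
  -- -w of R cancels and DK(u)u = lam⁻¹ f(K(u)) remains. Since R(u, 0) has order 2, e = -2 + 2 = 0,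
  -- and the smallness required of R is exactly `hN`.
  let R : C3 × C3 → C3 := fun q => lam⁻¹ • f (P q.1 + q.2) - P q.1 - q.2
  have hin : AnalyticAt ℂ (fun q : C3 × C3 => P q.1 + q.2) 0 :=
    ((P.comp (ContinuousLinearMap.fst ℂ C3 C3)) + ContinuousLinearMap.snd ℂ C3 C3).analyticAt 0
  have hf' : AnalyticAt ℂ f ((fun q : C3 × C3 => P q.1 + q.2) 0) := by simpa using hf
  have hR : AnalyticAt ℂ R 0 :=
    (((AnalyticAt.comp (g := f) (f := fun q : C3 × C3 => P q.1 + q.2) hf' hin).const_smul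
      (c := lam⁻¹)).sub
      ((P.comp (ContinuousLinearMap.fst ℂ C3 C3)).analyticAt 0)).sub
      ((ContinuousLinearMap.snd ℂ C3 C3).analyticAt 0)
  have hRd : HasFDerivAt R (lam⁻¹ • (fderiv ℂ f 0).comp
      (P.comp (ContinuousLinearMap.fst ℂ C3 C3) + ContinuousLinearMap.snd ℂ C3 C3) -
      P.comp (ContinuousLinearMap.fst ℂ C3 C3) - ContinuousLinearMap.snd ℂ C3 C3) 0 := by
    have h1 : HasFDerivAt f (fderiv ℂ f 0) ((fun q : C3 × C3 => P q.1 + q.2) 0) := by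
      simpa using hf.differentiableAt.hasFDerivAt
    have h2 : HasFDerivAt (fun q : C3 × C3 => P q.1 + q.2)
      (P.comp (ContinuousLinearMap.fst ℂ C3 C3) + ContinuousLinearMap.snd ℂ C3 C3) 0 :=
      ((P.comp (ContinuousLinearMap.fst ℂ C3 C3)) + ContinuousLinearMap.snd ℂ C3 C3).hasFDerivAt
    exact (((HasFDerivAt.comp (g := f) (f := fun q : C3 × C3 => P q.1 + q.2) 0 h1 h2).const_smul lam⁻¹).sub
      (P.comp (ContinuousLinearMap.fst ℂ C3 C3)).hasFDerivAt).sub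
      (ContinuousLinearMap.snd ℂ C3 C3).hasFDerivAt
  have hu : AnalyticAt ℂ (fun u : C3 => R (u, 0)) 0 :=
    AnalyticAt.comp (g := R) (f := fun u : C3 => (u, (0 : C3))) hR
      ((ContinuousLinearMap.inl ℂ C3 C3).analyticAt 0)
  have hud : fderiv ℂ (fun u : C3 => R (u, 0)) 0 = 0 := by
    have h1 : HasFDerivAt (fun u : C3 => R (u, 0)) _ 0 :=
      HasFDerivAt.comp (g := R) (f := fun u : C3 => (u, (0 : C3))) 0 hRd
        (ContinuousLinearMap.inl ℂ C3 C3).hasFDerivAt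
    rw [h1.fderiv]
    ext1 u
    simp [hP, smul_smul, hlam]
  obtain ⟨w, hw, hwO, hode⟩ := exists_euler_solution (E := C3) (W := C3) (R := R) (p := -2) (m := 2)
    (e := 0) (fun f r hr hf => hf.analyticAt_three hr) (by norm_num) (by norm_num) hR
    (hu.isBigO_sq (by simp [R, hf0]) hud) (by
      rw [hRd.fderiv]
      refine lt_of_eq_of_lt (congrArg norm ?_) (hN.trans_eq (by norm_num))
      ext1 u
      simp)
  have hwO' : w =O[𝓝 0] fun u => ‖u - 0‖ ^ 2 := by simpa using hwO
  have hw0 : w 0 = 0 := hwO'.eq_zero_of_norm_pow (by norm_num)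
  have hwd : HasFDerivAt w (0 : C3 →L[ℂ] C3) 0 := hwO'.hasFDerivAt (by norm_num)
  refine ⟨⇑P + w, (P.analyticAt 0).add hw, by simp [hw0], ?_, ?_⟩
  · rw [(P.hasFDerivAt.add hwd).fderiv, add_zero]
  · filter_upwards [hode, hw.eventually_analyticAt] with u hu hua
    rw [(P.hasFDerivAt.add hua.differentiableAt.hasFDerivAt).fderiv]
    simp only [_root_.add_apply, hu, R, Pi.add_apply]
    have e1 : (-(((-2 : ℤ) : ℂ) + 1)) = 1 := by norm_num
    rw [e1, one_smul]
    have e2 : P u + (w u + (lam⁻¹ • f (P u + w u) - P u - w u)) = lam⁻¹ • f (P u + w u) := by abel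
    rw [e2, smul_smul, mul_inv_cancel₀ hlam, one_smul]

end Poincare

/-! ### Coordinate projections and graphs tangent to the vector field -/

theorem AnalyticAt.clm_apply_of_clm {E G W : Type*} [NormedAddCommGroup E] [NormedSpace ℂ E]
    [NormedAddCommGroup G] [NormedSpace ℂ G] [NormedAddCommGroup W] [NormedSpace ℂ W]
    {f : E → G →L[ℂ] W} {g : E → G} {x : E} (hf : AnalyticAt ℂ f x) (hg : AnalyticAt ℂ g x) :
    AnalyticAt ℂ (fun y => f y (g y)) x :=
  AnalyticAt.comp (f := fun y => (f y, g y))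
    ((ContinuousLinearMap.id ℂ (G →L[ℂ] W)).analyticAt_bilinear (f x, g x)) (hf.prod hg)

/-- `coordProj S` as a continuous linear map. -/
noncomputable def projL (S : Finset (Fin 3)) : C3 →L[ℂ] C3 :=
  ContinuousLinearMap.pi fun i => if i ∈ S then ContinuousLinearMap.proj i else 0

theorem projL_apply (S : Finset (Fin 3)) (p : C3) (i : Fin 3) :
    projL S p i = if i ∈ S then p i else 0 := by
  by_cases h : i ∈ S <;> simp [projL, h]

theorem projL_eq_coordProj (S : Finset (Fin 3)) (p : C3) : projL S p = coordProj S p := by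
  ext i; simp [projL_apply, coordProj]

@[simp] theorem projL_projL (S : Finset (Fin 3)) (p : C3) : projL S (projL S p) = projL S p := by
  ext i; by_cases h : i ∈ S <;> simp [projL_apply, h]

@[simp] theorem projL_compl_projL (S : Finset (Fin 3)) (p : C3) :
    projL Sᶜ (projL S p) = 0 := by
  ext i; by_cases h : i ∈ S <;> simp [projL_apply, h]

@[simp] theorem projL_projL_compl (S : Finset (Fin 3)) (p : C3) :
    projL S (projL Sᶜ p) = 0 := by
  ext i; by_cases h : i ∈ S <;> simp [projL_apply, h]

theorem projL_add_compl (S : Finset (Fin 3)) (p : C3) : projL S p + projL Sᶜ p = p := by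
  ext i; by_cases h : i ∈ S <;> simp [projL_apply, h]

/-- The parametrization of the graph of `ψ` over the coordinate subspace given by `S`. -/
noncomputable def graphMap (S : Finset (Fin 3)) (ψ : C3 → C3) (u : C3) : C3 :=
  projL S u + projL Sᶜ (ψ (projL S u))

section Graph

variable {S : Finset (Fin 3)} {ψ : C3 → C3} {F : C3 → C3}

@[simp] theorem projL_graphMap (u : C3) : projL S (graphMap S ψ u) = projL S u := by
  simp [graphMap]

@[simp] theorem graphMap_graphMap (u : C3) :
    graphMap S ψ (graphMap S ψ u) = graphMap S ψ u := by
  simp [graphMap]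

theorem graphMap_congr {u v : C3} (h : projL S u = projL S v) :
    graphMap S ψ u = graphMap S ψ v := by
  simp [graphMap, h]

theorem sub_graphMap (u : C3) : u - graphMap S ψ u = projL Sᶜ (u - ψ (projL S u)) := by
  rw [graphMap, map_sub]
  nth_rw 1 [← projL_add_compl S u]
  abel

theorem graphMap_eq_self_iff (p : C3) :
    graphMap S ψ p = p ↔ ∀ j, j ∉ S → p j = ψ (coordProj S p) j := by
  rw [eq_comm, ← sub_eq_zero, sub_graphMap, funext_iff, ← projL_eq_coordProj]
  refine forall_congr' fun j => ?_
  by_cases h : j ∈ S <;> simp [projL_apply, h, sub_eq_zero]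

/-- The graph of `ψ` over the coordinate subspace given by `S` is tangent to it at the origin, and
the vector field `F` is tangent to the graph near the origin. -/
structure IsTangentGraph (F : C3 → C3) (S : Finset (Fin 3)) (ψ : C3 → C3) : Prop where
  analyticAt : AnalyticAt ℂ ψ 0
  zero : ψ 0 = 0
  fderiv_zero : fderiv ℂ ψ 0 = 0
  tangent : ∀ᶠ u in 𝓝 (0 : C3), projL Sᶜ (F (graphMap S ψ u)) =
    projL Sᶜ (fderiv ℂ ψ (projL S u) (projL S (F (graphMap S ψ u))))

theorem tendsto_projL (S : Finset (Fin 3)) : Tendsto (projL S) (𝓝 0) (𝓝 0) :=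
  (projL S).continuous.tendsto' _ _ (map_zero _)

theorem analyticAt_graphMap (hψ : AnalyticAt ℂ ψ 0) : AnalyticAt ℂ (graphMap S ψ) 0 := by
  have h1 : AnalyticAt ℂ (fun u => ψ (projL S u)) 0 :=
    AnalyticAt.comp (g := ψ) (by simpa using hψ) ((projL S).analyticAt 0)
  exact ((projL S).analyticAt 0).add (((projL Sᶜ).analyticAt _).comp h1)

@[simp] theorem graphMap_zero (h0 : ψ 0 = 0) : graphMap S ψ 0 = 0 := by
  simp [graphMap, h0]

theorem tendsto_graphMap (hψ : AnalyticAt ℂ ψ 0) (h0 : ψ 0 = 0) :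
    Tendsto (graphMap S ψ) (𝓝 0) (𝓝 0) := by
  have := (analyticAt_graphMap (S := S) hψ).continuousAt.tendsto
  rwa [graphMap_zero h0] at this

theorem hasFDerivAt_graphMap {u : C3} (h : DifferentiableAt ℂ ψ (projL S u)) :
    HasFDerivAt (graphMap S ψ)
      (projL S + (projL Sᶜ).comp ((fderiv ℂ ψ (projL S u)).comp (projL S))) u := by
  have h1 : HasFDerivAt (fun u => ψ (projL S u)) ((fderiv ℂ ψ (projL S u)).comp (projL S)) u :=
    HasFDerivAt.comp (g := ψ) u h.hasFDerivAt (projL S).hasFDerivAt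
  exact (projL S).hasFDerivAt.add ((projL Sᶜ).hasFDerivAt.comp u h1)

/-- The failure of `F` to be tangent to the graphs that are parallel to the graph of `ψ`. -/
noncomputable def tangencyDefect (F : C3 → C3) (S : Finset (Fin 3)) (ψ : C3 → C3) (p : C3) : C3 :=
  projL Sᶜ (F p) - projL Sᶜ (fderiv ℂ ψ (projL S p) (projL S (F p)))

theorem tangencyDefect_graphMap_iff (u : C3) : tangencyDefect F S ψ (graphMap S ψ u) = 0 ↔
    projL Sᶜ (F (graphMap S ψ u)) =
      projL Sᶜ (fderiv ℂ ψ (projL S u) (projL S (F (graphMap S ψ u)))) := by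
  rw [tangencyDefect, sub_eq_zero, projL_graphMap]

theorem analyticAt_tangencyDefect (hF : AnalyticAt ℂ F 0) (hψ : AnalyticAt ℂ ψ 0) :
    AnalyticAt ℂ (tangencyDefect F S ψ) 0 := by
  have h1 : AnalyticAt ℂ (fun p => fderiv ℂ ψ (projL S p)) 0 :=
    AnalyticAt.comp (g := fderiv ℂ ψ) (by simpa using hψ.fderiv) ((projL S).analyticAt 0)
  have h2 : AnalyticAt ℂ (fun p => projL S (F p)) 0 := ((projL S).analyticAt _).comp hF
  exact (((projL Sᶜ).analyticAt _).comp hF).sub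
    (((projL Sᶜ).analyticAt _).comp (h1.clm_apply_of_clm h2))

/-- The term with Dψ is a product of two factors that both vanish at the origin, so it does not
contribute to first order. -/
theorem fderiv_tangencyDefect (hF : AnalyticAt ℂ F 0) (hF0 : F 0 = 0) (hψ : AnalyticAt ℂ ψ 0)
    (hψ1 : fderiv ℂ ψ 0 = 0) :
    fderiv ℂ (tangencyDefect F S ψ) 0 = (projL Sᶜ).comp (fderiv ℂ F 0) := by
  have h1 : HasFDerivAt (fun p => fderiv ℂ ψ (projL S p))
      ((fderiv ℂ (fderiv ℂ ψ) 0).comp (projL S)) 0 :=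
    HasFDerivAt.comp (g := fderiv ℂ ψ) 0
      (by simpa using hψ.fderiv.differentiableAt.hasFDerivAt) (projL S).hasFDerivAt
  have hFd := hF.differentiableAt.hasFDerivAt
  have h2 : HasFDerivAt (fun p => projL S (F p)) ((projL S).comp (fderiv ℂ F 0)) 0 :=
    (projL S).hasFDerivAt.comp 0 hFd
  have h3 := (((projL Sᶜ).hasFDerivAt (x := F 0)).comp 0 hFd).sub
    (((projL Sᶜ).hasFDerivAt (x := _)).comp 0 (h1.clm_apply h2))
  refine Eq.trans h3.fderiv ?_
  ext1 v
  simp [hF0, hψ1]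

/-- The tangent space of an invariant graph is invariant under the linear part. -/
theorem IsTangentGraph.projL_compl_fderiv (h : IsTangentGraph F S ψ) (hF : AnalyticAt ℂ F 0)
    (hF0 : F 0 = 0) (v : C3) : projL Sᶜ (fderiv ℂ F 0 (projL S v)) = 0 := by
  have h1 : HasFDerivAt (tangencyDefect F S ψ) ((projL Sᶜ).comp (fderiv ℂ F 0))
      (graphMap S ψ 0) := by
    rw [graphMap_zero h.zero, ← fderiv_tangencyDefect hF hF0 h.analyticAt h.fderiv_zero]
    exact (analyticAt_tangencyDefect hF h.analyticAt).differentiableAt.hasFDerivAt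
  have h2 : HasFDerivAt (graphMap S ψ) (projL S) 0 := by
    have := hasFDerivAt_graphMap (S := S) (ψ := ψ) (u := 0)
      (by simpa using h.analyticAt.differentiableAt)
    simpa [h.fderiv_zero] using this
  have h3 := h1.comp 0 h2
  have h4 : (tangencyDefect F S ψ ∘ graphMap S ψ) =ᶠ[𝓝 0] fun _ => 0 :=
    h.tangent.mono fun u hu => (tangencyDefect_graphMap_iff u).2 hu
  have h5 := h3.unique ((hasFDerivAt_const (0 : C3) (0 : C3)).congr_of_eventuallyEq h4)
  have := DFunLike.congr_fun h5 v
  simpa using this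

end Graph

/-! ### Local invariance is tangency -/

/-- A function on an interval that is dominated by its value in its derivative vanishes if it
vanishes somewhere. -/
theorem eq_zero_of_norm_deriv_le {E : Type*} [NormedAddCommGroup E] [NormedSpace ℝ E]
    {u u' : ℝ → E} {J : Set ℝ} (hJ : J.OrdConnected) {K : ℝ}
    (hu : ∀ t ∈ J, HasDerivWithinAt u (u' t) J t) (hb : ∀ t ∈ J, ‖u' t‖ ≤ K * ‖u t‖) {s t : ℝ}
    (hs : s ∈ J) (ht : t ∈ J) (h0 : u s = 0) : u t = 0 := by
  have key : ∀ {u u' : ℝ → E} {J : Set ℝ} (_ : J.OrdConnected)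
      (_ : ∀ t ∈ J, HasDerivWithinAt u (u' t) J t) (_ : ∀ t ∈ J, ‖u' t‖ ≤ K * ‖u t‖) {s t : ℝ}
      (_ : s ∈ J) (_ : t ∈ J) (_ : s ≤ t) (_ : u s = 0), u t = 0 := by
    intro u u' J hJ hu hb s t hs ht hst h0
    have hsub : Set.Icc s t ⊆ J := hJ.out hs ht
    refine eq_zero_of_abs_deriv_le_mul_abs_self_of_eq_zero_right (f := u) (f' := u') (K := K)
      (a := s) (b := t) (fun x hx => ((hu x (hsub hx)).continuousWithinAt).mono hsub)
      (fun x hx => ?_) h0 (fun x hx => hb x (hsub (Set.Ico_subset_Icc_self hx))) t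
      (Set.right_mem_Icc.2 hst)
    refine (hu x (hsub (Set.Ico_subset_Icc_self hx))).mono_of_mem_nhdsWithin ?_
    exact mem_of_superset (Icc_mem_nhdsGE hx.2)
      ((Set.Icc_subset_Icc_left hx.1).trans hsub)
  rcases le_total s t with h | h
  · exact key hJ hu hb hs ht h h0
  · let J' : Set ℝ := {x | -x ∈ J}
    have hJ' : J'.OrdConnected := ⟨fun x hx y hy z hz =>
      hJ.out hy hx ⟨neg_le_neg hz.2, neg_le_neg hz.1⟩⟩
    have := key (u := fun x => u (-x)) (u' := fun x => -u' (-x)) hJ' (fun x hx => ?_)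
      (fun x hx => by simpa using hb (-x) hx) (s := -s) (t := -t) (by simpa [J'] using hs)
      (by simpa [J'] using ht) (neg_le_neg h) (by simpa using h0)
    · simpa using this
    · have e1 := HasDerivWithinAt.scomp (t' := J) x (hu (-x) hx) ((hasDerivAt_neg x).hasDerivWithinAt (s := J'))
        (fun y hy => hy)
      simpa [Function.comp_def] using e1

section Invariance

variable {S : Finset (Fin 3)} {ψ : C3 → C3} {F : C3 → C3} {M : Set C3}

/-- A solution in real time starts at each point of the graph and stays in it for a short time.
Differentiating the graph equation along it at time 0 and taking the transverse component gives
tangency. -/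
theorem isTangentGraph_of_isLocallyInvariant (hF : AnalyticAt ℂ F 0) (hψ : AnalyticAt ℂ ψ 0)
    (h0 : ψ 0 = 0) (h1 : fderiv ℂ ψ 0 = 0)
    (hM : ∀ᶠ p in 𝓝 (0 : C3), p ∈ M ↔ graphMap S ψ p = p) (hinv : IsLocallyInvariant F M) :
    IsTangentGraph F S ψ := by
  refine ⟨hψ, h0, h1, ?_⟩
  obtain ⟨U, hU, hinv⟩ := hinv
  have hev : ∀ᶠ p in 𝓝 (0 : C3), AnalyticAt ℂ F p ∧ p ∈ U ∧ (p ∈ M ↔ graphMap S ψ p = p) :=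
    hF.eventually_analyticAt.and ((Filter.eventually_mem_set.2 hU).and hM)
  have hψd : ∀ᶠ u in 𝓝 (0 : C3), DifferentiableAt ℂ ψ (projL S u) :=
    (tendsto_projL S).eventually (hψ.eventually_analyticAt.mono fun _ h => h.differentiableAt)
  filter_upwards [(tendsto_graphMap (S := S) hψ h0).eventually hev.eventually_nhds, hψd] with u hu hd
  set p := graphMap S ψ u with hp
  have hpp := hu.self_of_nhds
  have hpM : p ∈ M := hpp.2.2.2 (graphMap_graphMap u)
  obtain ⟨α, hα0, ε, hε, hα⟩ :=
    (hpp.1.contDiffAt.restrict_scalars ℝ (n := 1)).exists_forall_mem_closedBall_exists_eq_forall_mem_Ioo_hasDerivAt₀ 0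
  have hαd : HasDerivAt α (F p) 0 := by
    have := hα 0 (by simp [hε])
    rwa [hα0] at this
  have hcont : ∀ᶠ t in 𝓝 (0 : ℝ), α t ∈ U ∧ (α t ∈ M ↔ graphMap S ψ (α t) = α t) := by
    have : Tendsto α (𝓝 0) (𝓝 p) := hα0 ▸ hαd.continuousAt
    exact this.eventually (hu.mono fun p h => h.2)
  obtain ⟨δ', hδ', hδb⟩ := Metric.eventually_nhds_iff_ball.1 hcont
  set δ := min δ' ε with hδd
  have hδ : 0 < δ := lt_min hδ' hε
  have hJb : ∀ t ∈ Set.Ioo (-δ) δ, t ∈ Metric.ball (0 : ℝ) δ' := fun t ht => by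
    rw [mem_ball_zero_iff, Real.norm_eq_abs]
    exact (abs_lt.2 ht).trans_le (min_le_left _ _)
  have hJε : ∀ t ∈ Set.Ioo (-δ) δ, t ∈ Set.Ioo (0 - ε) (0 + ε) := fun t ht => by
    have := (abs_lt.2 ht).trans_le (min_le_right _ _)
    simpa using abs_lt.1 this
  have hmem : ∀ t ∈ Set.Ioo (-δ) δ, graphMap S ψ (α t) = α t := fun t ht =>
    (hδb t (hJb t ht)).2.1 (hinv α _ Set.ordConnected_Ioo
      (fun t ht => (hα t (hJε t ht)).hasDerivWithinAt)
      (fun t ht => (hδb t (hJb t ht)).1) 0 (by simp [hδ]) (hα0 ▸ hpM) t ht)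
  have heq : (fun t => graphMap S ψ (α t)) =ᶠ[𝓝 0] α := by
    filter_upwards [Ioo_mem_nhds (neg_lt_zero.2 hδ) hδ] with t ht using hmem t ht
  have hd' : DifferentiableAt ℂ ψ (projL S p) := by rw [hp, projL_graphMap]; exact hd
  have h2 : HasFDerivAt (graphMap S ψ) _ (α 0) := hα0 ▸ hasFDerivAt_graphMap hd'
  have h3 := (h2.restrictScalars ℝ).comp_hasDerivAt 0 hαd
  have h4 := h3.unique (hαd.congr_of_eventuallyEq heq)
  have h5 := congrArg (projL Sᶜ) h4
  rw [hα0] at h5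
  simp only [ContinuousLinearMap.coe_restrictScalars', _root_.add_apply, map_add,
    projL_compl_projL, zero_add, ContinuousLinearMap.comp_apply, projL_projL] at h5
  rw [← h5, hp, projL_graphMap]

/-- Along a solution, the deviation from the graph has the tangency defect as its derivative. The
defect is Lipschitz and vanishes on the graph, so it is bounded by the deviation, and a deviation
that is zero once is zero throughout. -/
theorem IsTangentGraph.isLocallyInvariant (h : IsTangentGraph F S ψ) (hF : AnalyticAt ℂ F 0)
    (hM : ∀ᶠ p in 𝓝 (0 : C3), p ∈ M ↔ graphMap S ψ p = p) : IsLocallyInvariant F M := by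
  have hX := analyticAt_tangencyDefect (S := S) hF h.analyticAt
  obtain ⟨K, s, hs, hK⟩ := hX.hasStrictFDerivAt.exists_lipschitzOnWith
  have hs' : ∀ᶠ p in 𝓝 (0 : C3), graphMap S ψ p ∈ s :=
    (tendsto_graphMap (S := S) h.analyticAt h.zero).eventually_mem hs
  have hψd : ∀ᶠ u in 𝓝 (0 : C3), DifferentiableAt ℂ ψ (projL S u) :=
    (tendsto_projL S).eventually (h.analyticAt.eventually_analyticAt.mono fun _ h => h.differentiableAt)
  refine ⟨_, (((hM.and h.tangent).and (hs'.and hψd)).and (Filter.eventually_mem_set.2 hs)),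
    fun γ J hJ hγ hU t₀ ht₀ hM₀ t ht => ?_⟩
  have hU' := fun t ht => hU t ht
  simp only [Set.mem_ofPred_eq] at hU'
  have hz := eq_zero_of_norm_deriv_le (u := fun t => γ t - graphMap S ψ (γ t))
    (u' := fun t => tangencyDefect F S ψ (γ t)) hJ (K := K) (fun t ht => ?_) (fun t ht => ?_)
    ht₀ ht ?_
  · exact (hU' t ht).1.1.1.2 (sub_eq_zero.1 hz).symm
  · have h1 := hγ t ht
    have h2 := (hasFDerivAt_graphMap (hU' t ht).1.2.2).restrictScalars ℝ
    have h3 := h1.sub (h2.comp_hasDerivWithinAt t h1)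
    refine h3.congr_deriv ?_
    simp only [ContinuousLinearMap.coe_restrictScalars', _root_.add_apply,
      ContinuousLinearMap.comp_apply, tangencyDefect]
    nth_rw 1 [← projL_add_compl S (F (γ t))]
    abel
  · have h1 := (tangencyDefect_graphMap_iff (F := F) (S := S) (ψ := ψ) (γ t)).2 (hU' t ht).1.1.2
    have h2 := hK.dist_le_mul _ (hU' t ht).2 _ (hU' t ht).1.2.1
    rwa [dist_eq_norm, dist_eq_norm, h1, sub_zero] at h2
  · rw [sub_eq_zero]
    exact ((hU' t₀ ht₀).1.1.1.1 hM₀).symm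

theorem isCenterManifold_iff (hF : AnalyticAt ℂ F 0) :
    IsCenterManifold F S M ↔ ∃ ψ, IsTangentGraph F S ψ ∧
      ∀ᶠ p in 𝓝 (0 : C3), p ∈ M ↔ graphMap S ψ p = p := by
  constructor
  · rintro ⟨⟨ψ, hψ, h0, h1, hM⟩, hinv⟩
    simp only [← graphMap_eq_self_iff] at hM
    exact ⟨ψ, isTangentGraph_of_isLocallyInvariant hF hψ h0 h1 hM hinv, hM⟩
  · rintro ⟨ψ, h, hM⟩
    refine ⟨⟨ψ, h.analyticAt, h.zero, h.fderiv_zero, ?_⟩, h.isLocallyInvariant hF hM⟩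
    simpa only [← graphMap_eq_self_iff] using hM

theorem IsTangentGraph.isCenterManifold (h : IsTangentGraph F S ψ) (hF : AnalyticAt ℂ F 0) :
    IsCenterManifold F S {p | graphMap S ψ p = p} :=
  (isCenterManifold_iff hF).2 ⟨ψ, h, Eventually.of_forall fun _ => Iff.rfl⟩

end Invariance

/-! ### Periodic orbits of least period 2π/|ω| -/

section Isochronous

variable {S : Finset (Fin 3)} {ψ : C3 → C3} {F : C3 → C3} {M : Set C3}

theorem exp_mul_I_ne_one {ω s : ℝ} (hω : ω ≠ 0) (h0 : 0 < s) (hs : s < 2 * Real.pi / |ω|) :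
    Complex.exp (I * ω * s) ≠ 1 := by
  intro h
  obtain ⟨n, hn⟩ := Complex.exp_eq_one_iff.1 h
  have h1 : ω * s = n * (2 * Real.pi) := by
    have : I * ((ω * s : ℝ) : ℂ) = I * ((n * (2 * Real.pi) : ℝ) : ℂ) := by
      push_cast
      rw [← mul_assoc, hn]; ring
    exact_mod_cast mul_left_cancel₀ I_ne_zero this
  have h2 : |ω| * s < 2 * Real.pi := by
    rwa [lt_div_iff₀ (abs_pos.2 hω), mul_comm] at hs
  have h3 : |ω| * s = |(n : ℝ)| * (2 * Real.pi) := by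
    have := congrArg abs h1
    rwa [abs_mul, abs_mul, abs_of_pos h0, abs_of_pos Real.two_pi_pos] at this
  have h4 : |(n : ℝ)| < 1 := by
    by_contra hc
    push Not at hc
    nlinarith [Real.two_pi_pos]
  have h5 : n = 0 := by
    have : |n| < 1 := by exact_mod_cast h4
    exact Int.abs_lt_one_iff.1 this
  rw [h5] at h3
  have : 0 < |ω| * s := mul_pos (abs_pos.2 hω) h0
  simp at h3
  rcases h3 with h3 | h3
  · exact hω h3
  · exact h0.ne' h3

/-- An invariant graph over a subspace of the eigenspace of `iω` consists of periodic orbits of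
least period `2π / |ω|`. -/
theorem IsTangentGraph.hasIsochronousCenterFamily (h : IsTangentGraph F S ψ)
    (hF : AnalyticAt ℂ F 0) (hF0 : F 0 = 0) {ω : ℝ} (hω : ω ≠ 0)
    (hS : ∀ v, fderiv ℂ F 0 (projL S v) = (I * ω) • projL S v)
    (hM : ∀ᶠ p in 𝓝 (0 : C3), p ∈ M ↔ graphMap S ψ p = p) :
    HasIsochronousCenterFamily F M (2 * Real.pi / |ω|) := by
  have hlam : I * (ω : ℂ) ≠ 0 := mul_ne_zero I_ne_zero (by exact_mod_cast hω)
  set lam := I * (ω : ℂ) with hlamd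
  have hΓ := analyticAt_graphMap (S := S) h.analyticAt
  have hΓ0 := graphMap_zero (S := S) h.zero
  have hFΓ : AnalyticAt ℂ (fun u => F (graphMap S ψ u)) 0 :=
    AnalyticAt.comp (g := F) (by rwa [hΓ0]) hΓ
  have hFΓd : HasFDerivAt (fun u => F (graphMap S ψ u)) ((fderiv ℂ F 0).comp (projL S)) 0 := by
    have h1 := hasFDerivAt_graphMap (S := S) (ψ := ψ) (u := 0)
      (by simpa using h.analyticAt.differentiableAt)
    rw [map_zero, h.fderiv_zero] at h1
    have h2 : HasFDerivAt F (fderiv ℂ F 0) (graphMap S ψ 0) := by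
      rw [hΓ0]; exact hF.differentiableAt.hasFDerivAt
    simpa using HasFDerivAt.comp (g := F) 0 h2 h1
  -- The field on the graph, read in the coordinates of S, is extended to ℂ³ by the scalar lam on
  -- the complement, so that the whole linear part is lam times the identity.
  let f : C3 → C3 := fun u => projL S (F (graphMap S ψ u)) + lam • projL Sᶜ u
  have hf : AnalyticAt ℂ f 0 :=
    (((projL S).analyticAt _).comp hFΓ).add (((projL Sᶜ).analyticAt 0).const_smul (c := lam))
  have hfd : fderiv ℂ f 0 = lam • ContinuousLinearMap.id ℂ C3 := by
    have h1 : HasFDerivAt f ((projL S).comp ((fderiv ℂ F 0).comp (projL S)) + lam • projL Sᶜ) 0 :=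
      ((projL S).hasFDerivAt.comp 0 hFΓd).add ((projL Sᶜ).hasFDerivAt.const_smul lam)
    rw [h1.fderiv]
    ext1 v
    simp only [_root_.add_apply, ContinuousLinearMap.comp_apply, hS, map_smul, projL_projL,
      _root_.smul_apply, ContinuousLinearMap.id_apply]
    rw [← smul_add, projL_add_compl]
  obtain ⟨H, hH, hH0, hHd, hHode⟩ := exists_linearization hf (by simp [f, hΓ0, hF0]) hlam
    (ContinuousLinearMap.id ℂ C3) (fun u => by simp [hfd]) (by
      rw [hfd, smul_smul, inv_mul_cancel₀ hlam, one_smul, sub_self, norm_zero]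
      exact one_pos)
  -- A local chart: for p near 0 it provides u in the subspace with the S-part of H u equal to that
  -- of p.
  let G : C3 → C3 := fun u => projL S (H u) + projL Sᶜ u
  have hG : AnalyticAt ℂ G 0 := (((projL S).analyticAt _).comp hH).add ((projL Sᶜ).analyticAt 0)
  have hGd : fderiv ℂ G 0 = (ContinuousLinearEquiv.refl ℂ C3 : C3 →L[ℂ] C3) := by
    have h1 : HasFDerivAt G ((projL S).comp (fderiv ℂ H 0) + projL Sᶜ) 0 :=
      ((projL S).hasFDerivAt.comp 0 hH.differentiableAt.hasFDerivAt).add (projL Sᶜ).hasFDerivAt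
    rw [h1.fderiv, hHd]
    ext1 v
    simp [projL_add_compl]
  have hG0 : G 0 = 0 := by simp [G, hH0]
  have hGs : HasStrictFDerivAt G (ContinuousLinearEquiv.refl ℂ C3 : C3 →L[ℂ] C3) 0 := by
    rw [← hGd]; exact hG.hasStrictFDerivAt
  have hT : 0 < 2 * Real.pi / |ω| := div_pos Real.two_pi_pos (abs_pos.2 hω)
  refine ⟨hT, fun V hV => ?_⟩
  have hPH : Tendsto (fun u => projL S (H u)) (𝓝 0) (𝓝 0) := by
    have := (((projL S).analyticAt _).comp hH).continuousAt.tendsto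
    simpa [Function.comp_def, hH0] using this
  have hΓt := tendsto_graphMap (S := S) h.analyticAt h.zero
  have e1 : ∀ᶠ u in 𝓝 (0 : C3), lam • fderiv ℂ H u u = f (H u) := hHode
  have e2 : ∀ᶠ u in 𝓝 (0 : C3), DifferentiableAt ℂ H u :=
    hH.eventually_analyticAt.mono fun _ h => h.differentiableAt
  have e3 : ∀ᶠ u in 𝓝 (0 : C3), DifferentiableAt ℂ ψ (projL S (H u)) :=
    hPH.eventually (h.analyticAt.eventually_analyticAt.mono fun _ h => h.differentiableAt)
  have e4 : ∀ᶠ u in 𝓝 (0 : C3), projL Sᶜ (F (graphMap S ψ (projL S (H u)))) =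
      projL Sᶜ (fderiv ℂ ψ (projL S (projL S (H u)))
        (projL S (F (graphMap S ψ (projL S (H u)))))) := hPH.eventually h.tangent
  have e5 : ∀ᶠ u in 𝓝 (0 : C3), graphMap S ψ (projL S (H u)) ∈ M ∧
      graphMap S ψ (projL S (H u)) ∈ V := by
    filter_upwards [(hΓt.comp hPH).eventually (hM.and (Filter.eventually_mem_set.2 hV))] with u hu
    exact ⟨hu.1.2 (graphMap_graphMap _), hu.2⟩
  set Φ := hGs.toOpenPartialHomeomorph G with hΦ
  have hΦG : ∀ u, Φ u = G u := fun u => rfl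
  have h0s : (0 : C3) ∈ Φ.source := hGs.mem_toOpenPartialHomeomorph_source
  have h0t : (0 : C3) ∈ Φ.target := by
    have := Φ.map_source h0s
    rwa [hΦG, hG0] at this
  have hsymm0 : Φ.symm 0 = 0 := by
    have := Φ.left_inv h0s
    rwa [hΦG, hG0] at this
  have hsymm : Tendsto Φ.symm (𝓝 0) (𝓝 0) := by
    have := (Φ.continuousAt_symm h0t).tendsto
    rwa [hsymm0] at this
  obtain ⟨r, hr, hball⟩ := Metric.eventually_nhds_iff_ball.1
    (((e1.and e2).and (e3.and e4)).and (e5.and (Φ.open_source.eventually_mem h0s)))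
  have hU : ∀ᶠ p in 𝓝 (0 : C3), (p ∈ M ↔ graphMap S ψ p = p) ∧
      Φ.symm (projL S p) ∈ Metric.ball (0 : C3) r ∧ projL S p ∈ Φ.target :=
    hM.and (((hsymm.comp (tendsto_projL S)).eventually_mem (Metric.ball_mem_nhds _ hr)).and
      ((tendsto_projL S).eventually_mem (Φ.open_target.mem_nhds h0t)))
  refine ⟨_, hU, fun p hp hp0 => ?_⟩
  have hpU : (p ∈ M ↔ graphMap S ψ p = p) ∧
      Φ.symm (projL S p) ∈ Metric.ball (0 : C3) r ∧ projL S p ∈ Φ.target := hp.2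
  have hpΓ := hpU.1.1 hp.1
  set u := Φ.symm (projL S p) with hu
  have hGu : G u = projL S p := Φ.right_inv hpU.2.2
  have hPu : projL S (H u) = projL S p := by
    have := congrArg (projL S) hGu
    simpa [G] using this
  have hQu : projL Sᶜ u = 0 := by
    have := congrArg (projL Sᶜ) hGu
    simpa [G] using this
  -- As ω is real, the linear flow preserves the norm, so the orbit remains in the ball for all
  -- times.
  have hexp : ∀ t : ℝ, Complex.exp (lam * t) • u ∈ Metric.ball (0 : C3) r := fun t => by
    have h1 : ‖Complex.exp (lam * t)‖ = 1 := by
      rw [Complex.norm_exp, hlamd]; simp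
    rw [mem_ball_zero_iff, norm_smul, h1, one_mul]
    simpa using hpU.2.1
  let γ : ℝ → C3 := fun t => graphMap S ψ (projL S (H (Complex.exp (lam * t) • u)))
  have hγ0 : γ 0 = p := by
    simp only [γ, Complex.ofReal_zero, mul_zero, Complex.exp_zero, one_smul]
    rw [hPu, ← hpΓ]
    exact graphMap_congr (by simp)
  refine ⟨γ, hγ0, fun t => ?_, fun t => (hball _ (hexp t)).2.1, fun t => ?_, fun s hs0 hsT hper => ?_⟩
  · have hz := hball _ (hexp t)
    have d1 : HasDerivAt (fun t : ℝ => Complex.exp (lam * t) • u)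
        (lam • Complex.exp (lam * t) • u) t := by
      have h1 : HasDerivAt (fun z : ℂ => Complex.exp (lam * z)) (Complex.exp (lam * t) * lam) (t : ℂ) := by
        simpa using ((hasDerivAt_id (t : ℂ)).const_mul lam).cexp
      have h2 := h1.comp_ofReal.smul_const u
      rwa [mul_comm, mul_smul] at h2
    set z := Complex.exp (lam * t) • u with hzd
    have d2 := (hz.1.1.2.hasFDerivAt.restrictScalars ℝ).comp_hasDerivAt t d1
    have d3 : HasDerivAt (fun t : ℝ => projL S (H (Complex.exp (lam * t) • u)))
        (projL S (F (graphMap S ψ (projL S (H z))))) t := by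
      refine ((((projL S).restrictScalars ℝ).hasFDerivAt).comp_hasDerivAt t d2).congr_deriv ?_
      simp only [ContinuousLinearMap.coe_restrictScalars', map_smul]
      rw [← map_smul, hz.1.1.1]
      simp only [f, map_add, map_smul, projL_projL, projL_projL_compl, smul_zero, add_zero]
      congr 2
      exact graphMap_congr (by simp)
    have d4 := ((hasFDerivAt_graphMap (S := S) (ψ := ψ) (u := projL S (H z))
      (by simpa using hz.1.2.1)).restrictScalars ℝ).comp_hasDerivAt t d3
    refine d4.congr_deriv ?_
    simp only [ContinuousLinearMap.coe_restrictScalars', _root_.add_apply,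
      ContinuousLinearMap.comp_apply, projL_projL]
    have h4 := hz.1.2.2
    rw [projL_projL] at h4
    rw [← h4, projL_add_compl]
  · have hexpT : Complex.exp (lam * ((t + 2 * Real.pi / |ω| : ℝ) : ℂ)) = Complex.exp (lam * t) := by
      rw [Complex.exp_eq_exp_iff_exists_int]
      rcases lt_or_gt_of_ne hω with hneg | hpos
      · refine ⟨-1, ?_⟩
        rw [abs_of_neg hneg, hlamd]
        have : (ω : ℂ) ≠ 0 := by exact_mod_cast hω
        push_cast
        field_simp
      · refine ⟨1, ?_⟩
        rw [abs_of_pos hpos, hlamd]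
        have : (ω : ℂ) ≠ 0 := by exact_mod_cast hω
        push_cast
        field_simp
    simp only [γ, hexpT]
  · have h1 : γ s = γ 0 := by simpa using hper 0
    have h2 := congrArg (projL S) h1
    rw [hγ0] at h2
    simp only [γ, projL_graphMap, projL_projL] at h2
    -- A period s makes the chart take the same value at exp(lam s)u and at u. Injectivity then
    -- forces u = 0 for 0 < s < T, contradicting p ≠ 0.
    have h3 : G (Complex.exp (lam * s) • u) = G u := by
      simp only [G, h2, hPu, map_smul, hQu, smul_zero]
    have hus : u ∈ Φ.source := Φ.map_target hpU.2.2
    have h4 := Φ.injOn (hball _ (hexp s)).2.2 hus h3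
    have h5 : u = 0 := by
      by_contra hu0
      have : (Complex.exp (lam * s) - 1) • u = 0 := by rw [sub_smul, one_smul, h4, sub_self]
      rcases smul_eq_zero.1 this with h6 | h6
      · exact exp_mul_I_ne_one hω hs0 hsT (sub_eq_zero.1 h6)
      · exact hu0 h6
    have h6 : projL S p = 0 := by rw [← hGu, h5, hG0]
    apply hp0
    rw [← hpΓ, graphMap_congr (v := 0) (by simpa using h6), hΓ0]

end Isochronous

/-! ### Leading coefficients at a regular singular point -/

section LeadingOrder

variable {W : Type*} [NormedAddCommGroup W] [NormedSpace ℂ W] [CompleteSpace W]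

/-- The leading coefficient of a solution of `x φ' = A φ + o(φ)` is an eigenvector of `A`. -/
theorem eventually_eq_zero_or_leading_eigenvector {φ : ℂ → W} (hφ : AnalyticAt ℂ φ 0)
    (A : W →L[ℂ] W) (h : (fun σ => σ • deriv φ σ - A (φ σ)) =o[𝓝 0] φ) :
    (∀ᶠ σ in 𝓝 0, φ σ = 0) ∨ ∃ (n : ℕ) (g : ℂ → W), AnalyticAt ℂ g 0 ∧ g 0 ≠ 0 ∧
      (∀ᶠ σ in 𝓝 0, φ σ = σ ^ n • g σ) ∧ (n : ℂ) • g 0 = A (g 0) := by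
  refine or_iff_not_imp_left.2 fun hne => ?_
  obtain ⟨n, g, hg, hg0, hφg⟩ := hφ.exists_eventuallyEq_pow_smul_nonzero_iff.2 hne
  simp only [sub_zero] at hφg
  refine ⟨n, g, hg, hg0, hφg, ?_⟩
  have hd : ∀ᶠ σ in 𝓝 (0 : ℂ), σ • deriv φ σ - A (φ σ) =
      σ ^ n • ((n : ℂ) • g σ + σ • deriv g σ - A (g σ)) := by
    filter_upwards [hφg.eventually_nhds, hg.eventually_analyticAt] with σ hσ hgσ
    have h1 : HasDerivAt (fun σ => σ ^ n • g σ) (σ ^ n • deriv g σ + (n * σ ^ (n - 1)) • g σ) σ :=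
      (hasDerivAt_pow n σ).smul hgσ.differentiableAt.hasDerivAt
    have h2 : φ =ᶠ[𝓝 σ] fun σ => σ ^ n • g σ := hσ
    rw [h2.deriv_eq, h1.deriv, hσ.self_of_nhds, map_smul]
    have h3 : σ * (n * σ ^ (n - 1)) = σ ^ n * n := by
      cases n with
      | zero => simp
      | succ k => rw [Nat.add_sub_cancel]; ring
    rw [smul_add, smul_smul, smul_smul, h3, smul_sub, smul_add, smul_smul, smul_smul,
      mul_comm σ]
    abel
  have hlim : Tendsto (fun σ => (n : ℂ) • g σ + σ • deriv g σ - A (g σ)) (𝓝[≠] 0)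
      (𝓝 ((n : ℂ) • g 0 - A (g 0))) := by
    have hc : ContinuousAt (fun σ => (n : ℂ) • g σ + σ • deriv g σ - A (g σ)) 0 := by
      have := hg.continuousAt
      have := hg.deriv.continuousAt
      fun_prop
    have := hc.tendsto
    simp only [zero_smul, add_zero] at this
    exact this.mono_left nhdsWithin_le_nhds
  have ho : (fun σ => (n : ℂ) • g σ + σ • deriv g σ - A (g σ)) =o[𝓝[≠] 0] g := by
    rw [Asymptotics.isLittleO_iff]
    intro c hc
    filter_upwards [((Asymptotics.isLittleO_iff.1 h hc).and (hd.and hφg)).filter_mono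
      nhdsWithin_le_nhds, self_mem_nhdsWithin] with σ hσ hσ0
    obtain ⟨h1, h2, h3⟩ := hσ
    have hpos : 0 < ‖σ ^ n‖ := norm_pos_iff.2 (pow_ne_zero _ hσ0)
    rw [h2, h3, norm_smul, norm_smul] at h1
    refine le_of_mul_le_mul_left ?_ hpos
    linarith
  have h0 : Tendsto (fun σ => (n : ℂ) • g σ + σ • deriv g σ - A (g σ)) (𝓝[≠] 0) (𝓝 0) := by
    have hb : g =O[𝓝[≠] 0] fun _ => (1 : ℝ) :=
      (hg.continuousAt.tendsto.isBigO_one ℝ).mono nhdsWithin_le_nhds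
    exact (Asymptotics.isLittleO_one_iff ℝ).1 (ho.trans_isBigO hb)
  exact sub_eq_zero.1 (tendsto_nhds_unique hlim h0)

end LeadingOrder

/-! ### The manifold when Λ is the same scalar on the subspace and on its quotient -/

section ScalarEigenvalue

variable {S : Finset (Fin 3)} {ψ : C3 → C3} {F : C3 → C3} {lam : ℂ}

/-- If `range (projL S)` is an eigenspace and the eigenvalue is the same on the quotient, there is
an eigenspace linearization. -/
theorem exists_linearization_of_scalar (hF : AnalyticAt ℂ F 0) (hF0 : F 0 = 0) (hlam : lam ≠ 0)
    (hP : ∀ v, fderiv ℂ F 0 (projL S v) = lam • projL S v)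
    (hQ : ∀ v, projL Sᶜ (fderiv ℂ F 0 (projL Sᶜ v)) = lam • projL Sᶜ v) :
    ∃ K : C3 → C3, AnalyticAt ℂ K 0 ∧ K 0 = 0 ∧ fderiv ℂ K 0 = projL S ∧
      ∀ᶠ u in 𝓝 (0 : C3), lam • fderiv ℂ K u u = F (K u) := by
  -- The nilpotent part of Λ: it kills the S-directions and takes values in them.
  set L : C3 →L[ℂ] C3 := (fderiv ℂ F 0).comp (projL Sᶜ) - lam • projL Sᶜ with hL
  have hLP : ∀ v, projL S (L v) = L v := fun v => by
    have h1 : projL Sᶜ (L v) = 0 := by simp [hL, hQ]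
    have := projL_add_compl S (L v)
    rwa [h1, add_zero] at this
  obtain ⟨δ, hδ, hδ1⟩ : ∃ δ : ℝ, 0 < δ ∧ δ * ‖lam⁻¹ • L‖ < 1 := by
    refine ⟨(‖lam⁻¹ • L‖ + 1)⁻¹, by positivity, ?_⟩
    rw [inv_mul_lt_iff₀ (by positivity)]
    linarith
  have hδc : (δ : ℂ) ≠ 0 := by exact_mod_cast hδ.ne'
  -- Scaling the complement by δ conjugates lam + L into lam + δL, which is close enough to a scalar
  -- for the linearization theorem.
  set D : C3 →L[ℂ] C3 := projL S + (δ : ℂ) • projL Sᶜ with hD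
  set D' : C3 →L[ℂ] C3 := projL S + (δ : ℂ)⁻¹ • projL Sᶜ with hD'
  have hDD' : ∀ v, D (D' v) = v := fun v => by
    have := projL_add_compl S v
    simp [hD, hD', smul_smul, hδc, this]
  have hf : AnalyticAt ℂ (fun p => D' (F (D p))) 0 :=
    (D'.analyticAt _).comp (AnalyticAt.comp (g := F) (by simpa using hF) (D.analyticAt 0))
  have hfd : fderiv ℂ (fun p => D' (F (D p))) 0 = lam • ContinuousLinearMap.id ℂ C3 + (δ : ℂ) • L := by
    have h1 : HasFDerivAt F (fderiv ℂ F 0) (D 0) := by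
      simpa using hF.differentiableAt.hasFDerivAt
    have h2 : HasFDerivAt (fun p => D' (F (D p))) (D'.comp ((fderiv ℂ F 0).comp D)) 0 :=
      D'.hasFDerivAt.comp 0 (h1.comp 0 D.hasFDerivAt)
    rw [h2.fderiv]
    ext1 v
    have h3 : fderiv ℂ F 0 (projL Sᶜ v) = lam • projL Sᶜ v + L v := by simp [hL]
    have h4 : D' (L v) = L v := by
      have : projL Sᶜ (L v) = 0 := by rw [← hLP, projL_compl_projL]
      simp [hD', hLP, this]
    have h5 : D' (projL S v) = projL S v := by simp [hD']
    have h6 : D' (projL Sᶜ v) = (δ : ℂ)⁻¹ • projL Sᶜ v := by simp [hD']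
    have h7 : D v = projL S v + (δ : ℂ) • projL Sᶜ v := by simp [hD]
    rw [ContinuousLinearMap.comp_apply, ContinuousLinearMap.comp_apply, h7, map_add, hP, map_smul,
      h3, map_add, map_smul, h5, map_smul, map_add, map_smul, h6, h4]
    have h8 : lam • v = lam • projL S v + lam • projL Sᶜ v := by rw [← smul_add, projL_add_compl]
    simp only [smul_add, smul_smul]
    rw [show (δ : ℂ) * (lam * (δ : ℂ)⁻¹) = lam by field_simp]
    simp only [_root_.add_apply, _root_.smul_apply, ContinuousLinearMap.id_apply]
    rw [h8]
    abel
  obtain ⟨K, hK, hK0, hKd, hKode⟩ := exists_linearization hf (by simp [hF0]) hlam (projL S)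
    (fun u => by
      have h1 : L (projL S u) = 0 := by simp [hL]
      simp [hfd, h1])
    (by
      rw [hfd, smul_add, smul_smul, inv_mul_cancel₀ hlam, one_smul, add_sub_cancel_left,
        smul_comm, norm_smul, Complex.norm_real, Real.norm_of_nonneg hδ.le]
      exact hδ1)
  refine ⟨fun u => D (K u), (D.analyticAt _).comp hK, by simp [hK0], ?_, ?_⟩
  · have h1 : HasFDerivAt (fun u => D (K u)) (D.comp (fderiv ℂ K 0)) 0 :=
      D.hasFDerivAt.comp 0 hK.differentiableAt.hasFDerivAt
    rw [h1.fderiv, hKd]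
    ext1 v
    simp [hD]
  · filter_upwards [hKode, hK.eventually_analyticAt] with u hu hKu
    have h1 : HasFDerivAt (fun u => D (K u)) (D.comp (fderiv ℂ K u)) u :=
      D.hasFDerivAt.comp u hKu.differentiableAt.hasFDerivAt
    rw [h1.fderiv, ContinuousLinearMap.comp_apply, ← map_smul, hu, hDD']

variable {K : C3 → C3}

/-- The graph is the image under K of the subspace, written over its S-coordinates with the inverse
function theorem. Tangency holds because F at K(v) is lam times the image under DK(v) of the vector
v, which lies in the subspace. -/
theorem exists_isTangentGraph_of_linearization (hK : AnalyticAt ℂ K 0) (hK0 : K 0 = 0)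
    (hKd : fderiv ℂ K 0 = projL S)
    (hode : ∀ᶠ u in 𝓝 (0 : C3), lam • fderiv ℂ K u u = F (K u)) :
    ∃ ψ, IsTangentGraph F S ψ := by
  let G : C3 → C3 := fun u => projL S (K u) + projL Sᶜ u
  have hG : AnalyticAt ℂ G 0 := (((projL S).analyticAt _).comp hK).add ((projL Sᶜ).analyticAt 0)
  have hGd' : ∀ u, DifferentiableAt ℂ K u →
      HasFDerivAt G ((projL S).comp (fderiv ℂ K u) + projL Sᶜ) u := fun u hu =>
    ((projL S).hasFDerivAt.comp u hu.hasFDerivAt).add (projL Sᶜ).hasFDerivAt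
  have hGd : fderiv ℂ G 0 = (ContinuousLinearEquiv.refl ℂ C3 : C3 →L[ℂ] C3) := by
    rw [(hGd' 0 hK.differentiableAt).fderiv, hKd]
    ext1 v
    simp [projL_add_compl]
  have hG0 : G 0 = 0 := by simp [G, hK0]
  have hGs : HasStrictFDerivAt G (ContinuousLinearEquiv.refl ℂ C3 : C3 →L[ℂ] C3) 0 := by
    rw [← hGd]; exact hG.hasStrictFDerivAt
  set Φ := hGs.toOpenPartialHomeomorph G with hΦ
  have hΦG : ∀ u, Φ u = G u := fun u => rfl
  have h0s : (0 : C3) ∈ Φ.source := hGs.mem_toOpenPartialHomeomorph_source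
  have h0t : (0 : C3) ∈ Φ.target := by
    have := Φ.map_source h0s
    rwa [hΦG, hG0] at this
  have hsymm0 : Φ.symm 0 = 0 := by
    have := Φ.left_inv h0s
    rwa [hΦG, hG0] at this
  have hsymma : AnalyticAt ℂ Φ.symm 0 := by
    have := Φ.analyticAt_symm' h0s (i := ContinuousLinearEquiv.refl ℂ C3) hG hGd
    rwa [hΦG, hG0] at this
  have hKs : AnalyticAt ℂ (fun q => K (Φ.symm q)) 0 :=
    AnalyticAt.comp (g := K) (by rwa [hsymm0]) hsymma
  have hψ : AnalyticAt ℂ (fun q => projL Sᶜ (K (Φ.symm q))) 0 := ((projL Sᶜ).analyticAt _).comp hKs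
  have hψd : ∀ q, DifferentiableAt ℂ Φ.symm q → DifferentiableAt ℂ K (Φ.symm q) →
      HasFDerivAt (fun q => projL Sᶜ (K (Φ.symm q)))
        ((projL Sᶜ).comp ((fderiv ℂ K (Φ.symm q)).comp (fderiv ℂ Φ.symm q))) q := fun q h1 h2 =>
    (projL Sᶜ).hasFDerivAt.comp q (h2.hasFDerivAt.comp q h1.hasFDerivAt)
  have hsymm : Tendsto Φ.symm (𝓝 0) (𝓝 0) := by
    have := (Φ.continuousAt_symm h0t).tendsto
    rwa [hsymm0] at this
  refine ⟨fun q => projL Sᶜ (K (Φ.symm q)), hψ, by simp [hsymm0, hK0], ?_, ?_⟩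
  · rw [(hψd 0 hsymma.differentiableAt (by rw [hsymm0]; exact hK.differentiableAt)).fderiv, hsymm0,
      hKd]
    ext1 v
    simp
  · have ht := hsymm.comp (tendsto_projL S)
    filter_upwards [(tendsto_projL S).eventually hsymma.eventually_analyticAt,
      (tendsto_projL S).eventually (Φ.open_target.eventually_mem h0t),
      ht.eventually hK.eventually_analyticAt, ht.eventually hode] with u h1 h2 h3 h4
    simp only [Function.comp] at h3 h4
    rw [(hψd _ h1.differentiableAt h3.differentiableAt).fderiv]
    set v := Φ.symm (projL S u) with hv
    have hGv : G v = projL S u := Φ.right_inv h2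
    have hPv : projL S (K v) = projL S u := by
      have := congrArg (projL S) hGv
      simpa [G] using this
    have hQv : projL Sᶜ v = 0 := by
      have := congrArg (projL Sᶜ) hGv
      simpa [G] using this
    have hΓ : graphMap S (fun q => projL Sᶜ (K (Φ.symm q))) u = K v := by
      rw [graphMap, ← hv, projL_projL, ← hPv, projL_add_compl]
    have hvs : v ∈ Φ.source := Φ.map_target h2
    have hinv : fderiv ℂ Φ.symm (projL S u) (fderiv ℂ G v v) = v := by
      have e1 : HasFDerivAt Φ.symm (fderiv ℂ Φ.symm (projL S u)) (G v) := by
        rw [hGv]; exact h1.differentiableAt.hasFDerivAt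
      have e2 := e1.comp v (hGd' v h3.differentiableAt)
      have e3 : (Φ.symm ∘ G) =ᶠ[𝓝 v] id := by
        filter_upwards [Φ.open_source.mem_nhds hvs] with y hy using Φ.left_inv hy
      have e4 := e2.unique ((hasFDerivAt_id v).congr_of_eventuallyEq e3)
      rw [(hGd' v h3.differentiableAt).fderiv]
      exact DFunLike.congr_fun e4 v
    rw [(hGd' v h3.differentiableAt).fderiv, _root_.add_apply, hQv, add_zero,
      ContinuousLinearMap.comp_apply] at hinv
    rw [hΓ, ← h4]
    simp only [map_smul, ContinuousLinearMap.comp_apply, hinv, projL_projL]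

/-- Every invariant graph contains the image of a linearization. -/
theorem IsTangentGraph.graphMap_linearization (h : IsTangentGraph F S ψ) (hF : AnalyticAt ℂ F 0)
    (hF0 : F 0 = 0) (hlam : lam ≠ 0) (hΛ : ∀ v, projL Sᶜ (fderiv ℂ F 0 v) = lam • projL Sᶜ v)
    (hK : AnalyticAt ℂ K 0) (hK0 : K 0 = 0) (hKd : fderiv ℂ K 0 = projL S)
    (hode : ∀ᶠ u in 𝓝 (0 : C3), lam • fderiv ℂ K u u = F (K u)) :
    ∀ᶠ u in 𝓝 (0 : C3), graphMap S ψ (K (projL S u)) = K (projL S u) := by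
  have hKt : Tendsto K (𝓝 0) (𝓝 0) := by
    have := hK.continuousAt.tendsto
    rwa [hK0] at this
  have hΓ := analyticAt_graphMap (S := S) h.analyticAt
  have hψd : ∀ᶠ u in 𝓝 (0 : C3), DifferentiableAt ℂ ψ (projL S u) :=
    (tendsto_projL S).eventually (h.analyticAt.eventually_analyticAt.mono fun _ h => h.differentiableAt)
  let X := tangencyDefect F S ψ
  have hX : AnalyticAt ℂ X 0 := analyticAt_tangencyDefect hF h.analyticAt
  -- The transverse linear part is lam, so the defect minus lam times the deviation has derivative 0
  -- at the origin. Since Y vanishes on the graph, Y(p) is o of the deviation of p.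
  let Y : C3 → C3 := fun p => X p - lam • (p - graphMap S ψ p)
  have hY : AnalyticAt ℂ Y 0 := hX.sub ((analyticAt_id.sub hΓ).const_smul (c := lam))
  have hYd : fderiv ℂ Y 0 = 0 := by
    have h1 : HasFDerivAt X ((projL Sᶜ).comp (fderiv ℂ F 0)) 0 := by
      rw [← fderiv_tangencyDefect hF hF0 h.analyticAt h.fderiv_zero]
      exact hX.differentiableAt.hasFDerivAt
    have h2 := hasFDerivAt_graphMap (S := S) (ψ := ψ) (u := 0)
      (by simpa using h.analyticAt.differentiableAt)
    have h3 : HasFDerivAt Y _ 0 := h1.sub (((hasFDerivAt_id 0).sub h2).const_smul lam)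
    rw [h3.fderiv]
    ext1 v
    have h4 : v - projL S v = projL Sᶜ v := by
      nth_rw 1 [← projL_add_compl S v]; abel
    simp [h.fderiv_zero, hΛ, h4]
  have hYo : (fun q : C3 × C3 => Y q.1 - Y q.2) =o[𝓝 0] fun q => q.1 - q.2 := by
    have := hasStrictFDerivAt_iff_isLittleO.1 hY.hasStrictFDerivAt
    simp only [hYd, _root_.zero_apply, sub_zero] at this
    exact this
  have hKode : ∀ᶠ u in 𝓝 (0 : C3), (lam • fderiv ℂ K u u = F (K u) ∧ AnalyticAt ℂ K u) ∧
      AnalyticAt ℂ (fun p => p - graphMap S ψ p) (K u) ∧ DifferentiableAt ℂ ψ (projL S (K u)) :=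
    (hode.and hK.eventually_analyticAt).and (hKt.eventually
      ((analyticAt_id.sub hΓ).eventually_analyticAt.and hψd))
  obtain ⟨r, hr, hball⟩ := Metric.eventually_nhds_iff_ball.1 hKode
  have hsmall : ∀ᶠ u in 𝓝 (0 : C3), projL S u ∈ Metric.ball (0 : C3) (r / 2) :=
    (tendsto_projL S).eventually_mem (Metric.ball_mem_nhds _ (half_pos hr))
  filter_upwards [hsmall] with u hu
  set v := projL S u with hv
  have hmem : ∀ σ ∈ Metric.ball (0 : ℂ) 2, σ • v ∈ Metric.ball (0 : C3) r := fun σ hσ => by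
    rw [mem_ball_zero_iff] at *
    rw [norm_smul]
    nlinarith [norm_nonneg v, norm_nonneg σ]
  -- The deviation from the graph along a ray; the disc has radius 2 so that σ = 1 is an interior
  -- point.
  let φ : ℂ → C3 := fun σ => K (σ • v) - graphMap S ψ (K (σ • v))
  have hφa : AnalyticOnNhd ℂ φ (Metric.ball 0 2) := fun σ hσ => by
    have h1 := hball _ (hmem σ hσ)
    have h2 : AnalyticAt ℂ (fun σ : ℂ => σ • v) σ := analyticAt_id.smul analyticAt_const
    have h3 : AnalyticAt ℂ (fun σ : ℂ => K (σ • v)) σ := AnalyticAt.comp (g := K) h1.1.2 h2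
    exact AnalyticAt.comp (g := fun p => p - graphMap S ψ p) (f := fun σ : ℂ => K (σ • v)) h1.2.1 h3
  have h02 : (0 : ℂ) ∈ Metric.ball (0 : ℂ) 2 := Metric.mem_ball_self (by norm_num)
  have hφd : ∀ σ ∈ Metric.ball (0 : ℂ) 2, lam • σ • deriv φ σ = X (K (σ • v)) ∧
      deriv φ σ = projL Sᶜ (fderiv ℂ K (σ • v) v) -
        projL Sᶜ (fderiv ℂ ψ (projL S (K (σ • v))) (projL S (fderiv ℂ K (σ • v) v))) := by
    intro σ hσ
    have h1 := hball _ (hmem σ hσ)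
    have h2 : HasDerivAt (fun σ : ℂ => σ • v) v σ := by
      simpa using (hasDerivAt_id σ).smul_const v
    have h3 : HasDerivAt (fun σ : ℂ => K (σ • v)) (fderiv ℂ K (σ • v) v) σ :=
      HasFDerivAt.comp_hasDerivAt (l := K) σ h1.1.2.differentiableAt.hasFDerivAt h2
    have h4 : HasDerivAt φ _ σ := h3.sub (HasFDerivAt.comp_hasDerivAt
      (l := graphMap S ψ) σ (hasFDerivAt_graphMap h1.2.2) h3)
    have h5 : deriv φ σ = projL Sᶜ (fderiv ℂ K (σ • v) v) -
        projL Sᶜ (fderiv ℂ ψ (projL S (K (σ • v))) (projL S (fderiv ℂ K (σ • v) v))) := by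
      rw [h4.deriv]
      simp only [_root_.add_apply, ContinuousLinearMap.comp_apply]
      nth_rw 1 [← projL_add_compl S (fderiv ℂ K (σ • v) v)]
      abel
    refine ⟨?_, h5⟩
    have h6 : F (K (σ • v)) = (lam * σ) • fderiv ℂ K (σ • v) v := by
      rw [← h1.1.1, map_smul, smul_smul]
    simp only [X, tangencyDefect, h6, h5, map_smul, smul_smul, smul_sub]
  have hK0v : Tendsto (fun σ : ℂ => K (σ • v)) (𝓝 0) (𝓝 0) := by
    refine hKt.comp ?_
    have : ContinuousAt (fun σ : ℂ => σ • v) 0 := by fun_prop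
    simpa using this.tendsto
  have hΓt := tendsto_graphMap (S := S) h.analyticAt h.zero
  have hpair : Tendsto (fun σ : ℂ => (K (σ • v), graphMap S ψ (K (σ • v)))) (𝓝 0) (𝓝 (0 : C3 × C3)) :=
    hK0v.prodMk_nhds (hΓt.comp hK0v)
  have ho : (fun σ => σ • deriv φ σ - ContinuousLinearMap.id ℂ C3 (φ σ)) =o[𝓝 0] φ := by
    have h1 := (hYo.comp_tendsto hpair).const_smul_left (lam⁻¹)
    refine h1.congr' ?_ EventuallyEq.rfl
    filter_upwards [Metric.ball_mem_nhds (0 : ℂ) two_pos, hK0v.eventually h.tangent] with σ hσ hT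
    have h2 := (hφd σ hσ).1
    have h3 : X (graphMap S ψ (K (σ • v))) = 0 := (tangencyDefect_graphMap_iff _).2 hT
    change lam⁻¹ • (Y (K (σ • v)) - Y (graphMap S ψ (K (σ • v)))) = σ • deriv φ σ - φ σ
    simp only [Y, h3, graphMap_graphMap, sub_self, smul_zero, sub_zero, ← h2]
    rw [smul_sub, inv_smul_smul₀ hlam, inv_smul_smul₀ hlam]
  have hφ0 : φ 0 = 0 := by simp [φ, hK0, graphMap_zero h.zero]
  have hφ1 : deriv φ 0 = 0 := by
    rw [(hφd 0 h02).2, zero_smul, hKd, hK0, map_zero, h.fderiv_zero]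
    simp [hv]
  -- From σφ' = φ + o(φ) the order of φ can only be 1, which φ'(0) = 0 excludes. The identity
  -- theorem then carries φ = 0 to σ = 1.
  have hzero : ∀ᶠ σ in 𝓝 (0 : ℂ), φ σ = 0 := by
    rcases eventually_eq_zero_or_leading_eigenvector (hφa 0 h02) _ ho with h1 | ⟨n, g, hg, hg0, hφg, hn⟩
    · exact h1
    · exfalso
      rw [ContinuousLinearMap.id_apply] at hn
      have hn1 : n = 1 := by
        have : ((n : ℂ) - 1) • g 0 = 0 := by rw [sub_smul, hn, one_smul, sub_self]
        rcases smul_eq_zero.1 this with h2 | h2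
        · exact_mod_cast sub_eq_zero.1 h2
        · exact absurd h2 hg0
      subst hn1
      have h3 : φ =ᶠ[𝓝 0] fun σ => σ ^ 1 • g σ := hφg
      have h4 : HasDerivAt (fun σ : ℂ => σ ^ 1 • g σ) _ 0 :=
        (hasDerivAt_pow 1 (0 : ℂ)).smul hg.differentiableAt.hasDerivAt
      rw [h3.deriv_eq, h4.deriv] at hφ1
      exact hg0 (by simpa using hφ1)
  have := hφa.eqOn_zero_of_preconnected_of_eventuallyEq_zero
    (convex_ball (0 : ℂ) 2).isPreconnected h02 hzero
  have h1 := this (x := 1) (by simp)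
  simp only [φ, one_smul, Pi.zero_apply] at h1
  exact (sub_eq_zero.1 h1).symm

theorem eventuallyEq_of_graphMap {ψ' : C3 → C3} {M M' : Set C3}
    (hM : ∀ᶠ p in 𝓝 (0 : C3), p ∈ M ↔ graphMap S ψ p = p)
    (hM' : ∀ᶠ p in 𝓝 (0 : C3), p ∈ M' ↔ graphMap S ψ' p = p)
    (h : ∀ᶠ p in 𝓝 (0 : C3), graphMap S ψ p = graphMap S ψ' p) : M' =ᶠ[𝓝 (0 : C3)] M := by
  refine eventuallyEq_set.2 ?_
  filter_upwards [hM, hM', h] with p h1 h2 h3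
  rw [h1, h2, h3]

theorem hasUniqueIsochronousCenterManifold_of_scalar (hF : AnalyticAt ℂ F 0) (hF0 : F 0 = 0)
    {ω : ℝ} (hω : ω ≠ 0) (hP : ∀ v, fderiv ℂ F 0 (projL S v) = (I * ω) • projL S v)
    (hQ : ∀ v, projL Sᶜ (fderiv ℂ F 0 v) = (I * ω) • projL Sᶜ v) :
    HasUniqueIsochronousCenterManifold F S (2 * Real.pi / |ω|) := by
  have hlam : I * (ω : ℂ) ≠ 0 := mul_ne_zero I_ne_zero (by exact_mod_cast hω)
  obtain ⟨K, hK, hK0, hKd, hode⟩ := exists_linearization_of_scalar hF hF0 hlam hP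
    (fun v => by simp [hQ])
  obtain ⟨ψ, hψ⟩ := exists_isTangentGraph_of_linearization hK hK0 hKd hode
  have hM : ∀ᶠ p in 𝓝 (0 : C3), p ∈ {p | graphMap S ψ p = p} ↔ graphMap S ψ p = p :=
    Eventually.of_forall fun _ => Iff.rfl
  refine ⟨_, hψ.isCenterManifold hF, hψ.hasIsochronousCenterFamily hF hF0 hω hP hM,
    fun M' hM' => ?_⟩
  obtain ⟨ψ', hψ', hM'⟩ := (isCenterManifold_iff hF).1 hM'
  refine eventuallyEq_of_graphMap hM hM' ?_
  have hKP : AnalyticAt ℂ (fun u => K (projL S u)) 0 :=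
    AnalyticAt.comp (g := K) (by simpa using hK) ((projL S).analyticAt 0)
  let G : C3 → C3 := fun u => projL S (K (projL S u)) + projL Sᶜ u
  have hG : AnalyticAt ℂ G 0 := (((projL S).analyticAt _).comp hKP).add ((projL Sᶜ).analyticAt 0)
  have hGd : fderiv ℂ G 0 = (ContinuousLinearEquiv.refl ℂ C3 : C3 →L[ℂ] C3) := by
    have h0 : HasFDerivAt K (projL S) (projL S 0) := by
      rw [map_zero, ← hKd]; exact hK.differentiableAt.hasFDerivAt
    have h1 : HasFDerivAt G ((projL S).comp ((projL S).comp (projL S)) + projL Sᶜ) 0 :=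
      ((projL S).hasFDerivAt.comp 0 (h0.comp 0 (projL S).hasFDerivAt)).add (projL Sᶜ).hasFDerivAt
    rw [h1.fderiv]
    ext1 v
    simp [projL_add_compl]
  have hGs : HasStrictFDerivAt G (ContinuousLinearEquiv.refl ℂ C3 : C3 →L[ℂ] C3) 0 := by
    rw [← hGd]; exact hG.hasStrictFDerivAt
  -- The S-coordinates of the image of K fill a neighbourhood of 0, so two graphs that both contain
  -- this image have the same germ.
  have hmap := hGs.map_nhds_eq_of_equiv
  have hG0 : G 0 = 0 := by simp [G, hK0]
  rw [hG0] at hmap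
  have hboth := (hψ.graphMap_linearization hF hF0 hlam hQ hK hK0 hKd hode).and
    (hψ'.graphMap_linearization hF hF0 hlam hQ hK hK0 hKd hode)
  have himg := image_mem_map (m := G) hboth
  rw [hmap] at himg
  filter_upwards [himg] with p hp
  obtain ⟨u, ⟨h1, h2⟩, rfl⟩ := hp
  have h3 : projL S (G u) = projL S (K (projL S u)) := by simp [G]
  rw [graphMap_congr h3, graphMap_congr h3]
  exact h1.trans h2.symm

end ScalarEigenvalue

/-! ### Hadamard's lemma and difference quotients along rays -/

section Hadamard

variable {E W : Type*} [NormedAddCommGroup E] [NormedSpace ℂ E] [NormedAddCommGroup W]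
    [NormedSpace ℂ W]

theorem deriv_comp_smul {G : E → W} (hG : AnalyticAt ℂ G 0) (v : E) :
    deriv (fun s : ℂ => G (s • v)) 0 = fderiv ℂ G 0 v := by
  have h1 : HasDerivAt (fun s : ℂ => s • v) v 0 := by
    simpa using (hasDerivAt_id (0 : ℂ)).smul_const v
  have h2 : HasFDerivAt G (fderiv ℂ G 0) ((0 : ℂ) • v) := by
    rw [zero_smul]; exact hG.differentiableAt.hasFDerivAt
  exact (HasFDerivAt.comp_hasDerivAt (l := G) 0 h2 h1).deriv

variable [CompleteSpace W]

/-- Hadamard's lemma for analytic maps. -/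
theorem AnalyticAt.exists_eq_add_clm_apply {G : E → W} (hG : AnalyticAt ℂ G 0) :
    ∃ L : E → E →L[ℂ] W, AnalyticAt ℂ L 0 ∧ ∀ᶠ y in 𝓝 0, G y = G 0 + L y y := by
  obtain ⟨p, r, hp⟩ := hG
  have hrad : 0 < p.shift.radius := by
    rw [p.radius_shift]; exact hp.r_pos.trans_le hp.r_le
  have hL := p.shift.hasFPowerSeriesOnBall hrad
  refine ⟨p.shift.sum, hL.analyticAt, ?_⟩
  filter_upwards [Metric.eball_mem_nhds (0 : E) hp.r_pos, Metric.eball_mem_nhds (0 : E) hrad]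
    with y hy hy'
  have h1 := hp.hasSum hy
  have h2 := (ContinuousLinearMap.apply ℂ W y).hasSum (hL.hasSum hy')
  rw [zero_add] at h1 h2
  have h3 := (hasSum_nat_add_iff' 1).2 h1
  have h4 : ∀ n, p (n + 1) (fun _ => y) = (ContinuousLinearMap.apply ℂ W y) (p.shift n fun _ => y) :=
    fun n => by
      simp only [FormalMultilinearSeries.shift, ContinuousLinearMap.apply_apply]
      rw [ContinuousMultilinearMap.curryRight_apply]
      congr 1
      ext i
      refine Fin.lastCases ?_ (fun j => ?_) i <;> simp
  simp only [h4, Finset.sum_range_one] at h3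
  have h5 := h3.unique h2
  have h6 : p 0 (fun _ => y) = G 0 := by rw [hp.coeff_zero]
  rw [h6, ContinuousLinearMap.apply_apply] at h5
  rw [← h5]; abel

/-- Writing G(y) = G(0) + L(y)y, the quotient equals L(sv)v, also at s = 0. Hence blow-up and
reduction are jointly analytic. -/
theorem analyticAt_dslope_smul {G : E → W} (hG : AnalyticAt ℂ G 0) (v₀ : E) :
    AnalyticAt ℂ (fun q : ℂ × E => dslope (fun s : ℂ => G (s • q.2)) 0 q.1) (0, v₀) := by
  obtain ⟨L, hL, hGL⟩ := hG.exists_eq_add_clm_apply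
  have hsm : AnalyticAt ℂ (fun q : ℂ × E => q.1 • q.2) (0, v₀) := analyticAt_fst.smul analyticAt_snd
  have h1 : AnalyticAt ℂ (fun q : ℂ × E => L (q.1 • q.2) q.2) (0, v₀) :=
    (AnalyticAt.comp (g := L) (f := fun q : ℂ × E => q.1 • q.2) (by simpa using hL)
      hsm).clm_apply_of_clm analyticAt_snd
  refine h1.congr ?_
  have ht : Tendsto (fun q : ℂ × E => q.1 • q.2) (𝓝 (0, v₀)) (𝓝 0) := by
    simpa using hsm.continuousAt.tendsto
  have hL0 : fderiv ℂ G 0 = L 0 := by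
    have e1 : HasFDerivAt (fun y => G 0 + L y y) (L 0) 0 := by
      have := (hL.differentiableAt.hasFDerivAt.clm_apply (hasFDerivAt_id (𝕜 := ℂ) (0 : E))).const_add (G 0)
      refine this.congr_fderiv ?_
      ext1 v; simp
    rw [EventuallyEq.fderiv_eq (f₁ := G) hGL, e1.fderiv]
  filter_upwards [ht.eventually hGL] with q hq
  by_cases h0 : q.1 = 0
  · rw [h0, dslope_same, deriv_comp_smul hG, zero_smul, hL0]
  · rw [dslope_of_ne _ h0, slope_def_module, sub_zero, zero_smul, hq, add_sub_cancel_left, map_smul,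
      inv_smul_smul₀ h0]

end Hadamard

/-! ### Briot–Bouquet systems: reduction, uniqueness, dominated existence -/

section BriotBouquet

/-- `x w' = Φ(x, w)` is a Briot-Bouquet system at the origin. -/
structure IsBriotBouquet (Φ : ℂ → (Fin 2 → ℂ) → Fin 2 → ℂ) : Prop where
  analyticAt : AnalyticAt ℂ (fun q : ℂ × (Fin 2 → ℂ) => Φ q.1 q.2) 0
  zero : Φ 0 0 = 0

/-- `w` is a holomorphic solution germ of `x w' = Φ(x, w)` with `w(0) = 0`. -/
structure IsBriotBouquetSol (Φ : ℂ → (Fin 2 → ℂ) → Fin 2 → ℂ) (w : ℂ → Fin 2 → ℂ) : Prop where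
  analyticAt : AnalyticAt ℂ w 0
  zero : w 0 = 0
  ode : ∀ᶠ x in 𝓝 0, x • deriv w x = Φ x (w x)

/-- The substitution `w = x (w̃ + c)` in `x w' = Φ(x, w)`. -/
noncomputable def reduceBy (Φ : ℂ → (Fin 2 → ℂ) → Fin 2 → ℂ) (c : Fin 2 → ℂ) :
    ℂ → (Fin 2 → ℂ) → Fin 2 → ℂ :=
  fun x w i => dslope (fun s : ℂ => Φ s (s • (w + c)) i) 0 x - (w i + c i)

theorem reduce_eq_reduceBy (Φ : ℂ → (Fin 2 → ℂ) → Fin 2 → ℂ) :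
    reduce Φ = reduceBy Φ ((1 - wMatrix Φ)⁻¹.mulVec (xCoeff Φ)) := rfl

variable {Φ : ℂ → (Fin 2 → ℂ) → Fin 2 → ℂ} {c : Fin 2 → ℂ}

theorem IsBriotBouquet.analyticAt_apply (h : IsBriotBouquet Φ) (i : Fin 2) :
    AnalyticAt ℂ (fun q : ℂ × (Fin 2 → ℂ) => Φ q.1 q.2 i) 0 :=
  ((ContinuousLinearMap.proj (R := ℂ) (φ := fun _ : Fin 2 => ℂ) i).analyticAt _).comp h.analyticAt

theorem IsBriotBouquet.fderiv_apply_apply (h : IsBriotBouquet Φ) (v : ℂ × (Fin 2 → ℂ)) (i : Fin 2) :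
    fderiv ℂ (fun q : ℂ × (Fin 2 → ℂ) => Φ q.1 q.2 i) 0 v =
      fderiv ℂ (fun q : ℂ × (Fin 2 → ℂ) => Φ q.1 q.2) 0 v i := by
  have := (ContinuousLinearMap.proj (R := ℂ) (φ := fun _ : Fin 2 => ℂ) i).hasFDerivAt.comp 0
    h.analyticAt.differentiableAt.hasFDerivAt
  exact DFunLike.congr_fun this.fderiv v

theorem IsBriotBouquet.fderiv_eq (h : IsBriotBouquet Φ) (t : ℂ) (v : Fin 2 → ℂ) :
    fderiv ℂ (fun q : ℂ × (Fin 2 → ℂ) => Φ q.1 q.2) 0 (t, v) =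
      t • xCoeff Φ + (wMatrix Φ).mulVec v := by
  set D := fderiv ℂ (fun q : ℂ × (Fin 2 → ℂ) => Φ q.1 q.2) 0 with hD
  have h1 : D (1, 0) = xCoeff Φ := by
    ext i
    rw [hD, ← h.fderiv_apply_apply, ← deriv_comp_smul (h.analyticAt_apply i)]
    simp [xCoeff]
  have h2 : ∀ j, D (0, Pi.single j 1) = fun i => wMatrix Φ i j := fun j => by
    ext i
    rw [hD, ← h.fderiv_apply_apply, ← deriv_comp_smul (h.analyticAt_apply i)]
    simp [wMatrix, ← Pi.single_smul]
  have h3 : ((t, v) : ℂ × (Fin 2 → ℂ)) = t • (1, 0) + (v 0 • (0, Pi.single 0 1) + v 1 • (0, Pi.single 1 1)) := by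
    ext i
    · simp
    · fin_cases i <;> simp
  rw [h3, map_add, map_add, map_smul, map_smul, map_smul, h1, h2, h2]
  ext i
  fin_cases i <;> simp <;> ring

theorem reduceBy_zero_left (h : IsBriotBouquet Φ) (w : Fin 2 → ℂ) :
    reduceBy Φ c 0 w = xCoeff Φ + (wMatrix Φ).mulVec (w + c) - (w + c) := by
  ext i
  have h1 := deriv_comp_smul (h.analyticAt_apply i) (1, w + c)
  rw [h.fderiv_apply_apply, h.fderiv_eq] at h1
  simp only [reduceBy, dslope_same, Pi.sub_apply, Pi.add_apply]
  simp only [Prod.smul_fst, Prod.smul_snd, smul_eq_mul, mul_one, one_smul, Pi.add_apply] at h1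
  rw [h1]

/-- The new constant term is b + Ac - c. Phrasing the condition on c as an equation, without the
inverse of 1 - A, keeps the step available at a resonance. -/
theorem isBriotBouquet_reduceBy (h : IsBriotBouquet Φ)
    (hc : xCoeff Φ + (wMatrix Φ).mulVec c = c) : IsBriotBouquet (reduceBy Φ c) := by
  refine ⟨?_, by rw [reduceBy_zero_left h, zero_add, hc, sub_self]⟩
  refine AnalyticAt.pi fun i => ?_
  have h1 := analyticAt_dslope_smul (h.analyticAt_apply i) (1, c)
  have h2 : AnalyticAt ℂ (fun q : ℂ × (Fin 2 → ℂ) => (q.1, ((1 : ℂ), q.2 + c))) 0 :=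
    analyticAt_fst.prod (analyticAt_const.prod (analyticAt_snd.add analyticAt_const))
  have h3 := AnalyticAt.comp (f := fun q : ℂ × (Fin 2 → ℂ) => (q.1, ((1 : ℂ), q.2 + c))) (x := 0)
    (by simpa using h1) h2
  have h4 : AnalyticAt ℂ (fun q : ℂ × (Fin 2 → ℂ) => q.2 i) 0 :=
    ((ContinuousLinearMap.proj (R := ℂ) (φ := fun _ : Fin 2 => ℂ) i).analyticAt _).comp analyticAt_snd
  refine (h3.sub (h4.add (analyticAt_const (v := c i)))).congr (Eventually.of_forall fun q => ?_)
  simp [reduceBy, Function.comp_def]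

theorem wMatrix_apply (Φ : ℂ → (Fin 2 → ℂ) → Fin 2 → ℂ) (i j : Fin 2) :
    wMatrix Φ i j = deriv (fun s : ℂ => Φ 0 (Pi.single j s) i) 0 := rfl

theorem wMatrix_reduceBy (h : IsBriotBouquet Φ) : wMatrix (reduceBy Φ c) = wMatrix Φ - 1 := by
  ext i j
  rw [wMatrix_apply (reduceBy Φ c), Matrix.sub_apply]
  simp only [reduceBy_zero_left h]
  have h1 : ∀ s : ℂ, (xCoeff Φ + (wMatrix Φ).mulVec ((Pi.single j s : Fin 2 → ℂ) + c) -
      ((Pi.single j s : Fin 2 → ℂ) + c)) i =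
      s * (wMatrix Φ i j - (1 : Matrix (Fin 2) (Fin 2) ℂ) i j) +
        (xCoeff Φ + (wMatrix Φ).mulVec c - c) i := fun s => by
    have h2 : (Pi.single j s : Fin 2 → ℂ) i = s * (1 : Matrix (Fin 2) (Fin 2) ℂ) i j := by
      by_cases hij : i = j
      · subst hij; simp
      · simp [hij]
    simp only [Matrix.mulVec_add, Matrix.mulVec_single, Pi.sub_apply, Pi.add_apply, h2,
      Pi.smul_apply, MulOpposite.smul_eq_mul_unop, MulOpposite.unop_op, Matrix.col_apply]
    ring
  simp only [h1]
  simp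

theorem reduceBy_of_ne (h : IsBriotBouquet Φ) {x : ℂ} (hx : x ≠ 0) (w : Fin 2 → ℂ) :
    reduceBy Φ c x w = x⁻¹ • Φ x (x • (w + c)) - (w + c) := by
  ext i
  simp [reduceBy, dslope_of_ne _ hx, slope_def_module, h.zero]

theorem IsBriotBouquetSol.of_reduceBy (h : IsBriotBouquet Φ) {w : ℂ → Fin 2 → ℂ}
    (hw : IsBriotBouquetSol (reduceBy Φ c) w) :
    IsBriotBouquetSol Φ (fun x => x • (w x + c)) := by
  refine ⟨analyticAt_id.smul (hw.analyticAt.add analyticAt_const), by simp, ?_⟩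
  filter_upwards [hw.ode, hw.analyticAt.eventually_analyticAt] with x hx hxa
  have h1 : HasDerivAt (fun x => x • (w x + c)) (x • deriv w x + (1 : ℂ) • (w x + c)) x :=
    (hasDerivAt_id x).smul (hxa.differentiableAt.hasDerivAt.add_const c)
  rw [h1.deriv]
  by_cases h0 : x = 0
  · simp [h0, h.zero]
  · rw [hx, reduceBy_of_ne h h0, one_smul, sub_add_cancel, smul_inv_smul₀ h0]

/-- Comparison of the coefficients of x. At a resonance this is the obstruction to a holomorphic
solution. -/
theorem IsBriotBouquetSol.deriv_zero (h : IsBriotBouquet Φ) {w : ℂ → Fin 2 → ℂ}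
    (hw : IsBriotBouquetSol Φ w) :
    xCoeff Φ + (wMatrix Φ).mulVec (deriv w 0) = deriv w 0 := by
  have h1 : HasDerivAt (fun x : ℂ => x • deriv w x) ((0 : ℂ) • deriv (deriv w) 0 + (1 : ℂ) • deriv w 0) 0 :=
    (hasDerivAt_id (0 : ℂ)).smul hw.analyticAt.deriv.differentiableAt.hasDerivAt
  have h2 : HasDerivAt (fun x : ℂ => (x, w x)) ((1 : ℂ), deriv w 0) 0 :=
    (hasDerivAt_id (0 : ℂ)).prodMk hw.analyticAt.differentiableAt.hasDerivAt
  have h3 : HasFDerivAt (fun q : ℂ × (Fin 2 → ℂ) => Φ q.1 q.2)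
      (fderiv ℂ (fun q : ℂ × (Fin 2 → ℂ) => Φ q.1 q.2) 0) ((0 : ℂ), w 0) := by
    rw [hw.zero]; exact h.analyticAt.differentiableAt.hasFDerivAt
  have h4 := HasFDerivAt.comp_hasDerivAt (l := fun q : ℂ × (Fin 2 → ℂ) => Φ q.1 q.2)
    (f := fun x : ℂ => (x, w x)) 0 h3 h2
  have h5 := h4.unique (h1.congr_of_eventuallyEq (hw.ode.mono fun x hx => hx.symm))
  rw [h.fderiv_eq] at h5
  simpa using h5

theorem IsBriotBouquetSol.exists_reduceBy (h : IsBriotBouquet Φ) {w : ℂ → Fin 2 → ℂ}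
    (hw : IsBriotBouquetSol Φ w) :
    IsBriotBouquetSol (reduceBy Φ (deriv w 0)) (fun x => dslope w 0 x - deriv w 0) := by
  set c := deriv w 0 with hc
  have hds : AnalyticAt ℂ (dslope w 0) 0 := by
    obtain ⟨p, hp⟩ := hw.analyticAt
    exact hp.has_fpower_series_dslope_fslope.analyticAt
  have hwt : AnalyticAt ℂ (fun x => dslope w 0 x - c) 0 := hds.sub analyticAt_const
  refine ⟨hwt, by simp [hc], ?_⟩
  have hw_eq : ∀ x, w x = x • ((dslope w 0 x - c) + c) := fun x => by
    have := sub_smul_dslope w 0 x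
    rw [sub_zero, hw.zero, sub_zero] at this
    rw [sub_add_cancel, this]
  filter_upwards [hw.ode, hwt.eventually_analyticAt] with x hx hxa
  by_cases h0 : x = 0
  · have h1 : dslope w 0 0 - c = 0 := by simp [hc]
    subst h0
    rw [zero_smul, h1]
    exact (isBriotBouquet_reduceBy h (hw.deriv_zero h)).zero.symm
  · have h1 : HasDerivAt (fun x => x • ((dslope w 0 x - c) + c))
        (x • deriv (fun x => dslope w 0 x - c) x + (1 : ℂ) • (dslope w 0 x - c + c)) x :=
      (hasDerivAt_id x).smul (hxa.differentiableAt.hasDerivAt.add_const c)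
    have h2 : deriv w x = x • deriv (fun x => dslope w 0 x - c) x + (dslope w 0 x - c + c) := by
      rw [← one_smul ℂ (dslope w 0 x - c + c), ← h1.deriv]
      congr 1
      funext y; exact hw_eq y
    rw [reduceBy_of_ne h h0, ← hw_eq, ← hx, inv_smul_smul₀ h0, h2]
    abel

/-- Uniqueness of the holomorphic solution in the absence of resonances. -/
theorem IsBriotBouquetSol.eventuallyEq (h : IsBriotBouquet Φ)
    (hA : ∀ m : ℕ, 1 ≤ m → ((m : ℂ) • 1 - wMatrix Φ).det ≠ 0) {w w' : ℂ → Fin 2 → ℂ}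
    (hw : IsBriotBouquetSol Φ w) (hw' : IsBriotBouquetSol Φ w') : w =ᶠ[𝓝 0] w' := by
  have hφ : AnalyticAt ℂ (fun x => w x - w' x) 0 := hw.analyticAt.sub hw'.analyticAt
  have hst := hasStrictFDerivAt_iff_isLittleO.1 h.analyticAt.hasStrictFDerivAt
  have ht : Tendsto (fun x : ℂ => ((x, w x), (x, w' x))) (𝓝 0) (𝓝 (0, 0)) := by
    have h1 : ContinuousAt (fun x : ℂ => ((x, w x), (x, w' x))) 0 := by
      have := hw.analyticAt.continuousAt
      have := hw'.analyticAt.continuousAt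
      fun_prop
    have h2 := h1.tendsto
    rw [hw.zero, hw'.zero] at h2
    exact h2
  have ho := hst.comp_tendsto ht
  let A : (Fin 2 → ℂ) →L[ℂ] (Fin 2 → ℂ) := (Matrix.mulVecLin (wMatrix Φ)).toContinuousLinearMap
  -- Strict differentiability of Φ at the origin linearizes the equation for the difference, with an
  -- error small relative to the difference itself.
  have ho' : (fun x => x • deriv (fun x => w x - w' x) x - A (w x - w' x)) =o[𝓝 0]
      fun x => w x - w' x := by
    refine (ho.congr' (f₂ := fun x => x • deriv (fun x => w x - w' x) x - A (w x - w' x))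
      (g₂ := fun x => ((0 : ℂ), w x - w' x)) ?_ ?_).trans_isBigO ?_
    · filter_upwards [hw.ode, hw'.ode, hw.analyticAt.eventually_analyticAt,
        hw'.analyticAt.eventually_analyticAt] with x h1 h2 h3 h4
      have h5 : deriv (fun x => w x - w' x) x = deriv w x - deriv w' x :=
        (h3.differentiableAt.hasDerivAt.sub h4.differentiableAt.hasDerivAt).deriv
      rw [h5, smul_sub, h1, h2]
      have h6 : ((x, w x) : ℂ × (Fin 2 → ℂ)) - (x, w' x) = (0, w x - w' x) := by simp
      simp only [Function.comp, h6, h.fderiv_eq, zero_smul, zero_add]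
      rfl
    · exact Eventually.of_forall fun x => by simp
    · exact Asymptotics.IsBigO.of_bound 1 (Eventually.of_forall fun x => by simp)
  rcases eventually_eq_zero_or_leading_eigenvector hφ A ho' with h1 | ⟨n, g, hg, hg0, hφg, hn⟩
  · exact h1.mono fun x hx => sub_eq_zero.1 hx
  · exfalso
    have hn1 : 1 ≤ n := by
      by_contra hlt
      have h0 : n = 0 := by omega
      have h2 := hφg.self_of_nhds
      rw [h0, hw.zero, hw'.zero, pow_zero, one_smul, sub_self] at h2
      exact hg0 h2.symm
    refine hA n hn1 (Matrix.exists_mulVec_eq_zero_iff.1 ⟨g 0, hg0, ?_⟩)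
    rw [Matrix.sub_mulVec, Matrix.smul_mulVec, Matrix.one_mulVec, hn]
    exact sub_self _

/-- Adding Nw to both sides gives xw' + Nw = Φ + Nw, whose right side has linear part A in w. This
is the Euler equation with p = N - 1, m = 1, e = N, and ‖A‖ ≤ N < e + 1. -/
theorem exists_isBriotBouquetSol_of_dominated (h : IsBriotBouquet Φ)
    (A : Matrix (Fin 2) (Fin 2) ℂ) (N : ℕ) (hΦ : wMatrix Φ = A - (N : ℂ) • 1)
    (hN : ‖(Matrix.mulVecLin A).toContinuousLinearMap‖ ≤ N) : ∃ w, IsBriotBouquetSol Φ w := by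
  let B : ℂ × (Fin 2 → ℂ) →L[ℂ] (Fin 2 → ℂ) := (N : ℂ) • ContinuousLinearMap.snd ℂ ℂ (Fin 2 → ℂ)
  let R : ℂ × (Fin 2 → ℂ) → Fin 2 → ℂ := fun q => Φ q.1 q.2 + B q
  have hR : AnalyticAt ℂ R 0 := h.analyticAt.add (B.analyticAt 0)
  have hR0 : (fun x : ℂ => R (x, 0)) =O[𝓝 0] fun x : ℂ => ‖x‖ ^ 1 := by
    have h1 : DifferentiableAt ℂ (fun x : ℂ => R (x, 0)) 0 :=
      DifferentiableAt.comp (g := R) (f := fun x : ℂ => (x, (0 : Fin 2 → ℂ))) 0 hR.differentiableAt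
        (by fun_prop)
    have h2 := h1.isBigO_sub
    have h3 : R (0, 0) = 0 := by simp [R, B, h.zero]
    simp only [h3, sub_zero] at h2
    simpa using h2.norm_right
  obtain ⟨w, hw, hwO, hode⟩ := exists_euler_solution (R := R) (p := (N : ℤ) - 1) (m := 1) (e := N)
    (fun f r hr hf => hf.analyticAt_one hr) one_ne_zero (by push_cast; ring) hR hR0 (by
      refine lt_of_le_of_lt (le_of_eq_of_le (congrArg norm ?_) hN) (lt_add_one _)
      have h1 : HasFDerivAt R (fderiv ℂ (fun q : ℂ × (Fin 2 → ℂ) => Φ q.1 q.2) 0 + B) 0 :=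
        h.analyticAt.differentiableAt.hasFDerivAt.add B.hasFDerivAt
      rw [h1.fderiv]
      ext1 v
      simp only [ContinuousLinearMap.comp_apply, _root_.add_apply, ContinuousLinearMap.inr_apply,
        h.fderiv_eq, zero_smul, zero_add, hΦ, Matrix.sub_mulVec, Matrix.smul_mulVec,
        Matrix.one_mulVec, B, _root_.smul_apply, ContinuousLinearMap.coe_snd', sub_add_cancel]
      rfl)
  have hw0 : w 0 = 0 := by
    have h1 : w =O[𝓝 0] fun u => ‖u - 0‖ ^ 1 := by simpa using hwO
    exact h1.eq_zero_of_norm_pow one_ne_zero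
  refine ⟨w, hw, hw0, ?_⟩
  filter_upwards [hode] with x hx
  have h1 : fderiv ℂ w x x = x • deriv w x := by
    rw [fderiv_eq_smul_deriv]
  rw [← h1, hx]
  simp [R, B]

end BriotBouquet

/-! ### Iterated reduction and resonance -/

section Reduction

variable {Φ : ℂ → (Fin 2 → ℂ) → Fin 2 → ℂ} {N : ℕ}

theorem xCoeff_add_wMatrix_mulVec (hdet : (1 - wMatrix Φ).det ≠ 0) :
    xCoeff Φ + (wMatrix Φ).mulVec ((1 - wMatrix Φ)⁻¹.mulVec (xCoeff Φ)) =
      (1 - wMatrix Φ)⁻¹.mulVec (xCoeff Φ) := by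
  set c := (1 - wMatrix Φ)⁻¹.mulVec (xCoeff Φ) with hc
  have h1 : (1 - wMatrix Φ).mulVec c = xCoeff Φ := by
    rw [hc, Matrix.mulVec_mulVec, Matrix.mul_nonsing_inv _ (isUnit_iff_ne_zero.2 hdet),
      Matrix.one_mulVec]
  rw [Matrix.sub_mulVec, Matrix.one_mulVec] at h1
  rw [← h1]; abel

theorem IsBriotBouquet.iterate_reduce (h : IsBriotBouquet Φ)
    (hA : ∀ m : ℕ, 1 ≤ m → m ≤ N → ((m : ℂ) • 1 - wMatrix Φ).det ≠ 0) :
    IsBriotBouquet (reduce^[N] Φ) ∧ wMatrix (reduce^[N] Φ) = wMatrix Φ - (N : ℂ) • 1 := by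
  induction N with
  | zero => simpa using h
  | succ k ih =>
    obtain ⟨h1, h2⟩ := ih fun m hm hmk => hA m hm (hmk.trans (Nat.le_succ k))
    have hdet : (1 - wMatrix (reduce^[k] Φ)).det ≠ 0 := by
      rw [h2]
      have := hA (k + 1) (Nat.le_add_left 1 k) le_rfl
      push_cast at this
      rw [add_smul, one_smul] at this
      convert this using 2
      abel
    rw [Function.iterate_succ_apply', reduce_eq_reduceBy]
    refine ⟨isBriotBouquet_reduceBy h1 (xCoeff_add_wMatrix_mulVec hdet), ?_⟩
    rw [wMatrix_reduceBy h1, h2]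
    push_cast
    rw [add_smul, one_smul]
    abel

theorem eventuallyEq_of_smul_add {w w' : ℂ → Fin 2 → ℂ} {c : Fin 2 → ℂ} (h0 : w 0 = w' 0)
    (h : (fun x => x • (w x + c)) =ᶠ[𝓝 0] fun x => x • (w' x + c)) : w =ᶠ[𝓝 0] w' := by
  filter_upwards [h] with x hx
  by_cases hx0 : x = 0
  · rw [hx0, h0]
  · exact add_right_cancel (smul_right_injective _ hx0 hx)

/-- Solution germs of the reduced system embed into those of the original system. -/
theorem exists_lift_iterate_reduce (h : IsBriotBouquet Φ)
    (hA : ∀ m : ℕ, 1 ≤ m → m ≤ N → ((m : ℂ) • 1 - wMatrix Φ).det ≠ 0) :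
    ∃ T : (ℂ → Fin 2 → ℂ) → ℂ → Fin 2 → ℂ, ∀ w, IsBriotBouquetSol (reduce^[N] Φ) w →
      IsBriotBouquetSol Φ (T w) ∧ ∀ w', IsBriotBouquetSol (reduce^[N] Φ) w' →
        T w =ᶠ[𝓝 0] T w' → w =ᶠ[𝓝 0] w' := by
  induction N with
  | zero => exact ⟨id, fun w hw => ⟨hw, fun w' _ h => h⟩⟩
  | succ k ih =>
    have hA' : ∀ m : ℕ, 1 ≤ m → m ≤ k → ((m : ℂ) • 1 - wMatrix Φ).det ≠ 0 :=
      fun m hm hmk => hA m hm (hmk.trans (Nat.le_succ k))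
    obtain ⟨T, hT⟩ := ih hA'
    have hk := (h.iterate_reduce hA').1
    set Ψ := reduce^[k] Φ with hΨ
    set c := (1 - wMatrix Ψ)⁻¹.mulVec (xCoeff Ψ) with hc
    have hstep : reduce^[k + 1] Φ = reduceBy Ψ c := by
      rw [Function.iterate_succ_apply', reduce_eq_reduceBy]
    rw [hstep]
    refine ⟨fun w => T fun x => x • (w x + c), fun w hw => ?_⟩
    have h1 := hT _ (IsBriotBouquetSol.of_reduceBy hk hw)
    refine ⟨h1.1, fun w' hw' hww => ?_⟩
    exact eventuallyEq_of_smul_add (hw.zero.trans hw'.zero.symm)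
      (h1.2 _ (IsBriotBouquetSol.of_reduceBy hk hw') hww)

theorem IsBriotBouquetSol.exists_iterate_reduce (h : IsBriotBouquet Φ)
    (hA : ∀ m : ℕ, 1 ≤ m → m ≤ N → ((m : ℂ) • 1 - wMatrix Φ).det ≠ 0) {w : ℂ → Fin 2 → ℂ}
    (hw : IsBriotBouquetSol Φ w) : ∃ w', IsBriotBouquetSol (reduce^[N] Φ) w' := by
  induction N with
  | zero => exact ⟨w, hw⟩
  | succ k ih =>
    have hA' : ∀ m : ℕ, 1 ≤ m → m ≤ k → ((m : ℂ) • 1 - wMatrix Φ).det ≠ 0 :=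
      fun m hm hmk => hA m hm (hmk.trans (Nat.le_succ k))
    obtain ⟨w', hw'⟩ := ih hA'
    obtain ⟨hk, hk2⟩ := h.iterate_reduce hA'
    have hdet : (1 - wMatrix (reduce^[k] Φ)).det ≠ 0 := by
      rw [hk2]
      have := hA (k + 1) (Nat.le_add_left 1 k) le_rfl
      push_cast at this
      rw [add_smul, one_smul] at this
      convert this using 2
      abel
    -- Without resonance the first coefficient is forced, so dividing by x leads to exactly the
    -- prescribed reduction step.
    have h1 : deriv w' 0 = (1 - wMatrix (reduce^[k] Φ))⁻¹.mulVec (xCoeff (reduce^[k] Φ)) := by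
      have h2 : xCoeff (reduce^[k] Φ) = (1 - wMatrix (reduce^[k] Φ)).mulVec (deriv w' 0) := by
        rw [Matrix.sub_mulVec, Matrix.one_mulVec]
        exact eq_sub_of_add_eq (hw'.deriv_zero hk)
      rw [h2, Matrix.mulVec_mulVec, Matrix.nonsing_inv_mul _ (isUnit_iff_ne_zero.2 hdet),
        Matrix.one_mulVec]
    have h3 := hw'.exists_reduceBy hk
    rw [h1] at h3
    rw [Function.iterate_succ_apply', reduce_eq_reduceBy]
    exact ⟨_, h3⟩

/-- Existence of a holomorphic solution in the absence of resonances. -/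
theorem IsBriotBouquet.exists_sol (h : IsBriotBouquet Φ)
    (hA : ∀ m : ℕ, 1 ≤ m → ((m : ℂ) • 1 - wMatrix Φ).det ≠ 0) : ∃ w, IsBriotBouquetSol Φ w := by
  obtain ⟨N, hN⟩ := exists_nat_ge ‖(Matrix.mulVecLin (wMatrix Φ)).toContinuousLinearMap‖
  have hA' : ∀ m : ℕ, 1 ≤ m → m ≤ N → ((m : ℂ) • 1 - wMatrix Φ).det ≠ 0 := fun m hm _ => hA m hm
  obtain ⟨h1, h2⟩ := h.iterate_reduce hA'
  obtain ⟨w, hw⟩ := exists_isBriotBouquetSol_of_dominated h1 (wMatrix Φ) N h2 hN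
  obtain ⟨T, hT⟩ := exists_lift_iterate_reduce h hA'
  exact ⟨T w, (hT w hw).1⟩

/-- At a resonance, every admissible first coefficient belongs to a solution. -/
theorem IsBriotBouquet.exists_sol_family (h : IsBriotBouquet Φ)
    (hA : ∀ m : ℕ, 2 ≤ m → ((m : ℂ) • 1 - wMatrix Φ).det ≠ 0) {c : ℂ → Fin 2 → ℂ}
    (hc : ∀ t, xCoeff Φ + (wMatrix Φ).mulVec (c t) = c t) (hinj : Function.Injective c) :
    ∃ f : ℂ → ℂ → Fin 2 → ℂ, (∀ t, IsBriotBouquetSol Φ (f t)) ∧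
      ∀ t t', f t =ᶠ[𝓝 0] f t' → t = t' := by
  have hex : ∀ t, ∃ w, IsBriotBouquetSol (reduceBy Φ (c t)) w := fun t => by
    -- The step with c t shifts the eigenvalues by -1, so a resonance at m would come from one at m
    -- + 1 ≥ 2, which `hA` excludes.
    refine (isBriotBouquet_reduceBy h (hc t)).exists_sol fun m hm => ?_
    rw [wMatrix_reduceBy h]
    have := hA (m + 1) (by omega)
    push_cast at this
    rw [add_smul, one_smul] at this
    convert this using 2
    abel
  choose w hw using hex
  refine ⟨fun t x => x • (w t x + c t), fun t => (hw t).of_reduceBy h, fun t t' htt => hinj ?_⟩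
  have hd : ∀ t, deriv (fun x => x • (w t x + c t)) 0 = c t := fun t => by
    have h1 : HasDerivAt (fun x : ℂ => x • (w t x + c t))
        ((0 : ℂ) • deriv (w t) 0 + (1 : ℂ) • (w t 0 + c t)) 0 :=
      (hasDerivAt_id (0 : ℂ)).smul ((hw t).analyticAt.differentiableAt.hasDerivAt.add_const (c t))
    rw [h1.deriv, (hw t).zero]
    simp
  rw [← hd t, ← hd t']
  exact htt.deriv_eq

end Reduction

/-! ### Invariant curves and Briot–Bouquet solutions -/

section Correspondence

variable {F : C3 → C3} {k : Fin 3} {lam : ℂ} {ψ : C3 → C3}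

theorem ext_succAbove (k : Fin 3) {p q : C3} (h : p k = q k)
    (h' : ∀ j : Fin 2, p (k.succAbove j) = q (k.succAbove j)) : p = q :=
  funext ((Fin.forall_iff_succAbove k).2 ⟨h, h'⟩)

theorem insertNth_one_zero (k : Fin 3) :
    (Fin.insertNth k (1 : ℂ) (0 : Fin 2 → ℂ) : C3) = Pi.single k 1 := by
  refine ext_succAbove k ?_ fun j => ?_
  · simp
  · simp [Fin.succAbove_ne]

theorem analyticAt_insertNth {E : Type*} [NormedAddCommGroup E] [NormedSpace ℂ E] (k : Fin 3)
    (a : ℂ) {w : E → Fin 2 → ℂ} {x : E} (hw : AnalyticAt ℂ w x) :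
    AnalyticAt ℂ (fun y => (Fin.insertNth k a (w y) : C3)) x := by
  refine AnalyticAt.pi ((Fin.forall_iff_succAbove k).2 ⟨?_, fun j => ?_⟩)
  · simp only [Fin.insertNth_apply_same]
    exact analyticAt_const
  · simp only [Fin.insertNth_apply_succAbove]
    exact ((ContinuousLinearMap.proj (R := ℂ) (φ := fun _ : Fin 2 => ℂ) j).analyticAt _).comp hw

theorem projL_singleton (k : Fin 3) (p : C3) : projL {k} p = p k • Pi.single k 1 := by
  refine ext_succAbove k ?_ fun j => ?_
  · simp [projL_apply]
  · simp [projL_apply, Fin.succAbove_ne]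

theorem projL_compl_singleton_succAbove (k : Fin 3) (p : C3) (j : Fin 2) :
    projL {k}ᶜ p (k.succAbove j) = p (k.succAbove j) := by
  simp [projL_apply, Fin.succAbove_ne]

theorem projL_compl_singleton_same (k : Fin 3) (p : C3) : projL {k}ᶜ p k = 0 := by
  simp [projL_apply]

theorem blowUp_zero_left (hF : AnalyticAt ℂ F 0) (w : Fin 2 → ℂ) :
    blowUp F k 0 w = fderiv ℂ F 0 (Fin.insertNth k (1 : ℂ) w : C3) := by
  rw [blowUp, dslope_same, deriv_comp_smul hF]

theorem smul_blowUp (hF0 : F 0 = 0) (x : ℂ) (w : Fin 2 → ℂ) :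
    x • blowUp F k x w = F (x • (Fin.insertNth k (1 : ℂ) w : C3)) := by
  have := sub_smul_dslope (fun s : ℂ => F (s • (Fin.insertNth k (1 : ℂ) w : C3))) 0 x
  rw [sub_zero, zero_smul, hF0, sub_zero] at this
  exact this

theorem analyticAt_blowUp (hF : AnalyticAt ℂ F 0) :
    AnalyticAt ℂ (fun q : ℂ × (Fin 2 → ℂ) => blowUp F k q.1 q.2) 0 :=
  AnalyticAt.comp (g := fun q : ℂ × C3 => dslope (fun s : ℂ => F (s • q.2)) 0 q.1)
    (f := fun q : ℂ × (Fin 2 → ℂ) => (q.1, (Fin.insertNth k (1 : ℂ) q.2 : C3)))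
    (analyticAt_dslope_smul hF _) (analyticAt_fst.prod (analyticAt_insertNth k 1 analyticAt_snd))

theorem blowUp_zero_zero (hF : AnalyticAt ℂ F 0)
    (hk : fderiv ℂ F 0 (Pi.single k 1) = lam • Pi.single k 1) :
    blowUp F k 0 0 = lam • Pi.single k 1 := by
  rw [blowUp_zero_left hF, insertNth_one_zero, hk]

theorem analyticAt_blowUp_apply (hF : AnalyticAt ℂ F 0) (i : Fin 3) :
    AnalyticAt ℂ (fun q : ℂ × (Fin 2 → ℂ) => blowUp F k q.1 q.2 i) 0 :=
  ((ContinuousLinearMap.proj (R := ℂ) (φ := fun _ : Fin 3 => ℂ) i).analyticAt _).comp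
    (analyticAt_blowUp hF)

theorem isBriotBouquet_briotBouquet (hF : AnalyticAt ℂ F 0) (hlam : lam ≠ 0)
    (hk : fderiv ℂ F 0 (Pi.single k 1) = lam • Pi.single k 1) :
    IsBriotBouquet (briotBouquet F k) := by
  have h0 := blowUp_zero_zero hF hk
  refine ⟨AnalyticAt.pi fun i => ?_, ?_⟩
  · refine ((analyticAt_blowUp_apply hF (k.succAbove i)).div (analyticAt_blowUp_apply hF k) ?_).sub
      (((ContinuousLinearMap.proj (R := ℂ) (φ := fun _ : Fin 2 => ℂ) i).analyticAt _).comp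
        analyticAt_snd)
    simpa [h0] using hlam
  · ext i
    simp [briotBouquet, h0, Fin.succAbove_ne]

theorem eventually_blowUp_ne_zero (hF : AnalyticAt ℂ F 0) (hlam : lam ≠ 0)
    (hk : fderiv ℂ F 0 (Pi.single k 1) = lam • Pi.single k 1) {w : ℂ → Fin 2 → ℂ}
    (hw : AnalyticAt ℂ w 0) (hw0 : w 0 = 0) : ∀ᶠ x in 𝓝 0, blowUp F k x (w x) k ≠ 0 := by
  have h1 : AnalyticAt ℂ (fun x => blowUp F k x (w x) k) 0 :=
    AnalyticAt.comp (g := fun q : ℂ × (Fin 2 → ℂ) => blowUp F k q.1 q.2 k)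
      (f := fun x => (x, w x)) (by rw [hw0]; exact analyticAt_blowUp_apply hF k)
      (analyticAt_id.prod hw)
  refine h1.continuousAt.eventually_ne ?_
  rw [hw0, blowUp_zero_zero hF hk]
  simpa using hlam

/-- For `x ≠ 0`, the Briot-Bouquet equation at `x` is the tangency of `F` to the curve. -/
theorem smul_eq_briotBouquet_iff (hF0 : F 0 = 0) {x : ℂ} (hx : x ≠ 0) {w w' : Fin 2 → ℂ}
    (hne : blowUp F k x w k ≠ 0) : x • w' = briotBouquet F k x w ↔
      ∀ j, F (x • (Fin.insertNth k (1 : ℂ) w : C3)) (k.succAbove j) =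
        F (x • (Fin.insertNth k (1 : ℂ) w : C3)) k * (w j + x * w' j) := by
  rw [funext_iff]
  refine forall_congr' fun j => ?_
  rw [← smul_blowUp hF0]
  simp only [briotBouquet, Pi.smul_apply, smul_eq_mul]
  rw [eq_sub_iff_add_eq, eq_div_iff hne, mul_assoc, mul_right_inj' hx, eq_comm, mul_comm, add_comm]

/-- Because ψ vanishes to second order, its transverse part along the axis can be divided by x and
the quotient still vanishes at 0. -/
theorem IsTangentGraph.exists_sol (h : IsTangentGraph F {k} ψ) (hF : AnalyticAt ℂ F 0)
    (hF0 : F 0 = 0) (hlam : lam ≠ 0)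
    (hk : fderiv ℂ F 0 (Pi.single k 1) = lam • Pi.single k 1) :
    ∃ w, IsBriotBouquetSol (briotBouquet F k) w ∧
      ∀ u, graphMap {k} ψ u = u k • (Fin.insertNth k (1 : ℂ) (w (u k)) : C3) := by
  let J : C3 →L[ℂ] (Fin 2 → ℂ) :=
    ContinuousLinearMap.pi fun j => ContinuousLinearMap.proj (k.succAbove j)
  let ζ : ℂ → Fin 2 → ℂ := fun x => J (ψ (x • Pi.single k 1))
  have hray : AnalyticAt ℂ (fun x : ℂ => x • (Pi.single k 1 : C3)) 0 :=
    analyticAt_id.smul analyticAt_const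
  have hζ : AnalyticAt ℂ ζ 0 := (J.analyticAt _).comp
    (AnalyticAt.comp (g := ψ) (f := fun x : ℂ => x • (Pi.single k 1 : C3))
      (by rw [zero_smul]; exact h.analyticAt) hray)
  have hζd : ∀ x : ℂ, DifferentiableAt ℂ ψ (x • Pi.single k 1) →
      HasDerivAt ζ (J (fderiv ℂ ψ (x • Pi.single k 1) (Pi.single k 1))) x := fun x hx => by
    have h1 : HasDerivAt (fun x : ℂ => x • (Pi.single k 1 : C3)) (Pi.single k 1) x := by
      simpa using (hasDerivAt_id x).smul_const (Pi.single k 1 : C3)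
    exact J.hasFDerivAt.comp_hasDerivAt x (HasFDerivAt.comp_hasDerivAt (l := ψ) x hx.hasFDerivAt h1)
  have hζ0 : ζ 0 = 0 := by simp [ζ, h.zero]
  have hζ1 : deriv ζ 0 = 0 := by
    rw [(hζd 0 (by rw [zero_smul]; exact h.analyticAt.differentiableAt)).deriv, zero_smul,
      h.fderiv_zero]
    simp
  set w := dslope ζ 0 with hwd
  have hw : AnalyticAt ℂ w 0 := by
    obtain ⟨p, hp⟩ := hζ
    exact hp.has_fpower_series_dslope_fslope.analyticAt
  have hw0 : w 0 = 0 := by rw [hwd, dslope_same, hζ1]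
  have hζw : ∀ x, ζ x = x • w x := fun x => by
    have := sub_smul_dslope ζ 0 x
    rw [sub_zero, hζ0, sub_zero] at this
    exact this.symm
  have hgraph : ∀ u, graphMap {k} ψ u = u k • (Fin.insertNth k (1 : ℂ) (w (u k)) : C3) := fun u => by
    refine ext_succAbove k ?_ fun j => ?_
    · simp [graphMap, projL_singleton, projL_compl_singleton_same]
    · have h1 := congrFun (hζw (u k)) j
      simp only [graphMap, projL_singleton, Pi.add_apply, projL_compl_singleton_succAbove]
      simp only [ζ, J, ContinuousLinearMap.coe_pi', ContinuousLinearMap.proj_apply] at h1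
      rw [h1]
      simp [Fin.succAbove_ne]
  refine ⟨w, ⟨hw, hw0, ?_⟩, hgraph⟩
  have hrt : Tendsto (fun x : ℂ => x • (Pi.single k 1 : C3)) (𝓝 0) (𝓝 0) := by
    simpa using hray.continuousAt.tendsto
  filter_upwards [hrt.eventually h.tangent, hrt.eventually h.analyticAt.eventually_analyticAt,
    hw.eventually_analyticAt, eventually_blowUp_ne_zero hF hlam hk hw hw0] with x h1 h2 h3 h4
  by_cases hx : x = 0
  · rw [hx, hw0, zero_smul, (isBriotBouquet_briotBouquet hF hlam hk).zero]
  · rw [smul_eq_briotBouquet_iff hF0 hx h4]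
    intro j
    have h5 := congrFun h1 (k.succAbove j)
    have hxk : (x • (Pi.single k 1 : C3)) k = x := by simp
    have hPx : projL {k} (x • (Pi.single k 1 : C3)) = x • Pi.single k 1 := by
      rw [projL_singleton, hxk]
    rw [projL_compl_singleton_succAbove, projL_compl_singleton_succAbove, hgraph, hxk, hPx,
      projL_singleton, map_smul, Pi.smul_apply, smul_eq_mul] at h5
    rw [h5]
    congr 1
    have h6 : HasDerivAt ζ (x • deriv w x + (1 : ℂ) • w x) x := by
      have := (hasDerivAt_id x).smul h3.differentiableAt.hasDerivAt
      exact this.congr_of_eventuallyEq (Eventually.of_forall hζw)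
    have h7 := congrFun ((hζd x h2.differentiableAt).unique h6) j
    simp only [J, ContinuousLinearMap.coe_pi', ContinuousLinearMap.proj_apply] at h7
    rw [h7]
    simp
    ring

/-- The graph of p ↦ p k • w(p k) in the transverse coordinates; w(0) = 0 makes it vanish to second
order. At p k = 0 tangency reduces to F(0) = 0. -/
theorem IsBriotBouquetSol.exists_isTangentGraph {w : ℂ → Fin 2 → ℂ}
    (hw : IsBriotBouquetSol (briotBouquet F k) w) (hF : AnalyticAt ℂ F 0)
    (hF0 : F 0 = 0) (hlam : lam ≠ 0)
    (hk : fderiv ℂ F 0 (Pi.single k 1) = lam • Pi.single k 1) :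
    ∃ ψ, IsTangentGraph F {k} ψ ∧
      ∀ u, graphMap {k} ψ u = u k • (Fin.insertNth k (1 : ℂ) (w (u k)) : C3) := by
  let pk : C3 →L[ℂ] ℂ := ContinuousLinearMap.proj k
  let g : ℂ → C3 := fun x => Fin.insertNth k 0 (w x)
  have hg : AnalyticAt ℂ g 0 := analyticAt_insertNth k 0 hw.analyticAt
  have hg0 : g 0 = 0 := by
    refine ext_succAbove k ?_ fun j => ?_ <;> simp [g, hw.zero]
  let η : ℂ → C3 := fun x => x • g x
  have hη : AnalyticAt ℂ η 0 := analyticAt_id.smul hg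
  have hηd : ∀ x, DifferentiableAt ℂ g x → HasDerivAt η (x • deriv g x + (1 : ℂ) • g x) x :=
    fun x hx => (hasDerivAt_id x).smul hx.hasDerivAt
  have hψd : ∀ p : C3, DifferentiableAt ℂ g (p k) →
      HasFDerivAt (fun p : C3 => η (pk p)) (pk.smulRight (p k • deriv g (p k) + (1 : ℂ) • g (p k))) p :=
    fun p hp => by
      have h1 := HasDerivAt.hasFDerivAt (hηd (p k) hp)
      refine (HasFDerivAt.comp (g := η) (f := pk) p h1 pk.hasFDerivAt).congr_fderiv ?_
      ext1 v
      simp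
  have hψ : AnalyticAt ℂ (fun p : C3 => η (pk p)) 0 :=
    AnalyticAt.comp (g := η) (by simpa using hη) (pk.analyticAt 0)
  have hgraph : ∀ u, graphMap {k} (fun p : C3 => η (pk p)) u =
      u k • (Fin.insertNth k (1 : ℂ) (w (u k)) : C3) := fun u => by
    refine ext_succAbove k ?_ fun j => ?_
    · simp [graphMap, projL_singleton, projL_compl_singleton_same]
    · simp [graphMap, projL_singleton, projL_compl_singleton_succAbove, Fin.succAbove_ne, η, g, pk]
  have hkt : Tendsto (fun u : C3 => u k) (𝓝 0) (𝓝 0) := (continuous_apply k).tendsto' _ _ rfl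
  refine ⟨fun p => η (pk p), ⟨hψ, by simp [η], ?_, ?_⟩, hgraph⟩
  · rw [(hψd 0 (by simpa using hg.differentiableAt)).fderiv]
    ext1 v
    simp [hg0]
  · filter_upwards [hkt.eventually hg.eventually_analyticAt, hkt.eventually hw.ode,
      hkt.eventually (eventually_blowUp_ne_zero hF hlam hk hw.analyticAt hw.zero),
      hkt.eventually hw.analyticAt.eventually_analyticAt] with u h1 h2 h3 h4
    have hPk : (projL {k} u) k = u k := by simp [projL_singleton]
    rw [(hψd _ (by rw [hPk]; exact h1.differentiableAt)).fderiv, hgraph, hPk]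
    by_cases hx : u k = 0
    · simp [hx, hF0]
    · rw [smul_eq_briotBouquet_iff hF0 hx h3] at h2
      refine ext_succAbove k ?_ fun j => ?_
      · simp [projL_compl_singleton_same]
      · have h5 : deriv g (u k) (k.succAbove j) = deriv w (u k) j := by
          have e1 := hasDerivAt_pi.1 h1.differentiableAt.hasDerivAt (k.succAbove j)
          have e2 := hasDerivAt_pi.1 h4.differentiableAt.hasDerivAt j
          simp only [g, Fin.insertNth_apply_succAbove] at e1
          exact e1.unique e2
        rw [projL_compl_singleton_succAbove, projL_compl_singleton_succAbove, h2 j]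
        simp [projL_singleton, h5, g, pk]
        exact Or.inl (by ring)

end Correspondence

/-! ### Center manifolds over a coordinate axis -/

section Axis

variable {F : C3 → C3} {k : Fin 3} {ω : ℝ} {M : Set C3}

theorem insertNth_one_single (k : Fin 3) (j : Fin 2) (s : ℂ) :
    (Fin.insertNth k (1 : ℂ) (Pi.single j s : Fin 2 → ℂ) : C3) =
      Pi.single k 1 + s • Pi.single (k.succAbove j) 1 := by
  refine ext_succAbove k ?_ fun i => ?_
  · simp [(Fin.succAbove_ne k j).symm]
  · simp [Fin.succAbove_ne, Pi.single_apply]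

/-- The k-th component of Λ applied to the other basis vectors only perturbs the denominator, while
the numerator is already of first order. Thus ε disappears from the matrix over the x-axis but
survives off the diagonal over the z-axis. -/
theorem wMatrix_briotBouquet {lam : ℂ} (hF : AnalyticAt ℂ F 0) (hlam : lam ≠ 0)
    (hk : fderiv ℂ F 0 (Pi.single k 1) = lam • Pi.single k 1) (i j : Fin 2) :
    wMatrix (briotBouquet F k) i j =
      fderiv ℂ F 0 (Pi.single (k.succAbove j) 1) (k.succAbove i) / lam -
        (1 : Matrix (Fin 2) (Fin 2) ℂ) i j := by
  set v := fderiv ℂ F 0 (Pi.single (k.succAbove j) 1) with hv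
  have h1 : (fun s : ℂ => briotBouquet F k 0 (Pi.single j s) i) = fun s =>
      s * v (k.succAbove i) / (lam + s * v k) - s * (1 : Matrix (Fin 2) (Fin 2) ℂ) i j := by
    funext s
    rw [briotBouquet, blowUp_zero_left hF, insertNth_one_single, map_add, map_smul, hk, ← hv]
    simp [Fin.succAbove_ne, Pi.single_apply, Matrix.one_apply]
  have h2 : HasDerivAt (fun s : ℂ => s * v (k.succAbove i) / (lam + s * v k) -
      s * (1 : Matrix (Fin 2) (Fin 2) ℂ) i j)
      ((1 * v (k.succAbove i) * (lam + 0 * v k) - 0 * v (k.succAbove i) * (1 * v k)) /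
        (lam + 0 * v k) ^ 2 - 1 * (1 : Matrix (Fin 2) (Fin 2) ℂ) i j) 0 :=
    (((hasDerivAt_id (0 : ℂ)).mul_const _).div (((hasDerivAt_id (0 : ℂ)).mul_const _).const_add _)
      (by simpa using hlam)).sub ((hasDerivAt_id (0 : ℂ)).mul_const _)
  rw [wMatrix, Matrix.of_apply, h1, h2.deriv]
  congr 1
  · simp only [zero_mul, add_zero, sub_zero, one_mul]
    rw [sq, mul_div_mul_right _ _ hlam]
  · rw [one_mul]

theorem IsCenterManifold.exists_sol (hM : IsCenterManifold F {k} M) (hF : AnalyticAt ℂ F 0)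
    (hF0 : F 0 = 0) (hω : ω ≠ 0)
    (hk : fderiv ℂ F 0 (Pi.single k 1) = (I * ω) • Pi.single k 1) :
    ∃ w, IsBriotBouquetSol (briotBouquet F k) w ∧
      ∀ᶠ p in 𝓝 (0 : C3), p ∈ M ↔ p k • (Fin.insertNth k (1 : ℂ) (w (p k)) : C3) = p := by
  obtain ⟨ψ, hψ, h⟩ := (isCenterManifold_iff hF).1 hM
  obtain ⟨w, hw, hg⟩ := hψ.exists_sol hF hF0 (mul_ne_zero I_ne_zero (ofReal_ne_zero.2 hω)) hk
  exact ⟨w, hw, h.mono fun p hp => by rw [hp, hg]⟩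

theorem IsBriotBouquetSol.isCenterManifold {w : ℂ → Fin 2 → ℂ}
    (hw : IsBriotBouquetSol (briotBouquet F k) w) (hF : AnalyticAt ℂ F 0)
    (hF0 : F 0 = 0) (hω : ω ≠ 0)
    (hk : fderiv ℂ F 0 (Pi.single k 1) = (I * ω) • Pi.single k 1) :
    IsCenterManifold F {k} {p | p k • (Fin.insertNth k (1 : ℂ) (w (p k)) : C3) = p} := by
  obtain ⟨ψ, hψ, hg⟩ :=
    hw.exists_isTangentGraph hF hF0 (mul_ne_zero I_ne_zero (ofReal_ne_zero.2 hω)) hk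
  have := hψ.isCenterManifold hF
  simpa only [hg] using this

theorem IsCenterManifold.hasIsochronousCenterFamily (hM : IsCenterManifold F {k} M)
    (hF : AnalyticAt ℂ F 0) (hF0 : F 0 = 0) (hω : ω ≠ 0)
    (hk : fderiv ℂ F 0 (Pi.single k 1) = (I * ω) • Pi.single k 1) :
    HasIsochronousCenterFamily F M (2 * Real.pi / |ω|) := by
  obtain ⟨ψ, hψ, h⟩ := (isCenterManifold_iff hF).1 hM
  refine hψ.hasIsochronousCenterFamily hF hF0 hω (fun v => ?_) h
  rw [projL_singleton, map_smul, hk, smul_comm]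

theorem eventually_apply_coord {P : ℂ → Prop} (k : Fin 3) (h : ∀ᶠ x in 𝓝 (0 : ℂ), P x) :
    ∀ᶠ p in 𝓝 (0 : C3), P (p k) :=
  ((continuous_apply k).tendsto' (0 : C3) 0 rfl).eventually h

/-- The germ of the manifold determines the germ of the solution. -/
theorem IsBriotBouquetSol.eventuallyEq_of_curve {Φ : ℂ → (Fin 2 → ℂ) → Fin 2 → ℂ}
    {w w' : ℂ → Fin 2 → ℂ} (hw : IsBriotBouquetSol Φ w) (hw' : IsBriotBouquetSol Φ w')
    (h : ∀ᶠ p in 𝓝 (0 : C3), p k • (Fin.insertNth k (1 : ℂ) (w (p k)) : C3) = p ↔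
      p k • (Fin.insertNth k (1 : ℂ) (w' (p k)) : C3) = p) : w =ᶠ[𝓝 0] w' := by
  have ht : Tendsto (fun x : ℂ => x • (Fin.insertNth k (1 : ℂ) (w x) : C3)) (𝓝 0) (𝓝 0) := by
    have : ContinuousAt (fun x : ℂ => x • (Fin.insertNth k (1 : ℂ) (w x) : C3)) 0 :=
      continuousAt_id.smul (analyticAt_insertNth k 1 hw.analyticAt).continuousAt
    simpa [ContinuousAt] using this
  filter_upwards [ht.eventually h] with x hx
  have hxk : (x • (Fin.insertNth k (1 : ℂ) (w x) : C3)) k = x := by simp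
  rw [hxk] at hx
  have h1 := hx.1 rfl
  by_cases hx0 : x = 0
  · rw [hx0, hw.zero, hw'.zero]
  · have h2 := smul_right_injective C3 hx0 h1
    funext j
    have := congrFun h2 (k.succAbove j)
    simpa using this.symm

theorem hasUniqueIsochronousCenterManifold_axis (hF : AnalyticAt ℂ F 0) (hF0 : F 0 = 0)
    (hω : ω ≠ 0) (hk : fderiv ℂ F 0 (Pi.single k 1) = (I * ω) • Pi.single k 1)
    (hA : ∀ m : ℕ, 1 ≤ m → ((m : ℂ) • 1 - wMatrix (briotBouquet F k)).det ≠ 0) :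
    HasUniqueIsochronousCenterManifold F {k} (2 * Real.pi / |ω|) := by
  have hΦ := isBriotBouquet_briotBouquet hF (mul_ne_zero I_ne_zero (ofReal_ne_zero.2 hω)) hk
  obtain ⟨w, hw⟩ := hΦ.exists_sol hA
  have hM := hw.isCenterManifold hF hF0 hω hk
  refine ⟨_, hM, hM.hasIsochronousCenterFamily hF hF0 hω hk, fun M' hM' => ?_⟩
  obtain ⟨w', hw', h'⟩ := hM'.exists_sol hF hF0 hω hk
  refine eventuallyEq_set.2 ?_
  filter_upwards [h', eventually_apply_coord k (hw'.eventuallyEq hΦ hA hw)] with p h1 h2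
  rw [h1, h2]

theorem not_isCenterManifold_axis (hF : AnalyticAt ℂ F 0) (hF0 : F 0 = 0)
    (hω : ω ≠ 0) (hk : fderiv ℂ F 0 (Pi.single k 1) = (I * ω) • Pi.single k 1) {N : ℕ}
    (hA : ∀ m : ℕ, 1 ≤ m → m ≤ N → ((m : ℂ) • 1 - wMatrix (briotBouquet F k)).det ≠ 0)
    (hc : ∀ c, xCoeff (reduce^[N] (briotBouquet F k)) +
      (wMatrix (briotBouquet F k) - (N : ℂ) • 1).mulVec c ≠ c) (M : Set C3) :
    ¬ IsCenterManifold F {k} M := by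
  intro hM
  have hΦ := isBriotBouquet_briotBouquet hF (mul_ne_zero I_ne_zero (ofReal_ne_zero.2 hω)) hk
  obtain ⟨w, hw, -⟩ := hM.exists_sol hF hF0 hω hk
  obtain ⟨w', hw'⟩ := hw.exists_iterate_reduce hΦ hA
  obtain ⟨h1, h2⟩ := hΦ.iterate_reduce hA
  have := hw'.deriv_zero h1
  rw [h2] at this
  exact hc _ this

/-- The only admitted resonance N + 1 is moved to 1 by N reductions. Each parameter t then gives a
solution, and t can be recovered from the germ of the manifold: the germ determines the solution,
this one the reduced solution, and this one its first coefficient. -/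
theorem hasInfinitelyManyIsochronousCenterManifolds_axis (hF : AnalyticAt ℂ F 0) (hF0 : F 0 = 0)
    (hω : ω ≠ 0) (hk : fderiv ℂ F 0 (Pi.single k 1) = (I * ω) • Pi.single k 1) {N : ℕ}
    (hA : ∀ m : ℕ, 1 ≤ m → m ≠ N + 1 → ((m : ℂ) • 1 - wMatrix (briotBouquet F k)).det ≠ 0)
    {c : ℂ → Fin 2 → ℂ} (hc : ∀ t, xCoeff (reduce^[N] (briotBouquet F k)) +
      (wMatrix (briotBouquet F k) - (N : ℂ) • 1).mulVec (c t) = c t)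
    (hinj : Function.Injective c) :
    HasInfinitelyManyIsochronousCenterManifolds F {k} (2 * Real.pi / |ω|) := by
  have hΦ := isBriotBouquet_briotBouquet hF (mul_ne_zero I_ne_zero (ofReal_ne_zero.2 hω)) hk
  have hA' : ∀ m : ℕ, 1 ≤ m → m ≤ N → ((m : ℂ) • 1 - wMatrix (briotBouquet F k)).det ≠ 0 :=
    fun m hm hmN => hA m hm (by omega)
  obtain ⟨h1, h2⟩ := hΦ.iterate_reduce hA'
  obtain ⟨f, hf, hff⟩ := h1.exists_sol_family (c := c) (fun m hm => by
    rw [h2]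
    have := hA (m + N) (by omega) (by omega)
    push_cast at this
    rw [add_smul] at this
    convert this using 2
    abel) (by rw [h2]; exact hc) hinj
  obtain ⟨T, hT⟩ := exists_lift_iterate_reduce hΦ hA'
  refine ⟨Set.infinite_of_injective_forall_mem (α := ℂ) (f := fun t =>
    ((fun p => p ∈ {p : C3 | p k • (Fin.insertNth k (1 : ℂ) (T (f t) (p k)) : C3) = p} :
      C3 → Prop) : Germ (𝓝 (0 : C3)) Prop)) (fun t t' htt => ?_) fun t =>
      ⟨_, (hT _ (hf t)).1.isCenterManifold hF hF0 hω hk, rfl⟩,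
    fun M hM => hM.hasIsochronousCenterFamily hF hF0 hω hk⟩
  refine hff t t' ((hT _ (hf t)).2 _ (hf t') ?_)
  refine (hT _ (hf t)).1.eventuallyEq_of_curve (k := k) (hT _ (hf t')).1 ?_
  filter_upwards [Germ.coe_eq.1 htt] with p hp
  exact iff_of_eq hp

end Axis

/-! ### The matrices of the two axes, and the theorem -/

section LinearPart

variable {F : C3 → C3} {ω₁ ω₂ : ℝ} {ε : ℂ}

theorem wMatrix_briotBouquet_zero (hF : AnalyticAt ℂ F 0) (hω₁ : ω₁ ≠ 0)
    (hx : fderiv ℂ F 0 (Pi.single 0 1) = (I * ω₁) • Pi.single 0 1)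
    (hy : fderiv ℂ F 0 (Pi.single 1 1) = (I * ω₁) • Pi.single 1 1 + ε • Pi.single 0 1)
    (hz : fderiv ℂ F 0 (Pi.single 2 1) = (I * ω₂) • Pi.single 2 1) :
    wMatrix (briotBouquet F 0) = !![0, 0; 0, ((ω₂ / ω₁ : ℝ) : ℂ) - 1] := by
  have hlam : (I * ω₁ : ℂ) ≠ 0 := mul_ne_zero I_ne_zero (ofReal_ne_zero.2 hω₁)
  have s0 : (0 : Fin 3).succAbove (0 : Fin 2) = 1 := rfl
  have s1 : (0 : Fin 3).succAbove (1 : Fin 2) = 2 := rfl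
  ext i j
  rw [wMatrix_briotBouquet hF hlam hx]
  fin_cases i <;> fin_cases j <;>
    simp [s0, s1, hy, hz, hω₁, mul_div_mul_left _ _ I_ne_zero]

theorem wMatrix_briotBouquet_two (hF : AnalyticAt ℂ F 0) (hω₂ : ω₂ ≠ 0)
    (hx : fderiv ℂ F 0 (Pi.single 0 1) = (I * ω₁) • Pi.single 0 1)
    (hy : fderiv ℂ F 0 (Pi.single 1 1) = (I * ω₁) • Pi.single 1 1 + ε • Pi.single 0 1)
    (hz : fderiv ℂ F 0 (Pi.single 2 1) = (I * ω₂) • Pi.single 2 1) :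
    wMatrix (briotBouquet F 2) =
      !![((ω₁ / ω₂ : ℝ) : ℂ) - 1, ε / (I * ω₂); 0, ((ω₁ / ω₂ : ℝ) : ℂ) - 1] := by
  have hlam : (I * ω₂ : ℂ) ≠ 0 := mul_ne_zero I_ne_zero (ofReal_ne_zero.2 hω₂)
  have s0 : (2 : Fin 3).succAbove (0 : Fin 2) = 0 := rfl
  have s1 : (2 : Fin 3).succAbove (1 : Fin 2) = 1 := rfl
  ext i j
  rw [wMatrix_briotBouquet hF hlam hz]
  fin_cases i <;> fin_cases j <;>
    simp [s0, s1, hx, hy, mul_div_mul_left _ _ I_ne_zero]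

theorem det_smul_one_sub_diag (m r : ℂ) :
    (m • 1 - !![0, 0; 0, r - 1] : Matrix (Fin 2) (Fin 2) ℂ).det = m * (m + 1 - r) := by
  rw [Matrix.det_fin_two]
  simp
  exact Or.inl (by ring)

theorem det_smul_one_sub_jordan (m r a : ℂ) :
    (m • 1 - !![r - 1, a; 0, r - 1] : Matrix (Fin 2) (Fin 2) ℂ).det = (m + 1 - r) ^ 2 := by
  rw [Matrix.det_fin_two]
  simp
  ring

theorem natCast_add_one_sub_ofReal_ne_zero {m : ℕ} {r : ℝ} (h : r ≠ (m + 1 : ℕ)) :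
    (m : ℂ) + 1 - r ≠ 0 := by
  rw [sub_ne_zero]
  exact_mod_cast h.symm

end LinearPart

/-- Here `ℕ` contains 0, which changes nothing in the second and third claims, since the quotient of
the frequencies is not 0. -/
theorem theoremT (F : C3 → C3) (hF : AnalyticAt ℂ F 0) (hF0 : F 0 = 0)
    (ω₁ ω₂ : ℝ) (hω₁ : ω₁ ≠ 0) (hω₂ : ω₂ ≠ 0) (ε : ℂ) (hε : ε ≠ 0)
    (hx : fderiv ℂ F 0 (Pi.single 0 1) = (I * ω₁) • Pi.single 0 1)
    (hy : fderiv ℂ F 0 (Pi.single 1 1) = (I * ω₁) • Pi.single 1 1 + ε • Pi.single 0 1)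
    (hz : fderiv ℂ F 0 (Pi.single 2 1) = (I * ω₂) • Pi.single 2 1) :
    (∀ M : Set C3, ¬ IsCenterManifold F {1} M) ∧
    ((¬ ∃ n : ℕ, ω₂ / ω₁ = n) →
      HasUniqueIsochronousCenterManifold F {0} (2 * Real.pi / |ω₁|)) ∧
    ((¬ ∃ n : ℕ, ω₁ / ω₂ = n) →
      HasUniqueIsochronousCenterManifold F {2} (2 * Real.pi / |ω₂|)) ∧
    (ω₁ = ω₂ →
      HasUniqueIsochronousCenterManifold F {0, 2} (2 * Real.pi / |ω₁|)) ∧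
    (∀ n : ℕ, 2 ≤ n → ω₂ / ω₁ = n →
      (rBar F 0 n = 0 →
        HasInfinitelyManyIsochronousCenterManifolds F {0} (2 * Real.pi / |ω₁|)) ∧
      (rBar F 0 n ≠ 0 → ∀ M : Set C3, ¬ IsCenterManifold F {0} M)) ∧
    (∀ n : ℕ, 2 ≤ n → ω₁ / ω₂ = n →
      (rBar F 2 n = 0 →
        HasInfinitelyManyIsochronousCenterManifolds F {2} (2 * Real.pi / |ω₂|)) ∧
      (rBar F 2 n ≠ 0 → ∀ M : Set C3, ¬ IsCenterManifold F {2} M)) := by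
  have hA₀ := wMatrix_briotBouquet_zero hF hω₁ hx hy hz
  have hA₂ := wMatrix_briotBouquet_two hF hω₂ hx hy hz
  have hω₂' : (ω₂ : ℂ) ≠ 0 := ofReal_ne_zero.2 hω₂
  have hdet₀ : ∀ m : ℕ, 1 ≤ m → ω₂ / ω₁ ≠ (m + 1 : ℕ) →
      ((m : ℂ) • 1 - wMatrix (briotBouquet F 0)).det ≠ 0 := fun m hm hr => by
    rw [hA₀, det_smul_one_sub_diag]
    exact mul_ne_zero (by exact_mod_cast (by omega : m ≠ 0)) (natCast_add_one_sub_ofReal_ne_zero hr)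
  have hdet₂ : ∀ m : ℕ, ω₁ / ω₂ ≠ (m + 1 : ℕ) →
      ((m : ℂ) • 1 - wMatrix (briotBouquet F 2)).det ≠ 0 := fun m hr => by
    rw [hA₂, det_smul_one_sub_jordan]
    exact pow_ne_zero 2 (natCast_add_one_sub_ofReal_ne_zero hr)
  refine ⟨fun M hM => ?_, fun hr => ?_, fun hr => ?_, fun h12 => ?_, fun n hn hr => ?_,
    fun n hn hr => ?_⟩
  · obtain ⟨ψ, hψ, -⟩ := (isCenterManifold_iff hF).1 hM
    -- Invariance of the y-axis under Λ would make the x-component of Λe_y, which is ε, vanish.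
    have h := congrFun (hψ.projL_compl_fderiv hF hF0 (Pi.single 1 1)) 0
    rw [projL_singleton, Pi.single_eq_same, one_smul, hy] at h
    exact hε (by simpa [projL_apply] using h)
  · exact hasUniqueIsochronousCenterManifold_axis hF hF0 hω₁ hx fun m hm =>
      hdet₀ m hm fun h => hr ⟨_, h⟩
  · exact hasUniqueIsochronousCenterManifold_axis hF hF0 hω₂ hz fun m _ =>
      hdet₂ m fun h => hr ⟨_, h⟩
  · have hv : ∀ v : C3, v = v 0 • Pi.single 0 1 + v 1 • Pi.single 1 1 + v 2 • Pi.single 2 1 :=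
      fun v => by ext i; fin_cases i <;> simp
    -- For equal frequencies Λ is a scalar plus a nilpotent map that sends e_y to a multiple of e_x.
    -- The latter vanishes on the (x,z)-plane and takes values in it.
    have hΛ : ∀ v, fderiv ℂ F 0 v = (I * ω₁) • v + (ε * v 1) • Pi.single 0 1 := fun v => by
      conv_lhs => rw [hv v]
      conv_rhs => rw [hv v]
      simp only [map_add, map_smul, hx, hy, hz, ← h12]
      ext i
      fin_cases i <;> simp <;> ring
    refine hasUniqueIsochronousCenterManifold_of_scalar hF hF0 hω₁ (fun v => ?_) fun v => ?_
    · rw [hΛ]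
      simp [projL_apply]
    · rw [hΛ]
      ext i
      fin_cases i <;> simp [projL_apply]
  · have hne : ∀ m : ℕ, m ≠ n - 2 + 1 → ω₂ / ω₁ ≠ (m + 1 : ℕ) := fun m hm h => by
      rw [hr, Nat.cast_inj] at h
      omega
    have hB : wMatrix (briotBouquet F 0) - ((n - 2 : ℕ) : ℂ) • 1 = !![(2 - n : ℂ), 0; 0, 1] := by
      rw [hA₀, hr]
      ext i j
      fin_cases i <;> fin_cases j <;> simp [Nat.cast_sub hn]
      ring
    have hn1 : (n : ℂ) - 1 ≠ 0 := by
      rw [sub_ne_zero]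
      exact_mod_cast (by omega : n ≠ 1)
    refine ⟨fun h0 => ?_, fun h0 => ?_⟩
    -- The rows of b + Ac = c are b₀ + (2 - n)c₀ = c₀ and b₁ + c₁ = c₁: the first fixes c₀ = b₀/(n -
    -- 1), the second needs b₁ = r̄ = 0 and leaves c₁ = t free.
    · refine hasInfinitelyManyIsochronousCenterManifolds_axis hF hF0 hω₁ hx (N := n - 2)
        (c := fun t => ![xCoeff (reduce^[n - 2] (briotBouquet F 0)) 0 / (n - 1), t])
        (fun m hm hm' => hdet₀ m hm (hne m hm')) (fun t => ?_) fun t t' h => congrFun h 1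
      rw [hB]
      rw [rBar] at h0
      ext i
      fin_cases i
      · simp [Matrix.vecHead, Matrix.vecTail]
        field_simp
        ring
      · simp [h0]
    · refine not_isCenterManifold_axis hF hF0 hω₁ hx (N := n - 2)
        (fun m hm hmn => hdet₀ m hm (hne m (by omega))) fun c hc => h0 ?_
      rw [hB] at hc
      simpa [rBar, Matrix.mulVec, Matrix.vecHead, Matrix.vecTail] using congrFun hc 1
  · have hne : ∀ m : ℕ, m ≠ n - 2 + 1 → ω₁ / ω₂ ≠ (m + 1 : ℕ) := fun m hm h => by
      rw [hr, Nat.cast_inj] at h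
      omega
    have hB : wMatrix (briotBouquet F 2) - ((n - 2 : ℕ) : ℂ) • 1 = !![1, ε / (I * ω₂); 0, 1] := by
      rw [hA₂, hr]
      ext i j
      fin_cases i <;> fin_cases j <;> simp [Nat.cast_sub hn] <;> ring
    refine ⟨fun h0 => ?_, fun h0 => ?_⟩
    -- Now the first row is b₀ + c₀ + (ε/(iω₂))c₁ = c₀. It fixes c₁, because ε ≠ 0, and leaves c₀ =
    -- t free; the second row again needs r̄ = 0.
    · refine hasInfinitelyManyIsochronousCenterManifolds_axis hF hF0 hω₂ hz (N := n - 2)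
        (c := fun t => ![t, -(xCoeff (reduce^[n - 2] (briotBouquet F 2)) 0 * (I * ω₂) / ε)])
        (fun m hm hm' => hdet₂ m (hne m hm')) (fun t => ?_) fun t t' h => congrFun h 0
      rw [hB]
      rw [rBar] at h0
      ext i
      fin_cases i
      · simp [Matrix.vecHead, Matrix.vecTail]
        field_simp
        ring
      · simp [h0]
    · refine not_isCenterManifold_axis hF hF0 hω₂ hz (N := n - 2)
        (fun m hm hmn => hdet₂ m (hne m (by omega))) fun c hc => h0 ?_
      rw [hB] at hc
      simpa [rBar, Matrix.mulVec, Matrix.vecHead, Matrix.vecTail] using congrFun hc 1
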